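/- Let $n\ge 0$ be an integer and let $\varepsilon>0$. A subset of $\mathbb{RP}^n$ is \emph{properly convex} if its intersection with every projective line is connected and its closure is contained in an affine patch (the complement of a projective hyperplane). A \emph{properly convex projective $n$-manifold} is a quotient $M=\Omega/\Gamma$, where $\Omega\subset\mathbb{RP}^n$ is open and properly convex and $\Gamma\subset PGL(n+1,\mathbb R)$ is a discrete torsion-free group preserving $\Omega$. The \emph{Hilbert metric} on $\Omega$ is $$d_\Omega(a,b)=\log\frac{\|b-x\|\,\|a-y\|}{\|b-y\|\,\|a-x\|}\qquad(a\neq b),$$ where $x,y\in\partial\Omega$ are the endpoints of the segment in $\Omega$ through $a$ and $b$, in the order $x,a,b,y$, the norms being computed in an affine patch containing $\overline\Omega$ (and $d_\Omega(a,a)=0$). The Hilbert metric on $M$ is the induced quotient metric: the distance between two points of $M$ is the infimum of the distances between their lifts to $\Omega$. The \emph{injectivity radius} $\operatorname{inj}(x)\in[0,\infty]$ of $M$ at $x$ is the supremum of the radii of the embedded metric balls centred at $x$, that is, of the $r\ge 0$ such that $\Omega\to M$ is injective on the open ball of radius $r$ about each lift of $x$. Let $\mathcal H$ be the set of isometry classes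 (by base-point-preserving isometries) of pointed metric spaces $(M,x)$, where $M$ is a properly convex projective $n$-manifold with the Hilbert metric, $x\in M$, and $\operatorname{inj}(x)\ge\varepsilon$. Then $\mathcal H$ is compact in the pointed Gromov--Hausdorff topology, i.e. the topology on isometry classes of pointed metric spaces in which a neighbourhood basis of $(X,x)$ is given, for $\delta>0$, by the $(Y,y)$ for which there is a relation $R\subset X\times Y$ with $(x,y)\in R$, such that every point at distance less than $1/\delta$ from $x$ (respectively from $y$) is related to a point of $Y$ (respectively of $X$), and $|d(a,a')-d(b,b')|<\delta$ whenever $(a,b),(a',b')\in R$. -/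

import Mathlib

open scoped MatrixGroups Topology Uniformity ENNReal NNReal LinearAlgebra.Projectivization

noncomputable section

namespace ConvexProjective

/-! ### Real projective space and its group of projective transformations -/

/-- Real projective `n`-space `ℝPⁿ`. -/
abbrev RP (n : ℕ) : Type := ℙ ℝ (Fin (n + 1) → ℝ)

/-- The group `PGL(n+1, ℝ)` of projective transformations of `ℝPⁿ`. -/
abbrev PGroup (n : ℕ) : Type := PGL(Fin (n + 1), ℝ)

/-- `ℝPⁿ` has the quotient topology of `ℝⁿ⁺¹ ∖ {0}`. -/
instance instTopologicalSpaceRP (n : ℕ) : TopologicalSpace (RP n) :=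
  TopologicalSpace.coinduced (Projectivization.mk' ℝ) inferInstance

/-- `PGL(n+1, ℝ)` has the quotient topology of `GL(n+1, ℝ)`. -/
instance instTopologicalSpacePGroup (n : ℕ) : TopologicalSpace (PGroup n) :=
  TopologicalSpace.coinduced (Matrix.ProjGenLinGroup.mk : GL (Fin (n + 1)) ℝ →* PGroup n)
    inferInstance

/-- The projective subspace `ℙ(U)` determined by a linear subspace `U` of `ℝⁿ⁺¹`.  It is a
projective line if `U` has dimension `2`. -/
def projSubspace {n : ℕ} (U : Submodule ℝ (Fin (n + 1) → ℝ)) : Set (RP n) :=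
  {p | p.submodule ≤ U}

/-- The complement of the projective hyperplane `φ = 0`; an affine patch if `φ ≠ 0`. -/
def affinePatch {n : ℕ} (φ : Module.Dual ℝ (Fin (n + 1) → ℝ)) : Set (RP n) :=
  {p | φ p.rep ≠ 0}

/-- The affine coordinate on the affine patch of `φ`: it sends a point to its representative
on the affine hyperplane `φ = 1` of `ℝⁿ⁺¹`. -/
def affineCoord {n : ℕ} (φ : Module.Dual ℝ (Fin (n + 1) → ℝ)) (p : RP n) : Fin (n + 1) → ℝ :=
  (φ p.rep)⁻¹ • p.rep

/-! ### Properly convex sets and the Hilbert metric -/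

/-- A subset of `ℝPⁿ` is convex if its intersection with every projective line is connected
(possibly empty). -/
def IsProjConvex {n : ℕ} (C : Set (RP n)) : Prop :=
  ∀ U : Submodule ℝ (Fin (n + 1) → ℝ), Module.finrank ℝ U = 2 →
    IsPreconnected (projSubspace U ∩ C)

/-- A subset of `ℝPⁿ` is properly convex if it is convex and its closure is contained in an
affine patch. -/
def IsProperlyConvex {n : ℕ} (C : Set (RP n)) : Prop :=
  IsProjConvex C ∧ ∃ φ : Module.Dual ℝ (Fin (n + 1) → ℝ), φ ≠ 0 ∧ closure C ⊆ affinePatch φ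

/-- `d` is the logarithm of the cross ratio
`(‖b - x‖ * ‖a - y‖) / (‖b - y‖ * ‖a - x‖)`, where `x, y` are the endpoints on the frontier of `Ω`
of the line segment through `a` and `b`, in the order `x, a, b, y`, computed in an affine patch
that contains the closure of `Ω`; and `d = 0` if `a = b`.  The norm is that of `ℝⁿ⁺¹`; the vectors
involved are parallel, so that the ratio depends neither on the norm nor on the patch. -/
def IsLogCrossRatio {n : ℕ} (Ω : Set (RP n)) (a b : RP n) (d : ℝ) : Prop :=
  (a = b ∧ d = 0) ∨
  (a ≠ b ∧ ∃ φ : Module.Dual ℝ (Fin (n + 1) → ℝ), φ ≠ 0 ∧ closure Ω ⊆ affinePatch φ ∧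
    ∃ x ∈ frontier Ω, ∃ y ∈ frontier Ω,
      Wbtw ℝ (affineCoord φ x) (affineCoord φ a) (affineCoord φ b) ∧
      Wbtw ℝ (affineCoord φ a) (affineCoord φ b) (affineCoord φ y) ∧
      d = Real.log
        ((‖affineCoord φ b - affineCoord φ x‖ * ‖affineCoord φ a - affineCoord φ y‖) /
          (‖affineCoord φ b - affineCoord φ y‖ * ‖affineCoord φ a - affineCoord φ x‖)))

/-- The Hilbert metric of an open properly convex set `Ω`, at points `a`, `b` of `Ω`: the set on
the right-hand side has exactly one element, the logarithm of the cross ratio. -/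
def hilbertDist {n : ℕ} (Ω : Set (RP n)) (a b : RP n) : ℝ :=
  sInf {d | IsLogCrossRatio Ω a b d}

/-! ### Properly convex projective manifolds -/

/-- The data of a properly convex projective `n`-manifold `Ω / Γ`: an open properly convex subset
`Ω` of `ℝPⁿ` and a discrete torsion-free group `Γ` of projective transformations preserving `Ω`. -/
structure ProperlyConvexManifold (n : ℕ) where
  Ω : Set (RP n)
  isOpen : IsOpen Ω
  properlyConvex : IsProperlyConvex Ω
  Γ : Subgroup (PGroup n)
  preserves : ∀ γ ∈ Γ, (fun p : RP n => γ • p) '' Ω = Ω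
  discrete : DiscreteTopology Γ
  torsionFree : ∀ γ ∈ Γ, IsOfFinOrder γ → γ = 1

namespace ProperlyConvexManifold

variable {n : ℕ}

/-- The equivalence relation on `Ω` whose classes are the orbits of `Γ`. -/
def orbitSetoid (M : ProperlyConvexManifold n) : Setoid M.Ω where
  r a b := ∃ γ ∈ M.Γ, γ • (a : RP n) = b
  iseqv :=
    { refl := fun a => ⟨1, M.Γ.one_mem, one_smul _ _⟩
      symm := by
        rintro a b ⟨γ, hγ, h⟩
        exact ⟨γ⁻¹, M.Γ.inv_mem hγ, by rw [← h, inv_smul_smul]⟩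
      trans := by
        rintro a b c ⟨γ, hγ, h⟩ ⟨δ, hδ, h'⟩
        exact ⟨δ * γ, M.Γ.mul_mem hδ hγ, by rw [mul_smul, h, h']⟩ }

/-- The points of the manifold `M = Ω / Γ`. -/
def Space (M : ProperlyConvexManifold n) : Type := Quotient M.orbitSetoid

/-- The covering projection `Ω → M = Ω / Γ`. -/
def proj (M : ProperlyConvexManifold n) (a : M.Ω) : M.Space := Quotient.mk M.orbitSetoid a

/-- The metric on `M = Ω / Γ` induced by the Hilbert metric of `Ω`: the distance between two
points is the infimum of the Hilbert distances between their lifts. -/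
def mDist (M : ProperlyConvexManifold n) (x y : M.Space) : ℝ :=
  sInf {d | ∃ a b : M.Ω, M.proj a = x ∧ M.proj b = y ∧ d = hilbertDist M.Ω a b}

/-- The ball of radius `r` centred at `x` in `M` is embedded: `Ω → M` is injective on the balls of
radius `r` (in the Hilbert metric) centred at the lifts of `x`. -/
def BallEmbedded (M : ProperlyConvexManifold n) (x : M.Space) (r : ℝ≥0) : Prop :=
  ∀ a : M.Ω, M.proj a = x → Set.InjOn M.proj {b : M.Ω | hilbertDist M.Ω a b < r}

/-- The injectivity radius of `M` at `x`: the supremum of the radii of the embedded metric balls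
centred at `x`.  It is `∞` if `Γ` is trivial. -/
def inj (M : ProperlyConvexManifold n) (x : M.Space) : ℝ≥0∞ :=
  ⨆ (r : ℝ≥0) (_ : M.BallEmbedded x r), (r : ℝ≥0∞)

end ProperlyConvexManifold

/-! ### Isometry classes of pointed metric spaces and the pointed Gromov-Hausdorff topology -/

/-- A metric space with a base point. -/
structure PointedMetricSpace : Type 1 where
  carrier : Type
  [metric : MetricSpace carrier]
  pt : carrier

attribute [instance] PointedMetricSpace.metric

/-- Two pointed metric spaces are equivalent if there is an isometry from one onto the other that
preserves the base points. -/
instance pointedIsometrySetoid : Setoid PointedMetricSpace where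
  r X Y := ∃ e : X.carrier ≃ᵢ Y.carrier, e X.pt = Y.pt
  iseqv :=
    { refl := fun X => ⟨IsometryEquiv.refl _, rfl⟩
      symm := by
        rintro X Y ⟨e, he⟩
        exact ⟨e.symm, by rw [← he, e.symm_apply_apply]⟩
      trans := by
        rintro X Y Z ⟨e, he⟩ ⟨f, hf⟩
        exact ⟨e.trans f, by rw [IsometryEquiv.trans_apply, he, hf]⟩ }

/-- The isometry classes of pointed metric spaces. -/
def PointedIsometryClass : Type 1 := Quotient pointedIsometrySetoid

/-- `X` and `Y` are `ε`-close in the pointed Gromov-Hausdorff sense: there is a relation between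
them that relates the base points, is defined on the balls of radius `1 / ε` about the base
points of `X` and of `Y`, and distorts distances by less than `ε`. -/
def GHClose (ε : ℝ) (X Y : PointedMetricSpace) : Prop :=
  ∃ R : X.carrier → Y.carrier → Prop, R X.pt Y.pt ∧
    (∀ a, dist a X.pt < 1 / ε → ∃ b, R a b) ∧
    (∀ b, dist b Y.pt < 1 / ε → ∃ a, R a b) ∧
    ∀ a a' b b', R a b → R a' b' → |dist a a' - dist b b'| < ε

theorem GHClose.of_equiv {ε : ℝ} (hε : 0 < ε) {X Y : PointedMetricSpace} (h : X ≈ Y) :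
    GHClose ε X Y := by
  obtain ⟨e, he⟩ := h
  refine ⟨fun a b => e a = b, he, fun a _ => ⟨e a, rfl⟩,
    fun b _ => ⟨e.symm b, e.apply_symm_apply b⟩, ?_⟩
  rintro a a' b b' rfl rfl
  simpa [e.dist_eq] using hε

theorem GHClose.symm {ε : ℝ} {X Y : PointedMetricSpace} (h : GHClose ε X Y) : GHClose ε Y X := by
  obtain ⟨R, h0, h1, h2, h3⟩ := h
  refine ⟨fun b a => R a b, h0, h2, h1, fun b b' a a' h h' => ?_⟩
  rw [abs_sub_comm]
  exact h3 a a' b b' h h'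

theorem GHClose.mono {ε δ : ℝ} (hδ : 0 < δ) (hδε : δ ≤ ε) {X Y : PointedMetricSpace}
    (h : GHClose δ X Y) : GHClose ε X Y := by
  obtain ⟨R, h0, h1, h2, h3⟩ := h
  have hle : 1 / ε ≤ 1 / δ := one_div_le_one_div_of_le hδ hδε
  exact ⟨R, h0, fun a ha => h1 a (ha.trans_le hle), fun b hb => h2 b (hb.trans_le hle),
    fun a a' b b' h h' => (h3 a a' b b' h h').trans_le hδε⟩

theorem GHClose.trans_isom {ε : ℝ} {X X' Y Y' : PointedMetricSpace} (hX : X' ≈ X) (hY : Y ≈ Y')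
    (h : GHClose ε X Y) : GHClose ε X' Y' := by
  obtain ⟨e, he⟩ := hX
  obtain ⟨f, hf⟩ := hY
  obtain ⟨R, h0, h1, h2, h3⟩ := h
  refine ⟨fun a b => R (e a) (f.symm b), ?_, ?_, ?_, ?_⟩
  · have : f.symm Y'.pt = Y.pt := by rw [← hf, f.symm_apply_apply]
    simpa only [he, this] using h0
  · intro a ha
    obtain ⟨b, hb⟩ := h1 (e a) (by rwa [← he, e.dist_eq])
    exact ⟨f b, by simpa only [f.symm_apply_apply] using hb⟩
  · intro b hb
    obtain ⟨a, ha⟩ := h2 (f.symm b) (by rwa [← f.dist_eq, f.apply_symm_apply, hf])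
    exact ⟨e.symm a, by simpa only [e.apply_symm_apply] using ha⟩
  · intro a a' b b' h h'
    have := h3 _ _ _ _ h h'
    rwa [e.dist_eq, f.symm.dist_eq] at this

theorem GHClose.trans {ε δ : ℝ} (hδ : 0 < δ) (hδε : 2 * δ ≤ ε) (hδ1 : 2 * δ ≤ 1)
    {X Y Z : PointedMetricSpace} (h : GHClose δ X Y) (h' : GHClose δ Y Z) : GHClose ε X Z := by
  obtain ⟨R, h0, h1, h2, h3⟩ := h
  obtain ⟨S, k0, k1, k2, k3⟩ := h'
  have e1 : 1 / ε ≤ 1 / (2 * δ) := one_div_le_one_div_of_le (by linarith) hδε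
  have e2 : 1 / (2 * δ) = (1 / δ) / 2 := by field_simp
  have e3 : δ ≤ (1 / δ) / 2 := by
    rw [le_div_iff₀ (by norm_num), le_div_iff₀ hδ]
    nlinarith
  refine ⟨fun a c => ∃ b, R a b ∧ S b c, ⟨Y.pt, h0, k0⟩, ?_, ?_, ?_⟩
  · intro a ha
    obtain ⟨b, hb⟩ := h1 a (by linarith)
    have hd := abs_lt.1 (h3 _ _ _ _ hb h0)
    obtain ⟨c, hc⟩ := k1 b (by linarith)
    exact ⟨c, b, hb, hc⟩
  · intro c hc
    obtain ⟨b, hb⟩ := k2 c (by linarith)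
    have hd := abs_lt.1 (k3 _ _ _ _ hb k0)
    obtain ⟨a, ha⟩ := h2 b (by linarith)
    exact ⟨a, b, ha, hb⟩
  · rintro a a' c c' ⟨b, hab, hbc⟩ ⟨b', hab', hbc'⟩
    have p := abs_lt.1 (h3 _ _ _ _ hab hab')
    have q := abs_lt.1 (k3 _ _ _ _ hbc hbc')
    rw [abs_lt]
    constructor <;> linarith

/-- The basic entourage: the pairs of isometry classes that are `ε`-close. -/
def ghEntourage (ε : ℝ) : Set (PointedIsometryClass × PointedIsometryClass) :=
  {p | ∃ X Y : PointedMetricSpace,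
    p = (Quotient.mk pointedIsometrySetoid X, Quotient.mk pointedIsometrySetoid Y) ∧
      GHClose ε X Y}

theorem ghEntourage_mono {ε δ : ℝ} (hδ : 0 < δ) (hδε : δ ≤ ε) :
    ghEntourage δ ⊆ ghEntourage ε := by
  rintro p ⟨X, Y, hp, h⟩
  exact ⟨X, Y, hp, h.mono hδ hδε⟩

/-- The sets `ghEntourage ε`, `ε > 0`, form a filter basis. -/
def ghBasis : FilterBasis (PointedIsometryClass × PointedIsometryClass) where
  sets := {V | ∃ ε : ℝ, 0 < ε ∧ V = ghEntourage ε}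
  nonempty := ⟨_, 1, one_pos, rfl⟩
  inter_sets := by
    rintro _ _ ⟨ε, hε, rfl⟩ ⟨δ, hδ, rfl⟩
    have hm : 0 < min ε δ := lt_min hε hδ
    exact ⟨_, ⟨_, hm, rfl⟩, Set.subset_inter (ghEntourage_mono hm (min_le_left _ _))
      (ghEntourage_mono hm (min_le_right _ _))⟩

/-- The pointed Gromov-Hausdorff uniform structure on the isometry classes of pointed metric
spaces.  Its topology is the pointed Gromov-Hausdorff topology: the sets
`{Y | Y is ε-close to X}`, `ε > 0`, form a basis of neighbourhoods of `X`. -/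
instance ghUniformSpace : UniformSpace PointedIsometryClass :=
  UniformSpace.ofCore <| UniformSpace.Core.mkOfBasis ghBasis
    (by
      rintro _ ⟨ε, hε, rfl⟩ x
      induction x using Quotient.inductionOn with
      | h X => exact ⟨X, X, rfl, GHClose.of_equiv hε (Setoid.refl X)⟩)
    (by
      rintro _ ⟨ε, hε, rfl⟩
      refine ⟨_, ⟨ε, hε, rfl⟩, ?_⟩
      rintro _ ⟨X, Y, rfl, h⟩
      exact ⟨Y, X, rfl, h.symm⟩)
    (by
      rintro _ ⟨ε, hε, rfl⟩
      have hδ : 0 < min (ε / 2) (1 / 2) := lt_min (by linarith) (by norm_num)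
      have hδ1 : min (ε / 2) (1 / 2) ≤ ε / 2 := min_le_left _ _
      have hδ2 : min (ε / 2) (1 / 2) ≤ (1 / 2 : ℝ) := min_le_right _ _
      refine ⟨_, ⟨_, hδ, rfl⟩, ?_⟩
      rintro ⟨x, z⟩ ⟨y, ⟨X, Y, hxy, h⟩, ⟨Y', Z, hyz, h'⟩⟩
      obtain ⟨rfl, rfl⟩ := Prod.mk.inj hxy
      obtain ⟨hY, rfl⟩ := Prod.mk.inj hyz
      exact ⟨X, Z, rfl, GHClose.trans hδ (by linarith) (by linarith)
        (h.trans_isom (Setoid.refl X) (Quotient.exact hY)) h'⟩)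

/-- The isometry class of a pointed metric space. -/
def PointedMetricSpace.isomClass (X : PointedMetricSpace) : PointedIsometryClass :=
  Quotient.mk pointedIsometrySetoid X

theorem nhds_hasBasis_ghClose (X : PointedMetricSpace) :
    (𝓝 X.isomClass).HasBasis (fun ε : ℝ => 0 < ε)
      (fun ε => {y | ∃ Y : PointedMetricSpace, y = Y.isomClass ∧ GHClose ε X Y}) := by
  have hu : (𝓤 PointedIsometryClass).HasBasis (fun ε : ℝ => 0 < ε) ghEntourage := by
    refine ⟨fun V => ⟨fun hV => ?_, ?_⟩⟩
    · obtain ⟨_, ⟨ε, hε, rfl⟩, h⟩ := ghBasis.mem_filter_iff.1 hV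
      exact ⟨ε, hε, h⟩
    · rintro ⟨ε, hε, h⟩
      exact ghBasis.mem_filter_iff.2 ⟨_, ⟨ε, hε, rfl⟩, h⟩
  have hn := nhds_basis_uniformity' hu (x := X.isomClass)
  refine hn.congr (fun _ => Iff.rfl) fun ε _ => ?_
  ext y
  constructor
  · rintro ⟨X', Y, h, hc⟩
    obtain ⟨hX, rfl⟩ := Prod.mk.inj h
    exact ⟨Y, rfl, hc.trans_isom (Quotient.exact hX) (Setoid.refl Y)⟩
  · rintro ⟨Y, rfl, hc⟩
    exact ⟨X, Y, rfl, hc⟩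

/-- The set of isometry classes of pointed metric spaces `(M, x)`, where `M` is a properly convex
projective `n`-manifold with the Hilbert metric and the injectivity radius of `M` at `x` is at
least `ε`. -/
def thickPointed (n : ℕ) (ε : ℝ) : Set PointedIsometryClass :=
  {c | ∃ (X : PointedMetricSpace) (M : ProperlyConvexManifold n) (x : M.Space),
    c = X.isomClass ∧ ENNReal.ofReal ε ≤ M.inj x ∧
    ∃ e : X.carrier ≃ M.Space, e X.pt = x ∧ ∀ p q, dist p q = M.mDist (e p) (e q)}

end ConvexProjective

end

noncomputable section

namespace ConvexProjective

open Filter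

/-! ### Concave functions describing convex cones -/

/-! The proof lifts everything to linear algebra. The cone C over Ω in ℝⁿ⁺¹ is open, convex and
contains no line in its closure. With M(a/b) the least t such that t b − a lies in the closed cone,
the Hilbert distance is log (M(a/b) M(b/a)) (`IsConeFunction.hilbertDist_eq`). The cone is encoded
by a superadditive, positively homogeneous function F, positive exactly on C, so that convergence of
domains becomes pointwise convergence of functions.

Compactness of pointed domains is Benzécri's theorem (`exists_isNormalizedConeFunction`). Among the
linear forms that are nonnegative on C and equal to 1 at a lift v of the base point, choose n + 1
with determinant of maximal absolute value. By Cramer's rule every other such form is a combination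
of these with coefficients in [−1, 1]. In the coordinates that they define, v becomes (1, …, 1), and
the infimum F of all the forms satisfies −∑ |wᵢ| ≤ F w ≤ wⱼ for every j. Such F are uniformly
bounded at each vector and 1-Lipschitz for the ℓ¹ norm, so they have pointwise limits along any
ultrafilter, and the limits are of the same kind.

The holonomy is lifted to a group of linear automorphisms of C containing the positive homotheties,
so that vectors may be rescaled freely. Along an ultrafilter the groups converge to the group of
limits of their elements (`limitGroup`). The bound on the injectivity radius is used in the form
`thick`: an element that takes some point of the ε-ball about (1, …, 1) into this ball is scalar.
This condition and torsion-freeness pass to the limit (`IsThickGroup.limit`), and thickness makes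
the limit group discrete in PGL. No elements are lost on the way: automorphisms of normalized cones
that move points by bounded amounts have, after rescaling, bounded matrices with bounded inverses
(`IsThickGroup.exists_limit`). Hence the quotient distances converge (`IsThickModel.tendsto_dist`),
uniformly on compact sets of lifts, which is pointed Gromov–Hausdorff convergence
(`IsThickModel.eventually_ghClose`). Compactness then follows from the ultrafilter criterion. -/

/-- A function whose positivity set is an open convex cone, and whose nonnegativity set is a closed
convex cone that contains no line. -/
structure IsConeFunction {n : ℕ} (F : (Fin (n + 1) → ℝ) → ℝ) : Prop where
  add_le : ∀ u w, F u + F w ≤ F (u + w)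
  apply_smul : ∀ t : ℝ, 0 < t → ∀ w, F (t • w) = t * F w
  cont : Continuous F
  sharp : ∀ w, w ≠ 0 → 0 ≤ F w → F (-w) < 0

/-- The least `t` with `a ≤ t • b` in the order of the cone `0 ≤ F`. -/
def relMax {n : ℕ} (F : (Fin (n + 1) → ℝ) → ℝ) (a b : Fin (n + 1) → ℝ) : ℝ :=
  sInf {t : ℝ | 0 ≤ F (t • b - a)}

/-- The Hilbert (pseudo-)metric of the cone `0 < F`. -/
def coneDist {n : ℕ} (F : (Fin (n + 1) → ℝ) → ℝ) (a b : Fin (n + 1) → ℝ) : ℝ :=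
  Real.log (relMax F a b * relMax F b a)

namespace IsConeFunction

variable {n : ℕ} {F : (Fin (n + 1) → ℝ) → ℝ} {a b c : Fin (n + 1) → ℝ}

theorem apply_zero (hF : IsConeFunction F) : F 0 = 0 := by
  have := hF.apply_smul 2 two_pos 0
  rw [smul_zero] at this
  linarith

theorem ne_zero (hF : IsConeFunction F) (ha : 0 < F a) : a ≠ 0 := by
  rintro rfl
  exact ha.ne' hF.apply_zero

theorem smul_pos (hF : IsConeFunction F) (ha : 0 < F a) {t : ℝ} (ht : 0 < t) : 0 < F (t • a) := by
  rw [hF.apply_smul t ht]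
  exact mul_pos ht ha

theorem neg_neg_of_pos (hF : IsConeFunction F) (ha : 0 < F a) : F (-a) < 0 :=
  hF.sharp a (hF.ne_zero ha) ha.le

theorem pos_of_smul (hF : IsConeFunction F) (ha : 0 < F a) {t : ℝ} (hta : 0 < F (t • a)) :
    0 < t := by
  rcases lt_trichotomy t 0 with h | rfl | h
  · have := hF.apply_smul (-t) (by linarith) (-a)
    rw [smul_neg, neg_smul, neg_neg] at this
    have h2 := hF.neg_neg_of_pos ha
    nlinarith
  · rw [zero_smul, hF.apply_zero] at hta
    exact absurd hta (lt_irrefl _)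
  · exact h

/-- Superadditivity makes t ↦ F (t b − a) increase with slope at least F b. When F b > 0 this
function has a unique zero, and that zero is `relMax F a b`; the characterizations of `relMax` below
rest on this. -/
theorem apply_add_smul_le (hF : IsConeFunction F) {t s : ℝ} (h : t < s) :
    F (t • b - a) + (s - t) * F b ≤ F (s • b - a) := by
  rw [← hF.apply_smul _ (sub_pos.2 h)]
  refine (hF.add_le _ _).trans_eq ?_
  congr 1
  module

theorem bddBelow (hF : IsConeFunction F) (hb : 0 < F b) (a : Fin (n + 1) → ℝ) :
    BddBelow {t : ℝ | 0 ≤ F (t • b - a)} := by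
  refine ⟨-(|F (-a)| / F b), fun t (ht : 0 ≤ F (t • b - a)) => ?_⟩
  by_contra! hlt
  have h0 : t < 0 := hlt.trans_le (neg_nonpos.2 (by positivity))
  have h := hF.apply_add_smul_le (a := a) (b := b) h0
  simp only [zero_smul, zero_sub] at h
  have h1 : t * F b < -(|F (-a)| / F b) * F b := mul_lt_mul_of_pos_right hlt hb
  rw [neg_mul, div_mul_cancel₀ _ hb.ne'] at h1
  have := le_abs_self (F (-a))
  linarith

theorem relMax_mem (hF : IsConeFunction F) (hb : 0 < F b) (a : Fin (n + 1) → ℝ) :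
    0 ≤ F (relMax F a b • b - a) := by
  have hcl : IsClosed {t : ℝ | 0 ≤ F (t • b - a)} :=
    isClosed_le continuous_const (hF.cont.comp (by fun_prop))
  refine hcl.csInf_mem ⟨|F (-a)| / F b + 1, ?_⟩ (hF.bddBelow hb a)
  have h := hF.apply_add_smul_le (a := a) (b := b) (t := 0) (s := |F (-a)| / F b + 1)
    (by positivity)
  rw [zero_smul, zero_sub, sub_zero, add_mul, div_mul_cancel₀ _ hb.ne'] at h
  have := neg_abs_le (F (-a))
  exact (by linarith : (0 : ℝ) ≤ F ((|F (-a)| / F b + 1) • b - a))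

theorem relMax_le_iff (hF : IsConeFunction F) (hb : 0 < F b) {t : ℝ} :
    relMax F a b ≤ t ↔ 0 ≤ F (t • b - a) := by
  constructor
  · intro h
    rcases h.eq_or_lt with h | h
    · exact h ▸ hF.relMax_mem hb a
    · have h1 := hF.apply_add_smul_le (a := a) (b := b) h
      have h2 := hF.relMax_mem hb a
      nlinarith
  · exact fun h => csInf_le (hF.bddBelow hb a) h

theorem relMax_lt_iff (hF : IsConeFunction F) (hb : 0 < F b) {t : ℝ} :
    relMax F a b < t ↔ 0 < F (t • b - a) := by
  constructor
  · intro h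
    have h1 := hF.apply_add_smul_le (a := a) (b := b) h
    have h2 := hF.relMax_mem hb a
    nlinarith
  · intro h
    have hc : Continuous fun s : ℝ => F (s • b - a) := hF.cont.comp (by fun_prop)
    have h1 : ∀ᶠ s in 𝓝 t, 0 < F (s • b - a) := hc.continuousAt.eventually (lt_mem_nhds h)
    obtain ⟨s, hs, hst⟩ := ((h1.filter_mono nhdsWithin_le_nhds).and
      (self_mem_nhdsWithin : Set.Iio t ∈ 𝓝[<] t)).exists
    exact ((hF.relMax_le_iff hb).2 hs.le).trans_lt hst

theorem relMax_eq (hF : IsConeFunction F) (hb : 0 < F b) {t : ℝ} (h : F (t • b - a) = 0) :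
    relMax F a b = t :=
  le_antisymm ((hF.relMax_le_iff hb).2 h.ge)
    (not_lt.1 fun hlt => ((hF.relMax_lt_iff hb).1 hlt).ne' h)

theorem apply_relMax (hF : IsConeFunction F) (hb : 0 < F b) (a : Fin (n + 1) → ℝ) :
    F (relMax F a b • b - a) = 0 :=
  le_antisymm (not_lt.1 fun h => ((hF.relMax_lt_iff hb).2 h).false) (hF.relMax_mem hb a)

theorem le_relMax_mul (hF : IsConeFunction F) (hb : 0 < F b) (ha : 0 < F a) :
    0 < relMax F a b ∧ F a ≤ relMax F a b * F b := by
  have h0 := hF.apply_relMax hb a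
  have h1 : 0 < relMax F a b := by
    refine hF.pos_of_smul hb ?_
    have h2 := hF.add_le (relMax F a b • b - a) a
    rw [sub_add_cancel] at h2
    linarith
  refine ⟨h1, ?_⟩
  have h2 := hF.add_le (relMax F a b • b - a) a
  rw [sub_add_cancel, hF.apply_smul _ h1] at h2
  linarith

theorem relMax_pos (hF : IsConeFunction F) (hb : 0 < F b) (ha : 0 < F a) : 0 < relMax F a b :=
  (hF.le_relMax_mul hb ha).1

theorem relMax_self (hF : IsConeFunction F) (ha : 0 < F a) : relMax F a a = 1 :=
  hF.relMax_eq ha (by rw [one_smul, sub_self, hF.apply_zero])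

theorem relMax_smul (hF : IsConeFunction F) (hb : 0 < F b) {s t : ℝ} (hs : 0 < s) (ht : 0 < t) :
    relMax F (s • a) (t • b) = s / t * relMax F a b := by
  refine hF.relMax_eq (hF.smul_pos hb ht) ?_
  have : (s / t * relMax F a b) • t • b - s • a = s • (relMax F a b • b - a) := by
    rw [smul_smul, smul_sub, smul_smul]
    congr 2
    field_simp
  rw [this, hF.apply_smul s hs, hF.apply_relMax hb, mul_zero]

/-- Substitute b ≤ M(b/c) c into a ≤ M(a/b) b. The logarithm of this is the triangle inequality. -/
theorem relMax_trans (hF : IsConeFunction F) (ha : 0 < F a) (hb : 0 < F b) (hc : 0 < F c) :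
    relMax F a c ≤ relMax F a b * relMax F b c := by
  rw [hF.relMax_le_iff hc]
  have h := hF.add_le (relMax F a b • (relMax F b c • c - b)) (relMax F a b • b - a)
  rw [hF.apply_smul _ (hF.relMax_pos hb ha), hF.apply_relMax hb, hF.apply_relMax hc] at h
  refine (by linarith : (0 : ℝ) ≤ _).trans (h.trans_eq ?_)
  congr 1
  module

theorem coneDist_comm (a b : Fin (n + 1) → ℝ) : coneDist F a b = coneDist F b a := by
  rw [coneDist, coneDist, mul_comm]

theorem coneDist_self (hF : IsConeFunction F) (ha : 0 < F a) : coneDist F a a = 0 := by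
  rw [coneDist, hF.relMax_self ha, mul_one, Real.log_one]

theorem coneDist_triangle (hF : IsConeFunction F) (ha : 0 < F a) (hb : 0 < F b) (hc : 0 < F c) :
    coneDist F a c ≤ coneDist F a b + coneDist F b c := by
  have hab := hF.relMax_pos hb ha
  have hba := hF.relMax_pos ha hb
  have hbc := hF.relMax_pos hc hb
  have hcb := hF.relMax_pos hb hc
  have hac := hF.relMax_pos hc ha
  have hca := hF.relMax_pos ha hc
  rw [coneDist, coneDist, coneDist, ← Real.log_mul (by positivity) (by positivity)]
  refine Real.log_le_log (by positivity) ?_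
  calc relMax F a c * relMax F c a
      ≤ (relMax F a b * relMax F b c) * (relMax F c b * relMax F b a) :=
        mul_le_mul (hF.relMax_trans ha hb hc) (hF.relMax_trans hc hb ha) hca.le (by positivity)
    _ = _ := by ring

theorem coneDist_nonneg (hF : IsConeFunction F) (ha : 0 < F a) (hb : 0 < F b) :
    0 ≤ coneDist F a b := by
  have h := hF.coneDist_triangle ha hb ha
  rw [hF.coneDist_self ha, coneDist_comm b a] at h
  linarith

theorem relMax_mul_eq_exp (hF : IsConeFunction F) (ha : 0 < F a) (hb : 0 < F b) :
    relMax F a b * relMax F b a = Real.exp (coneDist F a b) :=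
  (Real.exp_log (mul_pos (hF.relMax_pos hb ha) (hF.relMax_pos ha hb))).symm

theorem coneDist_smul (hF : IsConeFunction F) (ha : 0 < F a) (hb : 0 < F b) {s t : ℝ} (hs : 0 < s)
    (ht : 0 < t) : coneDist F (s • a) (t • b) = coneDist F a b := by
  rw [coneDist, coneDist, hF.relMax_smul hb hs ht, hF.relMax_smul ha ht hs]
  congr 1
  field_simp

/-- If M(a/b) M(b/a) = 1, then M(a/b) b − a and its negative both lie in the closed cone, which
contains no line. -/
theorem exists_smul_of_coneDist_eq_zero (hF : IsConeFunction F) (ha : 0 < F a) (hb : 0 < F b)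
    (h : coneDist F a b = 0) : ∃ t : ℝ, 0 < t ∧ t • b = a := by
  have h1 := hF.relMax_mul_eq_exp ha hb
  rw [h, Real.exp_zero] at h1
  have hM := hF.relMax_pos hb ha
  refine ⟨_, hM, ?_⟩
  by_contra hne
  have h2 := hF.sharp _ (sub_ne_zero.2 hne) (hF.relMax_mem hb a)
  have h3 : relMax F a b • (relMax F b a • a - b) = -(relMax F a b • b - a) := by
    rw [smul_sub, smul_smul, h1, one_smul, neg_sub]
  rw [← h3, hF.apply_smul _ hM, hF.apply_relMax ha, mul_zero] at h2
  exact h2.false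

theorem nonneg_of_tendsto (hF : IsConeFunction F) (h : ∀ t : ℝ, 0 < t → 0 ≤ F (a + t • b)) :
    0 ≤ F a := by
  have hc : Continuous fun t : ℝ => F (a + t • b) := hF.cont.comp (by fun_prop)
  have h1 : Tendsto (fun t : ℝ => F (a + t • b)) (𝓝[>] 0) (𝓝 (F a)) := by
    have := (hc.tendsto 0).mono_left (nhdsWithin_le_nhds (s := Set.Ioi 0))
    simpa using this
  exact ge_of_tendsto h1 (eventually_nhdsWithin_of_forall h)

theorem pos_add_smul (hF : IsConeFunction F) (ha : 0 ≤ F a) (hb : 0 < F b) {t : ℝ} (ht : 0 < t) :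
    0 < F (a + t • b) := by
  have := hF.add_le a (t • b)
  have := hF.smul_pos hb ht
  linarith

theorem convex_pos (hF : IsConeFunction F) : Convex ℝ {w | 0 < F w} := by
  intro u hu w hw s t hs ht hst
  rcases hs.eq_or_lt with rfl | hs
  · simpa [show t = 1 by linarith] using hw
  · rcases ht.eq_or_lt with rfl | ht
    · simpa [show s = 1 by linarith] using hu
    · have := hF.add_le (s • u) (t • w)
      have := hF.smul_pos hu hs
      have := hF.smul_pos hw ht
      change 0 < F _
      linarith

/-- A linear automorphism of the open cone preserves the closed cone. -/
theorem nonneg_smul (hF : IsConeFunction F) {g : GL (Fin (n + 1)) ℝ} {v : Fin (n + 1) → ℝ}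
    (hv : 0 < F v) (hg : ∀ w, 0 < F w → 0 < F (g • w)) {w : Fin (n + 1) → ℝ} (hw : 0 ≤ F w) :
    0 ≤ F (g • w) := by
  refine hF.nonneg_of_tendsto (b := g • v) fun t ht => ?_
  rw [← smul_comm g t v, ← smul_add]
  exact (hg _ (hF.pos_add_smul hw hv ht)).le

theorem relMax_smul_smul (hF : IsConeFunction F) {g : GL (Fin (n + 1)) ℝ}
    (hg : ∀ w, 0 < F w → 0 < F (g • w)) (hg' : ∀ w, 0 < F w → 0 < F (g⁻¹ • w))
    (hb : 0 < F b) : relMax F (g • a) (g • b) = relMax F a b := by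
  have key : ∀ t : ℝ, t • g • b - g • a = g • (t • b - a) := fun t => by
    rw [smul_sub, smul_comm t g b]
  refine eq_of_forall_ge_iff fun t => ?_
  rw [hF.relMax_le_iff hb, hF.relMax_le_iff (hg _ hb), key]
  refine ⟨fun h => ?_, hF.nonneg_smul hb hg⟩
  simpa using hF.nonneg_smul hb hg' h

theorem coneDist_smul_smul (hF : IsConeFunction F) {g : GL (Fin (n + 1)) ℝ}
    (hg : ∀ w, 0 < F w → 0 < F (g • w)) (hg' : ∀ w, 0 < F w → 0 < F (g⁻¹ • w))
    (ha : 0 < F a) (hb : 0 < F b) : coneDist F (g • a) (g • b) = coneDist F a b := by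
  rw [coneDist, coneDist, hF.relMax_smul_smul hg hg' hb, hF.relMax_smul_smul hg hg' ha]

end IsConeFunction

/-! ### Normalized cones -/

/-- Concave functions of cones in the position provided by Benzécri's theorem: the cone lies in the
positive orthant and contains a ball about `(1, …, 1)` whose size depends on `n` only. -/
structure IsNormalizedConeFunction {n : ℕ} (F : (Fin (n + 1) → ℝ) → ℝ) : Prop where
  add_le : ∀ u w, F u + F w ≤ F (u + w)
  apply_smul : ∀ t : ℝ, 0 < t → ∀ w, F (t • w) = t * F w
  le_apply : ∀ w i, F w ≤ w i
  neg_sum_le : ∀ w, -∑ i, |w i| ≤ F w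
  one_le : 1 ≤ F 1

namespace IsNormalizedConeFunction

variable {n : ℕ} {F : (Fin (n + 1) → ℝ) → ℝ} {a b : Fin (n + 1) → ℝ}

/-- Superadditivity and the lower bound −∑ |wᵢ| give the ℓ¹-Lipschitz constant 1, the same for all
normalized cones. This equicontinuity drives the limit arguments. -/
theorem sub_le (hF : IsNormalizedConeFunction F) (u w : Fin (n + 1) → ℝ) :
    F u - F w ≤ ∑ i, |u i - w i| := by
  have h1 := hF.add_le u (w - u)
  have h2 := hF.neg_sum_le (w - u)
  rw [add_sub_cancel] at h1
  simp only [Pi.sub_apply, abs_sub_comm (w _)] at h2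
  linarith

theorem abs_sub_le (hF : IsNormalizedConeFunction F) (u w : Fin (n + 1) → ℝ) :
    |F u - F w| ≤ ∑ i, |u i - w i| := by
  refine abs_sub_le_iff.2 ⟨hF.sub_le u w, (hF.sub_le w u).trans_eq ?_⟩
  simp only [abs_sub_comm]

/-- The common Lipschitz constant upgrades pointwise convergence to convergence along convergent
arguments. -/
theorem tendsto_apply {ι : Type*} {l : Filter ι} {f : ι → (Fin (n + 1) → ℝ) → ℝ}
    (hf : ∀ i, IsNormalizedConeFunction (f i)) (hfF : ∀ w, Tendsto (fun i => f i w) l (𝓝 (F w)))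
    {u : ι → Fin (n + 1) → ℝ} (hu : Tendsto u l (𝓝 a)) :
    Tendsto (fun i => f i (u i)) l (𝓝 (F a)) := by
  have hs : Tendsto (fun i => ∑ j, |u i j - a j|) l (𝓝 0) := by
    have hc : Continuous fun w : Fin (n + 1) → ℝ => ∑ j, |w j - a j| := by fun_prop
    simpa [Function.comp_def] using (hc.tendsto a).comp hu
  have h0 : Tendsto (fun i => f i (u i) - f i a) l (𝓝 0) :=
    squeeze_zero_norm (fun i => (hf i).abs_sub_le _ _) hs
  simpa using h0.add (hfF a)

theorem cont (hF : IsNormalizedConeFunction F) : Continuous F :=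
  continuous_iff_continuousAt.2 fun _ =>
    tendsto_apply (fun _ => hF) (fun _ => tendsto_const_nhds) tendsto_id

theorem isConeFunction (hF : IsNormalizedConeFunction F) : IsConeFunction F where
  add_le := hF.add_le
  apply_smul := hF.apply_smul
  cont := hF.cont
  sharp w hw h := by
    obtain ⟨i, hi⟩ := Function.ne_iff.1 hw
    have h1 := h.trans (hF.le_apply w i)
    have h2 : 0 < w i := lt_of_le_of_ne h1 (Ne.symm hi)
    have h3 := hF.le_apply (-w) i
    rw [Pi.neg_apply] at h3
    linarith

theorem apply_one (hF : IsNormalizedConeFunction F) : F 1 = 1 :=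
  le_antisymm (hF.le_apply 1 0) hF.one_le

theorem one_pos (hF : IsNormalizedConeFunction F) : 0 < F 1 := by
  rw [hF.apply_one]
  exact _root_.one_pos

theorem sum_pos (hF : IsNormalizedConeFunction F) {w : Fin (n + 1) → ℝ} (hw : w ≠ 0)
    (h : 0 ≤ F w) : 0 < ∑ i, w i := by
  obtain ⟨i, hi⟩ := Function.ne_iff.1 hw
  exact Finset.sum_pos' (fun j _ => h.trans (hF.le_apply w j))
    ⟨i, Finset.mem_univ i, lt_of_le_of_ne (h.trans (hF.le_apply w i)) (Ne.symm hi)⟩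

theorem of_tendsto {ι : Type*} {l : Filter ι} [l.NeBot] {f : ι → (Fin (n + 1) → ℝ) → ℝ}
    (hf : ∀ i, IsNormalizedConeFunction (f i)) (hfF : ∀ w, Tendsto (fun i => f i w) l (𝓝 (F w))) :
    IsNormalizedConeFunction F where
  add_le u w := le_of_tendsto_of_tendsto' ((hfF u).add (hfF w)) (hfF _) fun i => (hf i).add_le u w
  apply_smul t ht w := by
    refine tendsto_nhds_unique (hfF (t • w)) (((hfF w).const_mul t).congr fun i => ?_)
    exact ((hf i).apply_smul t ht w).symm
  le_apply w j := le_of_tendsto' (hfF w) fun i => (hf i).le_apply w j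
  neg_sum_le w := ge_of_tendsto' (hfF w) fun i => (hf i).neg_sum_le w
  one_le := ge_of_tendsto' (hfF 1) fun i => (hf i).one_le

/-- For each w the values lie in the compact interval [−∑ |wᵢ|, w₀], so the ultrafilter limit
exists. -/
theorem exists_tendsto {ι : Type*} (l : Ultrafilter ι) {f : ι → (Fin (n + 1) → ℝ) → ℝ}
    (hf : ∀ i, IsNormalizedConeFunction (f i)) :
    ∃ F : (Fin (n + 1) → ℝ) → ℝ, ∀ w, Tendsto (fun i => f i w) l (𝓝 (F w)) := by
  have h : ∀ w, ∃ y, Tendsto (fun i => f i w) l (𝓝 y) := fun w => by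
    obtain ⟨y, -, hy⟩ := (isCompact_Icc (a := -∑ i, |w i|) (b := w 0)).ultrafilter_le_nhds
      (l.map fun i => f i w) (by
        rw [le_principal_iff]
        exact mem_map.2 (Eventually.of_forall fun i => ⟨(hf i).neg_sum_le w, (hf i).le_apply w 0⟩))
    exact ⟨y, hy⟩
  choose F hF using h
  exact ⟨F, hF⟩

/-- Otherwise there are bad points in K for almost all indices. They converge along the ultrafilter,
and `tendsto_apply` at their limit gives a contradiction. -/
theorem eventually_abs_sub_lt {ι : Type*} (l : Ultrafilter ι) {f : ι → (Fin (n + 1) → ℝ) → ℝ}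
    (hf : ∀ i, IsNormalizedConeFunction (f i)) (hF : IsNormalizedConeFunction F)
    (hfF : ∀ w, Tendsto (fun i => f i w) l (𝓝 (F w)))
    {K : Set (Fin (n + 1) → ℝ)} (hK : IsCompact K) {η : ℝ} (hη : 0 < η) :
    ∀ᶠ i in (l : Filter ι), ∀ w ∈ K, |f i w - F w| < η := by
  by_contra hcon
  have h := Ultrafilter.eventually_not.2 hcon
  have h1 : ∀ i, ∃ w, (¬ ∀ w ∈ K, |f i w - F w| < η) → w ∈ K ∧ η ≤ |f i w - F w| := fun i => by
    by_cases hi : ∀ w ∈ K, |f i w - F w| < η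
    · exact ⟨0, fun h => absurd hi h⟩
    · push Not at hi
      exact hi.imp fun w hw _ => hw
  choose u hu using h1
  obtain ⟨w, -, hw⟩ := hK.ultrafilter_le_nhds (l.map u) (by
    rw [le_principal_iff]
    exact mem_map.2 (h.mono fun i hi => (hu i hi).1))
  have hw' : Tendsto u l (𝓝 w) := hw
  have h2 : Tendsto (fun i => |f i (u i) - F (u i)|) l (𝓝 0) := by
    simpa using ((tendsto_apply hf hfF hw').sub ((hF.cont.tendsto w).comp hw')).abs
  obtain ⟨i, hi, hi'⟩ := (h.and (h2.eventually (gt_mem_nhds hη))).exists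
  exact absurd (hu i hi).2 hi'.not_ge

/-- For t different from `relMax F a b`, the sign of F (t b − a) is strict, hence is inherited by
almost all terms of the family. -/
theorem tendsto_relMax {ι : Type*} {l : Filter ι} {f : ι → (Fin (n + 1) → ℝ) → ℝ}
    (hf : ∀ i, IsNormalizedConeFunction (f i)) (hF : IsNormalizedConeFunction F)
    (hfF : ∀ w, Tendsto (fun i => f i w) l (𝓝 (F w)))
    {u w : ι → Fin (n + 1) → ℝ} (hu : Tendsto u l (𝓝 a)) (hw : Tendsto w l (𝓝 b)) (hb : 0 < F b) :
    Tendsto (fun i => relMax (f i) (u i) (w i)) l (𝓝 (relMax F a b)) := by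
  have hpos : ∀ᶠ i in l, 0 < f i (w i) := (tendsto_apply hf hfF hw).eventually (lt_mem_nhds hb)
  have key : ∀ t : ℝ, Tendsto (fun i => f i (t • w i - u i)) l (𝓝 (F (t • b - a))) := fun t =>
    tendsto_apply hf hfF ((hw.const_smul t).sub hu)
  refine tendsto_order.2 ⟨fun t ht => ?_, fun t ht => ?_⟩
  · have h : F (t • b - a) < 0 := by
      by_contra! h
      exact ht.not_ge ((hF.isConeFunction.relMax_le_iff hb).2 h)
    filter_upwards [hpos, (key t).eventually (gt_mem_nhds h)] with i hi hi'
    by_contra! h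
    exact hi'.not_ge (((hf i).isConeFunction.relMax_le_iff hi).1 h)
  · have h := (hF.isConeFunction.relMax_lt_iff hb).1 ht
    filter_upwards [hpos, (key t).eventually (lt_mem_nhds h)] with i hi hi'
    exact ((hf i).isConeFunction.relMax_lt_iff hi).2 hi'

theorem tendsto_coneDist {ι : Type*} {l : Filter ι} {f : ι → (Fin (n + 1) → ℝ) → ℝ}
    (hf : ∀ i, IsNormalizedConeFunction (f i)) (hF : IsNormalizedConeFunction F)
    (hfF : ∀ w, Tendsto (fun i => f i w) l (𝓝 (F w)))
    {u w : ι → Fin (n + 1) → ℝ} (hu : Tendsto u l (𝓝 a)) (hw : Tendsto w l (𝓝 b))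
    (ha : 0 < F a) (hb : 0 < F b) :
    Tendsto (fun i => coneDist (f i) (u i) (w i)) l (𝓝 (coneDist F a b)) :=
  ((tendsto_relMax hf hF hfF hu hw hb).mul (tendsto_relMax hf hF hfF hw hu ha)).log
    (mul_pos (hF.isConeFunction.relMax_pos hb ha) (hF.isConeFunction.relMax_pos ha hb)).ne'

theorem continuousAt_coneDist (hF : IsNormalizedConeFunction F) (ha : 0 < F a) (hb : 0 < F b) :
    ContinuousAt (fun w => coneDist F a w) b :=
  tendsto_coneDist (fun _ => hF) hF (fun _ => tendsto_const_nhds) tendsto_const_nhds tendsto_id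
    ha hb

theorem isOpen_ball (hF : IsNormalizedConeFunction F) (ha : 0 < F a) (r : ℝ) :
    IsOpen {w | 0 < F w ∧ coneDist F a w < r} :=
  isOpen_iff_mem_nhds.2 fun _ hw => ((hF.cont.continuousAt).eventually (lt_mem_nhds hw.1)).and
    ((hF.continuousAt_coneDist ha hw.1).eventually (gt_mem_nhds hw.2))

/-- A lower bound for `F` on Hilbert balls. -/
theorem mul_exp_neg_le (hF : IsNormalizedConeFunction F) (ha : 0 < F a) (hb : 0 < F b)
    (hab : ∑ i, a i = ∑ i, b i) {D : ℝ} (hD : coneDist F a b ≤ D) : F a * Real.exp (-D) ≤ F b := by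
  have hC := hF.isConeFunction
  obtain ⟨h1, h2⟩ := hC.le_relMax_mul hb ha
  -- The cone lies in the positive orthant, so b ≤ M(b/a) a in every coordinate; the two coordinate
  -- sums are equal, which forces M(b/a) ≥ 1. Then M(a/b) is at most exp D.
  have h3 : 1 ≤ relMax F b a := by
    have h4 : ∀ i, b i ≤ relMax F b a * a i := fun i => by
      have := (hC.relMax_mem ha b).trans (hF.le_apply _ i)
      simpa using this
    have h5 : ∑ i, b i ≤ relMax F b a * ∑ i, a i := by
      rw [Finset.mul_sum]
      exact Finset.sum_le_sum fun i _ => h4 i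
    rw [← hab] at h5
    have h6 := hF.sum_pos (hC.ne_zero ha) ha.le
    by_contra! h7
    nlinarith
  have h4 : relMax F a b ≤ Real.exp D := by
    have h5 := hC.relMax_mul_eq_exp ha hb
    have h6 := Real.exp_le_exp.2 hD
    nlinarith
  rw [Real.exp_neg, ← div_eq_mul_inv, div_le_iff₀ (Real.exp_pos _)]
  nlinarith

/-- An automorphism of the cone is bounded in terms of its value at one point. -/
theorem mul_abs_smul_apply_le (hF : IsNormalizedConeFunction F) {g : GL (Fin (n + 1)) ℝ}
    (hg : ∀ w, 0 ≤ F w → 0 ≤ F (g • w)) (ha : 0 < F a) (u : Fin (n + 1) → ℝ) (i : Fin (n + 1)) :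
    F a * |(g • u) i| ≤ (∑ j, |u j|) * (g • a) i := by
  -- The vector (∑ |uⱼ|) a + F(a) u lies in the closed cone, since F is at least (∑ |uⱼ|) F(a) −
  -- F(a) ∑ |uⱼ| = 0 there. Its image under g has nonnegative coordinates. Applying this to u and −u
  -- bounds the absolute value.
  have key : ∀ u : Fin (n + 1) → ℝ, 0 ≤ (∑ j, |u j|) * (g • a) i + F a * (g • u) i := fun u => by
    rcases (Finset.sum_nonneg fun j _ => abs_nonneg (u j) : 0 ≤ ∑ j, |u j|).eq_or_lt with h | h
    · have hu : u = 0 := by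
        funext j
        simpa using (Finset.sum_eq_zero_iff_of_nonneg fun j _ => abs_nonneg (u j)).1 h.symm j
      simp [hu]
    · have h1 := hF.add_le ((∑ j, |u j|) • a) (F a • u)
      rw [hF.apply_smul _ h, hF.apply_smul _ ha] at h1
      have h2 := mul_le_mul_of_nonneg_left (hF.neg_sum_le u) ha.le
      have h3 := (hg _ ((by linarith : (0 : ℝ) ≤ _).trans h1)).trans (hF.le_apply _ i)
      rw [smul_add, smul_comm g, smul_comm g] at h3
      simpa using h3
  have h1 := key u
  have h2 := key (-u)
  simp only [Pi.neg_apply, abs_neg, smul_neg] at h2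
  have h3 : F a * |(g • u) i| = |F a * (g • u) i| := by rw [abs_mul, abs_of_pos ha]
  rw [h3, abs_le]
  constructor <;> linarith

end IsNormalizedConeFunction

/-! ### Homogeneous coordinates -/

/-- The point of `ℝPⁿ` with homogeneous coordinates `w`; a junk value if `w = 0`. -/
def toRP {n : ℕ} (w : Fin (n + 1) → ℝ) : RP n :=
  if h : w ≠ 0 then Projectivization.mk ℝ w h else Projectivization.mk ℝ 1 one_ne_zero

section HomogeneousCoordinates

variable {n : ℕ} {u w : Fin (n + 1) → ℝ}

theorem toRP_of_ne (h : w ≠ 0) : toRP w = Projectivization.mk ℝ w h := dif_pos h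

theorem exists_toRP_eq (p : RP n) : ∃ w, w ≠ 0 ∧ toRP w = p :=
  ⟨p.rep, p.rep_nonzero, by rw [toRP_of_ne p.rep_nonzero, p.mk_rep]⟩

theorem toRP_eq_iff (hu : u ≠ 0) (hw : w ≠ 0) : toRP u = toRP w ↔ ∃ t : ℝ, t ≠ 0 ∧ t • w = u := by
  rw [toRP_of_ne hu, toRP_of_ne hw, Projectivization.mk_eq_mk_iff']
  refine exists_congr fun t => ⟨fun h => ⟨?_, h⟩, And.right⟩
  rintro rfl
  exact hu (by rw [← h, zero_smul])

theorem toRP_smul {t : ℝ} (ht : t ≠ 0) (w : Fin (n + 1) → ℝ) : toRP (t • w) = toRP w := by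
  by_cases hw : w = 0
  · rw [hw, smul_zero]
  · exact (toRP_eq_iff (smul_ne_zero ht hw) hw).2 ⟨t, ht, rfl⟩

theorem exists_rep_toRP (hw : w ≠ 0) : ∃ t : ℝ, t ≠ 0 ∧ (toRP w).rep = t • w := by
  rw [toRP_of_ne hw]
  obtain ⟨t, ht⟩ := Projectivization.exists_smul_eq_mk_rep ℝ w hw
  exact ⟨t, t.ne_zero, ht.symm⟩

theorem mk_smul_toRP (g : GL (Fin (n + 1)) ℝ) (hw : w ≠ 0) :
    (Matrix.ProjGenLinGroup.mk g : PGroup n) • toRP w = toRP (g • w) := by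
  rw [toRP_of_ne hw, toRP_of_ne ((smul_ne_zero_iff_ne g).2 hw), Projectivization.PGL.mk_smul_mk]

theorem toRP_mem_affinePatch {φ : Module.Dual ℝ (Fin (n + 1) → ℝ)} (hw : w ≠ 0) :
    toRP w ∈ affinePatch φ ↔ φ w ≠ 0 := by
  obtain ⟨t, ht, h⟩ := exists_rep_toRP hw
  simp [affinePatch, h, ht]

theorem affineCoord_toRP (φ : Module.Dual ℝ (Fin (n + 1) → ℝ)) (hw : w ≠ 0) :
    affineCoord φ (toRP w) = (φ w)⁻¹ • w := by
  obtain ⟨t, ht, h⟩ := exists_rep_toRP hw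
  rw [affineCoord, h, map_smul, smul_smul, smul_eq_mul, mul_inv, mul_assoc, mul_comm, mul_assoc,
    mul_inv_cancel₀ ht, mul_one]

theorem affineCoord_neg (φ : Module.Dual ℝ (Fin (n + 1) → ℝ)) (p : RP n) :
    affineCoord (-φ) p = -affineCoord φ p := by
  simp [affineCoord, inv_neg]

theorem affinePatch_neg (φ : Module.Dual ℝ (Fin (n + 1) → ℝ)) :
    affinePatch (-φ) = affinePatch φ := by
  ext p
  simp [affinePatch]

theorem isOpen_RP_iff {U : Set (RP n)} : IsOpen U ↔ IsOpen {w | w ≠ 0 ∧ toRP w ∈ U} := by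
  have h0 : IsOpen {w : Fin (n + 1) → ℝ | w ≠ 0} := isOpen_ne
  rw [isOpen_coinduced, h0.isOpenEmbedding_subtypeVal.isOpen_iff_image_isOpen]
  refine iff_of_eq (congrArg IsOpen (Set.ext fun w => ?_))
  constructor
  · rintro ⟨⟨w, hw⟩, h, rfl⟩
    refine ⟨hw, ?_⟩
    rw [toRP_of_ne hw]
    exact h
  · rintro ⟨hw, h⟩
    refine ⟨⟨w, hw⟩, ?_, rfl⟩
    rw [toRP_of_ne hw] at h
    exact h

theorem continuousAt_toRP (hw : w ≠ 0) : ContinuousAt toRP w := by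
  intro N hN
  obtain ⟨U, hUN, hU, hwU⟩ := mem_nhds_iff.1 hN
  rw [mem_map]
  filter_upwards [(isOpen_RP_iff.1 hU).mem_nhds ⟨hw, hwU⟩] with u hu
  exact hUN hu.2

/-- The set of vectors on the lines that meet U is a union of nonzero dilates of U. -/
theorem isOpen_toRP_image {U : Set (Fin (n + 1) → ℝ)} (hU : IsOpen U)
    (h0 : (0 : Fin (n + 1) → ℝ) ∉ U) : IsOpen (toRP '' U) := by
  have h : {w | w ≠ 0 ∧ toRP w ∈ toRP '' U} = ⋃ (t : ℝ) (_ : t ≠ 0), (t • ·) ⁻¹' U := by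
    ext w
    simp only [Set.mem_iUnion, Set.mem_preimage, exists_prop]
    constructor
    · rintro ⟨hw, u, hu, huw⟩
      obtain ⟨t, ht, rfl⟩ := (toRP_eq_iff (fun h => h0 (h ▸ hu)) hw).1 huw
      exact ⟨t, ht, hu⟩
    · rintro ⟨t, ht, h⟩
      refine ⟨?_, _, h, toRP_smul ht w⟩
      rintro rfl
      rw [smul_zero] at h
      exact h0 h
  rw [isOpen_RP_iff, h]
  exact isOpen_biUnion fun t _ => hU.preimage (continuous_const_smul t)

/-- The open subset of `ℝPⁿ` determined by the cone `0 < F`. -/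
def projCone {n : ℕ} (F : (Fin (n + 1) → ℝ) → ℝ) : Set (RP n) := toRP '' {w | 0 < F w}

variable {F : (Fin (n + 1) → ℝ) → ℝ}

namespace IsConeFunction

theorem toRP_mem (hF : IsConeFunction F) (hw : w ≠ 0) :
    toRP w ∈ projCone F ↔ 0 < F w ∨ 0 < F (-w) := by
  constructor
  · rintro ⟨u, hu, h⟩
    obtain ⟨t, ht, rfl⟩ := (toRP_eq_iff (hF.ne_zero hu) hw).1 h
    rcases ht.lt_or_gt with h | h
    · right
      have := hF.smul_pos (a := t • w) hu (t := -t⁻¹) (by simpa using h)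
      rwa [smul_smul, neg_mul, inv_mul_cancel₀ ht, neg_one_smul] at this
    · left
      have := hF.smul_pos (a := t • w) hu (t := t⁻¹) (by simpa using h)
      rwa [smul_smul, inv_mul_cancel₀ ht, one_smul] at this
  · rintro (h | h)
    · exact ⟨w, h, rfl⟩
    · exact ⟨-w, h, by rw [← neg_one_smul ℝ w, toRP_smul (by norm_num)]⟩

theorem toRP_eq_iff_pos (hF : IsConeFunction F) (hu : 0 < F u) (hw : 0 < F w) :
    toRP u = toRP w ↔ ∃ t : ℝ, 0 < t ∧ t • w = u := by
  rw [toRP_eq_iff (hF.ne_zero hu) (hF.ne_zero hw)]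
  constructor
  · rintro ⟨t, -, rfl⟩
    exact ⟨t, hF.pos_of_smul hw hu, rfl⟩
  · rintro ⟨t, ht, h⟩
    exact ⟨t, ht.ne', h⟩

theorem isOpen_projCone (hF : IsConeFunction F) : IsOpen (projCone F) :=
  isOpen_toRP_image (isOpen_lt continuous_const hF.cont) fun h => (hF.ne_zero h) rfl

/-- The lines on which F is negative in both directions form an open set that misses the
projectivized cone. -/
theorem exists_of_mem_closure (hF : IsConeFunction F) {p : RP n} (hp : p ∈ closure (projCone F)) :
    ∃ w, w ≠ 0 ∧ 0 ≤ F w ∧ toRP w = p := by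
  obtain ⟨w, hw, rfl⟩ := exists_toRP_eq p
  by_contra! hcon
  have h1 : F w < 0 := not_le.1 fun h => hcon w hw h rfl
  have h2 : F (-w) < 0 := not_le.1 fun h => hcon (-w) (neg_ne_zero.2 hw) h
    (by rw [← neg_one_smul ℝ w, toRP_smul (by norm_num)])
  have hU : IsOpen {w : Fin (n + 1) → ℝ | F w < 0 ∧ F (-w) < 0} :=
    (isOpen_lt hF.cont continuous_const).inter
      (isOpen_lt (hF.cont.comp continuous_neg) continuous_const)
  have h0 : (0 : Fin (n + 1) → ℝ) ∉ {w : Fin (n + 1) → ℝ | F w < 0 ∧ F (-w) < 0} := fun h =>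
    h.1.ne hF.apply_zero
  obtain ⟨_, ⟨u, hu, rfl⟩, hu'⟩ := mem_closure_iff.1 hp _ (isOpen_toRP_image hU h0)
    ⟨w, ⟨h1, h2⟩, rfl⟩
  rcases (hF.toRP_mem fun h => h0 (h ▸ hu)).1 hu' with h | h
  · exact h.not_gt hu.1
  · exact h.not_gt hu.2

theorem toRP_mem_closure (hF : IsConeFunction F) {v : Fin (n + 1) → ℝ} (hv : 0 < F v) (hw : w ≠ 0)
    (h : 0 ≤ F w) : toRP w ∈ closure (projCone F) := by
  have h1 : Tendsto (fun t : ℝ => toRP (w + t • v)) (𝓝[>] 0) (𝓝 (toRP w)) := by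
    have hc : Continuous fun t : ℝ => w + t • v := by fun_prop
    have h2 := (hc.tendsto 0).mono_left (nhdsWithin_le_nhds (s := Set.Ioi 0))
    rw [zero_smul, add_zero] at h2
    exact (continuousAt_toRP hw).tendsto.comp h2
  refine mem_closure_of_tendsto h1 (eventually_nhdsWithin_of_forall fun t ht => ?_)
  exact ⟨_, hF.pos_add_smul h hv ht, rfl⟩

theorem toRP_mem_frontier (hF : IsConeFunction F) {v : Fin (n + 1) → ℝ} (hv : 0 < F v) (hw : w ≠ 0)
    (h : F w = 0) : toRP w ∈ frontier (projCone F) := by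
  rw [hF.isOpen_projCone.frontier_eq]
  refine ⟨hF.toRP_mem_closure hv hw h.ge, fun hm => ?_⟩
  rcases (hF.toRP_mem hw).1 hm with h1 | h1
  · exact h1.ne' h
  · exact h1.not_gt (hF.sharp w hw h.ge)

theorem exists_of_mem_frontier (hF : IsConeFunction F) {p : RP n}
    (hp : p ∈ frontier (projCone F)) : ∃ w, w ≠ 0 ∧ F w = 0 ∧ toRP w = p := by
  rw [hF.isOpen_projCone.frontier_eq] at hp
  obtain ⟨w, hw, h, rfl⟩ := hF.exists_of_mem_closure hp.1
  exact ⟨w, hw, le_antisymm (not_lt.1 fun h => hp.2 ⟨w, h, rfl⟩) h, rfl⟩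

end IsConeFunction

end HomogeneousCoordinates

/-! ### The Hilbert metric as a cone metric -/

namespace IsConeFunction

variable {n : ℕ} {F : (Fin (n + 1) → ℝ) → ℝ} {a b x y : Fin (n + 1) → ℝ}

/-- If b = (1 − s) a + s y, then (1 − s)⁻¹ b − a is a positive multiple of the boundary vector y. So
M(a/b) = (1 − s)⁻¹, which is also the ratio of the lengths of a − y and b − y: each M is one half of
the cross ratio. -/
theorem relMax_eq_norm_div (hF : IsConeFunction F) (hb : 0 < F b) (hy : F y = 0)
    (hab : a ≠ b) (h : Wbtw ℝ a b y) : b ≠ y ∧ relMax F a b = ‖a - y‖ / ‖b - y‖ := by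
  obtain ⟨s, ⟨hs0, hs1⟩, hs⟩ := h
  rw [AffineMap.lineMap_apply_module] at hs
  have hs0 : 0 < s := lt_of_le_of_ne hs0 (by rintro rfl; simp at hs; exact hab hs)
  have hs1 : s < 1 := lt_of_le_of_ne hs1 (by
    rintro rfl
    simp at hs
    exact hb.ne' (hs ▸ hy))
  have h1 : 0 < 1 - s := by linarith
  have hne : b ≠ y := by
    rintro rfl
    exact hb.ne' hy
  refine ⟨hne, ?_⟩
  have h2 : b - y = (1 - s) • (a - y) := by rw [← hs]; module
  have h3 : (1 - s)⁻¹ • b - a = (s * (1 - s)⁻¹) • y := by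
    rw [← hs, smul_add, smul_smul, smul_smul, inv_mul_cancel₀ h1.ne', mul_comm s]
    module
  have h4 : a - y ≠ 0 := by
    intro h
    rw [h, smul_zero, sub_eq_zero] at h2
    exact hne h2
  rw [hF.relMax_eq hb (t := (1 - s)⁻¹), h2, norm_smul, Real.norm_of_nonneg h1.le]
  · have := norm_ne_zero_iff.2 h4
    field_simp
  · rw [h3, hF.apply_smul _ (by positivity), hy, mul_zero]

theorem cross_ratio_eq (hF : IsConeFunction F) (ha : 0 < F a) (hb : 0 < F b) (hx : F x = 0)
    (hy : F y = 0) (hab : a ≠ b) (h : Wbtw ℝ x a b) (h' : Wbtw ℝ a b y) :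
    ‖b - x‖ * ‖a - y‖ / (‖b - y‖ * ‖a - x‖) = relMax F a b * relMax F b a := by
  rw [(hF.relMax_eq_norm_div hb hy hab h').2,
    (hF.relMax_eq_norm_div ha hx hab.symm h.symm).2, div_mul_div_comm]
  ring

/-- The ray from a through b leaves the cone in the direction of M(a/b) b − a; rescaling this vector
to φ = 1 gives the endpoint y. -/
theorem exists_wbtw (hF : IsConeFunction F) {φ : Module.Dual ℝ (Fin (n + 1) → ℝ)}
    (hφ : ∀ w, w ≠ 0 → 0 ≤ F w → 0 < φ w) (hb : 0 < F b) (hφa : φ a = 1)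
    (hφb : φ b = 1) (hab : a ≠ b) : ∃ y, φ y = 1 ∧ F y = 0 ∧ Wbtw ℝ a b y := by
  set t := relMax F a b with ht
  have h0 : F (t • b - a) = 0 := hF.apply_relMax hb a
  have h1 : φ (t • b - a) = t - 1 := by simp [hφa, hφb]
  have h2 : t • b - a ≠ 0 := by
    intro h
    rw [h, map_zero] at h1
    rw [show t = 1 by linarith, one_smul, sub_eq_zero] at h
    exact hab h.symm
  have h3 : 0 < t - 1 := h1 ▸ hφ _ h2 h0.ge
  have h4 : 0 < t := by linarith
  refine ⟨(t - 1)⁻¹ • (t • b - a), ?_, ?_, (t - 1) / t, ⟨by positivity, ?_⟩, ?_⟩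
  · rw [map_smul, h1, smul_eq_mul, inv_mul_cancel₀ h3.ne']
  · rw [hF.apply_smul _ (by positivity), h0, mul_zero]
  · rw [div_le_one h4]
    linarith
  · rw [AffineMap.lineMap_apply_module, smul_smul,
      show (t - 1) / t * (t - 1)⁻¹ = t⁻¹ by field_simp, smul_sub, smul_smul,
      inv_mul_cancel₀ h4.ne', show 1 - (t - 1) / t = t⁻¹ by field_simp; ring]
    module

/-- If φ had opposite signs at v and at a vector w of the closed cone, a positive combination of the
two would be a point of the open cone in the kernel of φ. -/
theorem dual_pos_or_neg (hF : IsConeFunction F) {v : Fin (n + 1) → ℝ} (hv : 0 < F v)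
    {φ : Module.Dual ℝ (Fin (n + 1) → ℝ)} (hφ : closure (projCone F) ⊆ affinePatch φ) :
    (∀ w, w ≠ 0 → 0 ≤ F w → 0 < φ w) ∨ (∀ w, w ≠ 0 → 0 ≤ F w → 0 < (-φ) w) := by
  have hne : ∀ w, w ≠ 0 → 0 ≤ F w → φ w ≠ 0 := fun w hw h =>
    (toRP_mem_affinePatch hw).1 (hφ (hF.toRP_mem_closure hv hw h))
  have key : ∀ ψ : Module.Dual ℝ (Fin (n + 1) → ℝ), (∀ w, w ≠ 0 → 0 ≤ F w → ψ w ≠ 0) → 0 < ψ v →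
      ∀ w, w ≠ 0 → 0 ≤ F w → 0 < ψ w := by
    intro ψ hψ hψv w hw h
    by_contra! hle
    have hlt : ψ w < 0 := lt_of_le_of_ne hle (hψ w hw h)
    have hz : 0 < F (ψ v • w + (-ψ w) • v) :=
      hF.pos_add_smul (by rw [hF.apply_smul _ hψv]; positivity) hv (by linarith)
    refine hψ _ (hF.ne_zero hz) hz.le ?_
    simp only [map_add, map_smul, smul_eq_mul]
    ring
  rcases (hne v (hF.ne_zero hv) hv.le).lt_or_gt with h | h
  · exact Or.inr (key (-φ) (fun w hw h => by simpa using hne w hw h) (by simpa using h))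
  · exact Or.inl (key φ hne h)

/-- Both halves are needed: any admissible patch and endpoints give the cone distance, and an
admissible choice exists. Hence the infimum defining `hilbertDist` is over a singleton. -/
theorem isLogCrossRatio_iff (hF : IsConeFunction F)
    (hp : ∃ φ : Module.Dual ℝ (Fin (n + 1) → ℝ), φ ≠ 0 ∧ closure (projCone F) ⊆ affinePatch φ)
    (ha : 0 < F a) (hb : 0 < F b) {d : ℝ} :
    IsLogCrossRatio (projCone F) (toRP a) (toRP b) d ↔ d = coneDist F a b := by
  have ha0 := hF.ne_zero ha
  have hb0 := hF.ne_zero hb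
  by_cases hab : toRP a = toRP b
  · obtain ⟨t, ht, rfl⟩ := (hF.toRP_eq_iff_pos ha hb).1 hab
    have h0 : coneDist F (t • b) b = 0 := by
      have h1 := hF.coneDist_smul hb hb ht one_pos
      rwa [one_smul, hF.coneDist_self hb] at h1
    simp [IsLogCrossRatio, hab, h0]
  have hmain : ∀ φ : Module.Dual ℝ (Fin (n + 1) → ℝ), (∀ w, w ≠ 0 → 0 ≤ F w → 0 < φ w) →
      0 < φ a ∧ 0 < φ b ∧ (φ a)⁻¹ • a ≠ (φ b)⁻¹ • b := fun φ hφ => by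
    refine ⟨hφ a ha0 ha.le, hφ b hb0 hb.le, fun h => hab ?_⟩
    rw [← toRP_smul (inv_ne_zero (hφ a ha0 ha.le).ne') a, h,
      toRP_smul (inv_ne_zero (hφ b hb0 hb.le).ne') b]
  have hco : ∀ φ : Module.Dual ℝ (Fin (n + 1) → ℝ), (∀ w, w ≠ 0 → 0 ≤ F w → 0 < φ w) →
      ∀ x ∈ frontier (projCone F), F (affineCoord φ x) = 0 := by
    intro φ hφ x hx
    obtain ⟨w, hw, hw0, rfl⟩ := hF.exists_of_mem_frontier hx
    rw [affineCoord_toRP φ hw, hF.apply_smul _ (inv_pos.2 (hφ w hw hw0.ge)), hw0, mul_zero]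
  have hcross : ∀ φ : Module.Dual ℝ (Fin (n + 1) → ℝ), (∀ w, w ≠ 0 → 0 ≤ F w → 0 < φ w) →
      ∀ x ∈ frontier (projCone F), ∀ y ∈ frontier (projCone F),
      Wbtw ℝ (affineCoord φ x) (affineCoord φ (toRP a)) (affineCoord φ (toRP b)) →
      Wbtw ℝ (affineCoord φ (toRP a)) (affineCoord φ (toRP b)) (affineCoord φ y) →
      Real.log
        ((‖affineCoord φ (toRP b) - affineCoord φ x‖ * ‖affineCoord φ (toRP a) - affineCoord φ y‖) /
          (‖affineCoord φ (toRP b) - affineCoord φ y‖ *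
            ‖affineCoord φ (toRP a) - affineCoord φ x‖)) = coneDist F a b := by
    intro φ hφ x hx y hy h h'
    obtain ⟨hφa, hφb, hne⟩ := hmain φ hφ
    rw [affineCoord_toRP φ ha0, affineCoord_toRP φ hb0] at h h' ⊢
    rw [hF.cross_ratio_eq (hF.smul_pos ha (inv_pos.2 hφa)) (hF.smul_pos hb (inv_pos.2 hφb))
      (hco φ hφ x hx) (hco φ hφ y hy) hne h h',
      ← hF.coneDist_smul ha hb (inv_pos.2 hφa) (inv_pos.2 hφb), coneDist]
  constructor
  · rintro (⟨h, -⟩ | ⟨-, φ, -, hcl, x, hx, y, hy, h, h', rfl⟩)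
    · exact absurd h hab
    rcases hF.dual_pos_or_neg ha hcl with hφ | hφ
    · exact hcross φ hφ x hx y hy h h'
    -- The forms φ and −φ define the same patch but opposite affine coordinates; betweenness and
    -- norms are unaffected by the sign.
    · have k := hcross (-φ) hφ x hx y hy
      have hneg : ∀ p q r : Fin (n + 1) → ℝ, Wbtw ℝ p q r → Wbtw ℝ (-p) (-q) (-r) :=
        fun p q r h => h.map (-LinearMap.id : (Fin (n + 1) → ℝ) →ₗ[ℝ] _).toAffineMap
      simp only [affineCoord_neg, neg_sub_neg, norm_sub_rev (affineCoord φ x),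
        norm_sub_rev (affineCoord φ y)] at k
      exact k (hneg _ _ _ h) (hneg _ _ _ h')
  · rintro rfl
    obtain ⟨φ, hφ0, hcl, hφ⟩ : ∃ φ : Module.Dual ℝ (Fin (n + 1) → ℝ), φ ≠ 0 ∧
        closure (projCone F) ⊆ affinePatch φ ∧ ∀ w, w ≠ 0 → 0 ≤ F w → 0 < φ w := by
      obtain ⟨φ, h0, h⟩ := hp
      rcases hF.dual_pos_or_neg ha h with hφ | hφ
      · exact ⟨φ, h0, h, hφ⟩
      · exact ⟨-φ, neg_ne_zero.2 h0, by rwa [affinePatch_neg], hφ⟩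
    obtain ⟨hφa, hφb, hne⟩ := hmain φ hφ
    have hFa := hF.smul_pos ha (inv_pos.2 hφa)
    have hFb := hF.smul_pos hb (inv_pos.2 hφb)
    have h1a : φ ((φ a)⁻¹ • a) = 1 := by simp [hφa.ne']
    have h1b : φ ((φ b)⁻¹ • b) = 1 := by simp [hφb.ne']
    obtain ⟨y, hy1, hy0, hy⟩ := hF.exists_wbtw hφ hFb h1a h1b hne
    obtain ⟨x, hx1, hx0, hx⟩ := hF.exists_wbtw hφ hFa h1b h1a hne.symm
    have hne0 : ∀ w, φ w = 1 → w ≠ 0 := by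
      rintro w hw rfl
      simp at hw
    have hxf := hF.toRP_mem_frontier ha (hne0 x hx1) hx0
    have hyf := hF.toRP_mem_frontier ha (hne0 y hy1) hy0
    have hxc : affineCoord φ (toRP x) = x := by simp [affineCoord_toRP φ (hne0 x hx1), hx1]
    have hyc : affineCoord φ (toRP y) = y := by simp [affineCoord_toRP φ (hne0 y hy1), hy1]
    have hw : Wbtw ℝ (affineCoord φ (toRP x)) (affineCoord φ (toRP a))
        (affineCoord φ (toRP b)) := by
      rw [hxc, affineCoord_toRP φ ha0, affineCoord_toRP φ hb0]
      exact hx.symm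
    have hw' : Wbtw ℝ (affineCoord φ (toRP a)) (affineCoord φ (toRP b))
        (affineCoord φ (toRP y)) := by
      rw [hyc, affineCoord_toRP φ ha0, affineCoord_toRP φ hb0]
      exact hy
    exact Or.inr ⟨hab, φ, hφ0, hcl, toRP x, hxf, toRP y, hyf, hw, hw',
      (hcross φ hφ _ hxf _ hyf hw hw').symm⟩

theorem hilbertDist_eq (hF : IsConeFunction F)
    (hp : ∃ φ : Module.Dual ℝ (Fin (n + 1) → ℝ), φ ≠ 0 ∧ closure (projCone F) ⊆ affinePatch φ)
    (ha : 0 < F a) (hb : 0 < F b) :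
    hilbertDist (projCone F) (toRP a) (toRP b) = coneDist F a b := by
  have : {d | IsLogCrossRatio (projCone F) (toRP a) (toRP b) d} = {coneDist F a b} :=
    Set.ext fun d => hF.isLogCrossRatio_iff hp ha hb
  rw [hilbertDist, this, csInf_singleton]

end IsConeFunction

open Matrix

/-! ### Linear lifts of the holonomy group -/

theorem scalar_smul {n : ℕ} (t : ℝˣ) (w : Fin (n + 1) → ℝ) :
    GeneralLinearGroup.scalar (Fin (n + 1)) t • w = (t : ℝ) • w := by
  change (GeneralLinearGroup.scalar (Fin (n + 1)) t : Matrix (Fin (n + 1)) (Fin (n + 1)) ℝ) *ᵥ w = _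
  simp

theorem GL_smul_apply {n : ℕ} (g : GL (Fin (n + 1)) ℝ) (w : Fin (n + 1) → ℝ) (i : Fin (n + 1)) :
    (g • w) i = ∑ j, (g : Matrix _ _ ℝ) i j * w j := rfl

theorem continuous_GL_smul {n : ℕ} (g : GL (Fin (n + 1)) ℝ) :
    Continuous fun w : Fin (n + 1) → ℝ => g • w := by
  refine continuous_pi fun i => ?_
  simp only [GL_smul_apply]
  fun_prop

theorem exists_smul_of_mem_center {n : ℕ} {g : GL (Fin (n + 1)) ℝ} (hg : g ∈ Subgroup.center _) :
    ∃ t : ℝˣ, ∀ w : Fin (n + 1) → ℝ, g • w = (t : ℝ) • w := by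
  rw [GeneralLinearGroup.center_eq_range_scalar] at hg
  obtain ⟨t, rfl⟩ := hg
  exact ⟨t, scalar_smul t⟩

/-- A matrix is scalar if all the vectors of some nonempty open set are eigenvectors. -/
theorem mem_center_of_isOpen {n : ℕ} {g : GL (Fin (n + 1)) ℝ} {U : Set (Fin (n + 1) → ℝ)}
    (hU : IsOpen U) (hne : U.Nonempty) (h : ∀ u ∈ U, ∃ t : ℝ, g • u = t • u) :
    g ∈ Subgroup.center _ := by
  obtain ⟨u, hu⟩ := hne
  -- Being an eigenvector implies the vanishing of the quadratic forms q(z) = (g z)ᵢ zⱼ − (g z)ⱼ zᵢ.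
  -- They vanish on U, and the second difference q(u + s z) + q(u − s z) − 2 q(u) = 2 s² q(z) shows
  -- that they vanish everywhere.
  have key : ∀ z : Fin (n + 1) → ℝ, ∀ i j, (g • z) i * z j = (g • z) j * z i := by
    intro z i j
    have hc : Continuous fun s : ℝ => u + s • z := by fun_prop
    have h1 : ∀ᶠ s : ℝ in 𝓝 0, u + s • z ∈ U :=
      (hc.tendsto' 0 u (by simp)).eventually (hU.mem_nhds hu)
    have hc' : Continuous fun s : ℝ => u + (-s) • z := by fun_prop
    have h2 : ∀ᶠ s : ℝ in 𝓝 0, u + (-s) • z ∈ U :=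
      (hc'.tendsto' 0 u (by simp)).eventually (hU.mem_nhds hu)
    obtain ⟨s, ⟨h1, h2⟩, hs⟩ := (((h1.and h2).filter_mono nhdsWithin_le_nhds).and
      (self_mem_nhdsWithin : Set.Ioi (0 : ℝ) ∈ 𝓝[>] 0)).exists
    have hq : ∀ v ∈ U, (g • v) i * v j = (g • v) j * v i := fun v hv => by
      obtain ⟨t, ht⟩ := h v hv
      simp only [ht, Pi.smul_apply, smul_eq_mul]
      ring
    have e0 := hq _ hu
    have e1 := hq _ h1
    have e2 := hq _ h2
    simp only [smul_add, smul_comm g, Pi.add_apply, Pi.smul_apply, smul_eq_mul] at e1 e2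
    have hs2 : s ^ 2 * ((g • z) i * z j) = s ^ 2 * ((g • z) j * z i) := by linarith
    exact mul_left_cancel₀ (pow_ne_zero 2 (ne_of_gt hs)) hs2
  have hcol : ∀ i j, (g • (Pi.single j 1 : Fin (n + 1) → ℝ)) i = (g : Matrix _ _ ℝ) i j := by
    intro i j
    simp [GL_smul_apply, Pi.single_apply]
  have hoff : ∀ i j, i ≠ j → (g : Matrix _ _ ℝ) i j = 0 := fun i j hij => by
    have := key (Pi.single j 1) i j
    simpa [hcol, Pi.single_apply, hij] using this
  have hdiag : ∀ i j, (g : Matrix _ _ ℝ) i i = (g : Matrix _ _ ℝ) j j := fun i j => by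
    rcases eq_or_ne i j with rfl | hij
    · rfl
    have := key (Pi.single i 1 + Pi.single j 1) i j
    simpa [smul_add, hcol, Pi.single_apply, hij, hij.symm, hoff i j hij, hoff j i hij.symm]
      using this
  rw [Subgroup.mem_center_iff]
  intro h
  refine Units.ext ?_
  have hg : (g : Matrix (Fin (n + 1)) (Fin (n + 1)) ℝ) =
      Matrix.scalar (Fin (n + 1)) ((g : Matrix (Fin (n + 1)) (Fin (n + 1)) ℝ) 0 0) := by
    ext i j
    rcases eq_or_ne i j with rfl | hij
    · simp [hdiag i 0]
    · simp [hoff i j hij, hij]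
  rw [Units.val_mul, Units.val_mul, hg]
  exact ((Matrix.scalar_commute _ (fun _ => Commute.all _ _) _).eq).symm

/-- `Ω` is the projectivization of the cone `0 < F`, and `Γ` is the image of the group `G` of
automorphisms of this cone. -/
structure Uniformizes {n : ℕ} (M : ProperlyConvexManifold n) (F : (Fin (n + 1) → ℝ) → ℝ)
    (G : Subgroup (GL (Fin (n + 1)) ℝ)) : Prop where
  cone : IsConeFunction F
  Ω_eq : M.Ω = projCone F
  Γ_eq : M.Γ = G.map ProjGenLinGroup.mk
  smul_pos : ∀ g ∈ G, ∀ w, 0 < F w → 0 < F (g • w)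
  scalar_mem : ∀ t : ℝˣ, 0 < (t : ℝ) → GeneralLinearGroup.scalar (Fin (n + 1)) t ∈ G

open scoped Classical in
/-- The projection of the cone over `Ω` to `M = Ω / Γ`, with value `x` outside the cone. -/
def ProperlyConvexManifold.conePt {n : ℕ} (M : ProperlyConvexManifold n) (x : M.Space)
    (w : Fin (n + 1) → ℝ) : M.Space :=
  if h : toRP w ∈ M.Ω then M.proj ⟨toRP w, h⟩ else x

namespace Uniformizes

variable {n : ℕ} {M : ProperlyConvexManifold n} {F : (Fin (n + 1) → ℝ) → ℝ}
  {G : Subgroup (GL (Fin (n + 1)) ℝ)} {w w' : Fin (n + 1) → ℝ}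

theorem toRP_mem (h : Uniformizes M F G) (hw : 0 < F w) : toRP w ∈ M.Ω := by
  rw [h.Ω_eq]
  exact ⟨w, hw, rfl⟩

theorem conePt_eq (h : Uniformizes M F G) (x : M.Space) (hw : 0 < F w) :
    M.conePt x w = M.proj ⟨toRP w, h.toRP_mem hw⟩ := dif_pos (h.toRP_mem hw)

theorem exists_pos (h : Uniformizes M F G) (a : M.Ω) : ∃ w, 0 < F w ∧ toRP w = a := by
  have ha : (a : RP n) ∈ projCone F := h.Ω_eq ▸ a.2
  exact ha

theorem exists_conePt_eq (h : Uniformizes M F G) (x p : M.Space) :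
    ∃ w, 0 < F w ∧ M.conePt x w = p := by
  obtain ⟨a, rfl⟩ : ∃ a, M.proj a = p := Quotient.exists_rep p
  obtain ⟨w, hw, hwa⟩ := h.exists_pos a
  refine ⟨w, hw, ?_⟩
  rw [h.conePt_eq x hw]
  exact congrArg M.proj (Subtype.ext hwa)

theorem mk_smul_toRP_eq_iff (h : Uniformizes M F G) {g : GL (Fin (n + 1)) ℝ} (hg : g ∈ G)
    (hw : 0 < F w) (hw' : 0 < F w') :
    (ProjGenLinGroup.mk g : PGroup n) • toRP w = toRP w' ↔ ∃ g' ∈ G, g' • w = w' ∧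
      (ProjGenLinGroup.mk g' : PGroup n) = ProjGenLinGroup.mk g := by
  constructor
  · intro e
    rw [mk_smul_toRP g (h.cone.ne_zero hw), eq_comm,
      h.cone.toRP_eq_iff_pos hw' (h.smul_pos g hg w hw)] at e
    obtain ⟨t, ht, e⟩ := e
    refine ⟨GeneralLinearGroup.scalar _ (Units.mk0 t ht.ne') * g,
      G.mul_mem (h.scalar_mem _ ht) hg, ?_, ?_⟩
    · rw [mul_smul, scalar_smul]
      exact e
    · rw [map_mul, ProjGenLinGroup.mk_scalar, one_mul]
  · rintro ⟨g', -, e, e'⟩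
    rw [← e', mk_smul_toRP g' (h.cone.ne_zero hw), e]

theorem proj_eq_iff (h : Uniformizes M F G) (hw : 0 < F w) (hw' : 0 < F w') :
    M.proj ⟨toRP w, h.toRP_mem hw⟩ = M.proj ⟨toRP w', h.toRP_mem hw'⟩ ↔ ∃ g ∈ G, g • w = w' := by
  have h1 : M.proj ⟨toRP w, h.toRP_mem hw⟩ = M.proj ⟨toRP w', h.toRP_mem hw'⟩ ↔
      ∃ γ ∈ M.Γ, γ • toRP w = toRP w' := Quotient.eq (r := M.orbitSetoid)
  rw [h1, h.Γ_eq]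
  constructor
  · rintro ⟨_, ⟨g, hg, rfl⟩, e⟩
    obtain ⟨g', hg', e', -⟩ := (h.mk_smul_toRP_eq_iff hg hw hw').1 e
    exact ⟨g', hg', e'⟩
  · rintro ⟨g, hg, e⟩
    exact ⟨_, ⟨g, hg, rfl⟩, (h.mk_smul_toRP_eq_iff hg hw hw').2 ⟨g, hg, e, rfl⟩⟩

theorem conePt_eq_iff (h : Uniformizes M F G) (x : M.Space) (hw : 0 < F w) (hw' : 0 < F w') :
    M.conePt x w = M.conePt x w' ↔ ∃ g ∈ G, g • w = w' := by
  rw [h.conePt_eq x hw, h.conePt_eq x hw', h.proj_eq_iff hw hw']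

theorem hilbertDist_eq (h : Uniformizes M F G) (hw : 0 < F w) (hw' : 0 < F w') :
    hilbertDist M.Ω (toRP w) (toRP w') = coneDist F w w' := by
  have hp := M.properlyConvex.2
  rw [h.Ω_eq] at hp ⊢
  exact h.cone.hilbertDist_eq hp hw hw'

theorem coneDist_smul_smul (h : Uniformizes M F G) {g : GL (Fin (n + 1)) ℝ} (hg : g ∈ G)
    (hw : 0 < F w) (hw' : 0 < F w') : coneDist F (g • w) (g • w') = coneDist F w w' :=
  h.cone.coneDist_smul_smul (h.smul_pos g hg) (h.smul_pos _ (G.inv_mem hg)) hw hw'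

theorem mDist_le (h : Uniformizes M F G) (x : M.Space) (hw : 0 < F w) (hw' : 0 < F w') :
    M.mDist (M.conePt x w) (M.conePt x w') ≤ coneDist F w w' := by
  refine csInf_le ⟨0, ?_⟩ ⟨_, _, (h.conePt_eq x hw).symm, (h.conePt_eq x hw').symm,
    (h.hilbertDist_eq hw hw').symm⟩
  rintro _ ⟨a, b, -, -, rfl⟩
  obtain ⟨u, hu, hua⟩ := h.exists_pos a
  obtain ⟨v, hv, hvb⟩ := h.exists_pos b
  rw [← hua, ← hvb, h.hilbertDist_eq hu hv]
  exact h.cone.coneDist_nonneg hu hv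

/-- Lifts that nearly realize the infimum can be moved by a group element so that the first one
becomes w; the second is then in the orbit of w'. -/
theorem exists_coneDist_lt (h : Uniformizes M F G) (x : M.Space) (hw : 0 < F w) (hw' : 0 < F w')
    {η : ℝ} (hη : 0 < η) :
    ∃ g ∈ G, coneDist F w (g • w') < M.mDist (M.conePt x w) (M.conePt x w') + η := by
  obtain ⟨_, ⟨a, b, ha, hb, rfl⟩, hlt⟩ := exists_lt_of_csInf_lt
    (s := {d | ∃ a b : M.Ω, M.proj a = M.conePt x w ∧ M.proj b = M.conePt x w' ∧
      d = hilbertDist M.Ω a b})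
    ⟨_, _, _, (h.conePt_eq x hw).symm, (h.conePt_eq x hw').symm, rfl⟩
    (lt_add_of_pos_right (M.mDist (M.conePt x w) (M.conePt x w')) hη)
  obtain ⟨u, hu, hua⟩ := h.exists_pos a
  obtain ⟨v, hv, hvb⟩ := h.exists_pos b
  rw [← hua, ← hvb, h.hilbertDist_eq hu hv] at hlt
  have ha' : a = ⟨toRP u, h.toRP_mem hu⟩ := Subtype.ext hua.symm
  have hb' : b = ⟨toRP v, h.toRP_mem hv⟩ := Subtype.ext hvb.symm
  rw [ha', h.conePt_eq x hw, h.proj_eq_iff hu hw] at ha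
  rw [hb', h.conePt_eq x hw', eq_comm, h.proj_eq_iff hw' hv] at hb
  obtain ⟨g, hg, rfl⟩ := ha
  obtain ⟨g', hg', rfl⟩ := hb
  refine ⟨g * g', G.mul_mem hg hg', ?_⟩
  rwa [mul_smul, h.coneDist_smul_smul hg hu hv]

end Uniformizes

/-! ### Limits of groups of cone automorphisms -/

/-- A group of automorphisms of a normalized cone, containing the homotheties, whose image in
`PGL(n+1, ℝ)` is torsion-free and which displaces the points of the Hilbert ball of radius `ε`
about `(1, …, 1)` out of this ball. -/
structure IsThickGroup {n : ℕ} (ε : ℝ) (F : (Fin (n + 1) → ℝ) → ℝ)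
    (G : Subgroup (GL (Fin (n + 1)) ℝ)) : Prop where
  normalized : IsNormalizedConeFunction F
  smul_pos : ∀ g ∈ G, ∀ w, 0 < F w → 0 < F (g • w)
  scalar_mem : ∀ t : ℝˣ, 0 < (t : ℝ) → GeneralLinearGroup.scalar (Fin (n + 1)) t ∈ G
  thick : ∀ g ∈ G, ∀ w, 0 < F w → coneDist F 1 w < ε → coneDist F 1 (g • w) < ε →
    g ∈ Subgroup.center _
  torsion : ∀ g ∈ G, ∀ m : ℕ, m ≠ 0 → g ^ m ∈ Subgroup.center _ → g ∈ Subgroup.center _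

/-- The group of the limits of elements of the groups `H i` along the filter `l`. -/
def limitGroup {n : ℕ} {ι : Type*} (l : Filter ι) (H : ι → Subgroup (GL (Fin (n + 1)) ℝ)) :
    Subgroup (GL (Fin (n + 1)) ℝ) where
  carrier := {g | ∃ h : ι → GL (Fin (n + 1)) ℝ, (∀ i, h i ∈ H i) ∧ Tendsto h l (𝓝 g)}
  mul_mem' := by
    rintro _ _ ⟨h, hh, ht⟩ ⟨k, hk, ht'⟩
    exact ⟨fun i => h i * k i, fun i => (H i).mul_mem (hh i) (hk i), ht.mul ht'⟩
  one_mem' := ⟨fun _ => 1, fun i => (H i).one_mem, tendsto_const_nhds⟩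
  inv_mem' := by
    rintro _ ⟨h, hh, ht⟩
    exact ⟨fun i => (h i)⁻¹, fun i => (H i).inv_mem (hh i), ht.inv⟩

theorem tendsto_GL_smul {n : ℕ} {ι : Type*} {l : Filter ι} {h : ι → GL (Fin (n + 1)) ℝ}
    {g : GL (Fin (n + 1)) ℝ} {u : ι → Fin (n + 1) → ℝ} {w : Fin (n + 1) → ℝ}
    (hh : Tendsto h l (𝓝 g)) (hu : Tendsto u l (𝓝 w)) :
    Tendsto (fun i => h i • u i) l (𝓝 (g • w)) := by
  have hm : Tendsto (fun i => (h i : Matrix (Fin (n + 1)) (Fin (n + 1)) ℝ)) l (𝓝 g) :=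
    (Units.continuous_val.tendsto g).comp hh
  refine tendsto_pi_nhds.2 fun j => ?_
  simp only [GL_smul_apply]
  refine tendsto_finsetSum _ fun k _ => Tendsto.mul ?_ (tendsto_pi_nhds.1 hu k)
  exact tendsto_pi_nhds.1 (tendsto_pi_nhds.1 hm j) k

theorem exists_tendsto_matrix {m : Type*} {ι : Type*} (l : Ultrafilter ι) {A : ι → Matrix m m ℝ}
    {C : ℝ} (hA : ∀ᶠ i in (l : Filter ι), ∀ j k, |A i j k| ≤ C) :
    ∃ B : Matrix m m ℝ, Tendsto A l (𝓝 B) := by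
  have h : ∀ j k, ∃ y, Tendsto (fun i => A i j k) l (𝓝 y) := fun j k => by
    obtain ⟨y, -, hy⟩ := (isCompact_Icc (a := -C) (b := C)).ultrafilter_le_nhds
      (l.map fun i => A i j k) (by
        rw [le_principal_iff]
        exact mem_map.2 (hA.mono fun i hi => abs_le.1 (hi j k)))
    exact ⟨y, hy⟩
  choose B hB using h
  exact ⟨B, tendsto_pi_nhds.2 fun j => tendsto_pi_nhds.2 fun k => hB j k⟩

/-- The matrices and their inverses converge separately; passing to the limit in the product
identities makes the two limits inverse to each other. A bound on the matrices alone would allow a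
singular limit. -/
theorem exists_tendsto_GL {n : ℕ} {ι : Type*} (l : Ultrafilter ι) {h : ι → GL (Fin (n + 1)) ℝ}
    {C : ℝ} (hC : ∀ᶠ i in (l : Filter ι), ∀ (j k : Fin (n + 1)),
      |(h i • (Pi.single k 1 : Fin (n + 1) → ℝ)) j| ≤ C)
    (hC' : ∀ᶠ i in (l : Filter ι), ∀ (j k : Fin (n + 1)),
      |((h i)⁻¹ • (Pi.single k 1 : Fin (n + 1) → ℝ)) j| ≤ C) :
    ∃ g : GL (Fin (n + 1)) ℝ, Tendsto h l (𝓝 g) := by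
  have hcol : ∀ (g : GL (Fin (n + 1)) ℝ) i j, (g • (Pi.single j 1 : Fin (n + 1) → ℝ)) i =
      (g : Matrix (Fin (n + 1)) (Fin (n + 1)) ℝ) i j := by
    intro g i j
    simp [GL_smul_apply, Pi.single_apply]
  simp only [hcol] at hC hC'
  obtain ⟨A, hA⟩ := exists_tendsto_matrix l hC
  obtain ⟨B, hB⟩ := exists_tendsto_matrix l hC'
  have hAB : A * B = 1 := tendsto_nhds_unique (hA.mul hB) (by simp)
  have hBA : B * A = 1 := tendsto_nhds_unique (hB.mul hA) (by simp)
  refine ⟨⟨A, B, hAB, hBA⟩, Units.isEmbedding_embedProduct.tendsto_nhds_iff.2 ?_⟩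
  exact hA.prodMk_nhds ((MulOpposite.continuous_op.tendsto B).comp hB)

namespace IsThickGroup

variable {n : ℕ} {ε : ℝ} {F : (Fin (n + 1) → ℝ) → ℝ} {G : Subgroup (GL (Fin (n + 1)) ℝ)}

theorem coneDist_smul_smul (h : IsThickGroup ε F G) {g : GL (Fin (n + 1)) ℝ} (hg : g ∈ G)
    {a b : Fin (n + 1) → ℝ} (ha : 0 < F a) (hb : 0 < F b) :
    coneDist F (g • a) (g • b) = coneDist F a b :=
  h.normalized.isConeFunction.coneDist_smul_smul (h.smul_pos g hg) (h.smul_pos _ (G.inv_mem hg))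
    ha hb

theorem nonneg_smul (h : IsThickGroup ε F G) {g : GL (Fin (n + 1)) ℝ} (hg : g ∈ G)
    (w : Fin (n + 1) → ℝ) (hw : 0 ≤ F w) : 0 ≤ F (g • w) :=
  h.normalized.isConeFunction.nonneg_smul h.normalized.one_pos (h.smul_pos g hg) hw

variable {ι : Type*} {l : Ultrafilter ι} {f : ι → (Fin (n + 1) → ℝ) → ℝ}
  {H : ι → Subgroup (GL (Fin (n + 1)) ℝ)}

theorem smul_pos_of_mem_limitGroup (hH : ∀ i, IsThickGroup ε (f i) (H i))
    (hfF : ∀ w, Tendsto (fun i => f i w) l (𝓝 (F w))) {g : GL (Fin (n + 1)) ℝ}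
    (hg : g ∈ limitGroup (l : Filter ι) H) {w : Fin (n + 1) → ℝ} (hw : 0 < F w) :
    0 < F (g • w) := by
  have hf := fun i => (hH i).normalized
  have hF : IsNormalizedConeFunction F := IsNormalizedConeFunction.of_tendsto hf hfF
  obtain ⟨h, hh, ht⟩ := hg
  have key : ∀ w, 0 < F w → 0 ≤ F (g • w) := fun w hw => by
    have h1 : Tendsto (fun i => f i (h i • w)) l (𝓝 (F (g • w))) :=
      IsNormalizedConeFunction.tendsto_apply hf hfF (tendsto_GL_smul ht tendsto_const_nhds)
    refine ge_of_tendsto h1 (((hfF w).eventually (lt_mem_nhds hw)).mono fun i hi => ?_)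
    exact ((hH i).smul_pos _ (hh i) w hi).le
  -- The limit only gives F (g w) ≥ 0. For strictness, apply this to w − s g⁻¹1, which is still in
  -- the open cone for small s > 0, and add back s · 1 after applying g.
  have hc : Continuous fun s : ℝ => w - s • g⁻¹ • (1 : Fin (n + 1) → ℝ) := by fun_prop
  have h1 : ∀ᶠ s : ℝ in 𝓝 0, 0 < F (w - s • g⁻¹ • (1 : Fin (n + 1) → ℝ)) :=
    ((hF.cont.comp hc).tendsto' 0 (F w) (by simp)).eventually (lt_mem_nhds hw)
  obtain ⟨s, h1, hs⟩ := ((h1.filter_mono nhdsWithin_le_nhds).and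
    (self_mem_nhdsWithin : Set.Ioi (0 : ℝ) ∈ 𝓝[>] 0)).exists
  have h2 := key _ h1
  rw [smul_sub, smul_comm g s, smul_inv_smul] at h2
  simpa using hF.isConeFunction.pos_add_smul h2 hF.one_pos hs

/-- Thickness is stated with strict inequalities, so if g satisfies them at w, so do almost all
elements converging to g; these are then central, and the center is closed. -/
theorem limit (hε : 0 < ε) (hH : ∀ i, IsThickGroup ε (f i) (H i))
    (hfF : ∀ w, Tendsto (fun i => f i w) l (𝓝 (F w))) :
    IsThickGroup ε F (limitGroup (l : Filter ι) H) := by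
  have hf := fun i => (hH i).normalized
  have hF : IsNormalizedConeFunction F := IsNormalizedConeFunction.of_tendsto hf hfF
  have hpos : ∀ g ∈ limitGroup (l : Filter ι) H, ∀ w, 0 < F w → 0 < F (g • w) :=
    fun g hg w hw => smul_pos_of_mem_limitGroup hH hfF hg hw
  have hcenter : ∀ (h : ι → GL (Fin (n + 1)) ℝ) (g : GL (Fin (n + 1)) ℝ), Tendsto h l (𝓝 g) →
      (∀ᶠ i in (l : Filter ι), h i ∈ Subgroup.center (GL (Fin (n + 1)) ℝ)) →
      g ∈ Subgroup.center _ := by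
    intro h g ht hc
    rw [Subgroup.mem_center_iff]
    intro k
    refine tendsto_nhds_unique_of_eventuallyEq (tendsto_const_nhds.mul ht)
      (ht.mul tendsto_const_nhds) (hc.mono fun i hi => ?_)
    exact Subgroup.mem_center_iff.1 hi k
  have hdist : ∀ (h : ι → GL (Fin (n + 1)) ℝ) (g : GL (Fin (n + 1)) ℝ), Tendsto h l (𝓝 g) →
      ∀ w, 0 < F (g • w) → coneDist F 1 (g • w) < ε →
      ∀ᶠ i in (l : Filter ι), coneDist (f i) 1 (h i • w) < ε := fun h g ht w hgw hd =>
    (IsNormalizedConeFunction.tendsto_coneDist hf hF hfF tendsto_const_nhds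
      (tendsto_GL_smul ht tendsto_const_nhds) hF.one_pos hgw).eventually (gt_mem_nhds hd)
  refine ⟨hF, hpos, fun t ht => ⟨fun _ => _, fun i => (hH i).scalar_mem t ht, tendsto_const_nhds⟩,
    ?_, ?_⟩
  · intro g hg w hw hd hd'
    have hgw := hpos g hg w hw
    obtain ⟨h, hh, ht⟩ := hg
    refine hcenter h g ht ?_
    filter_upwards [(hfF w).eventually (lt_mem_nhds hw), hdist h g ht w hgw hd',
      hdist (fun _ => 1) 1 tendsto_const_nhds w (by rwa [one_smul]) (by rwa [one_smul])]
      with i hi hi' hi''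
    rw [one_smul] at hi''
    exact (hH i).thick _ (hh i) w hi hi'' hi'
  -- A central power gᵐ acts as a positive scalar on the cone, hence does not displace the base
  -- point. The powers of the approximating elements then displace it by less than ε, so thickness
  -- makes them central, and torsion-freeness does the same for the elements themselves.
  · intro g hg m hm hgm
    have hp := hpos _ (Subgroup.pow_mem _ hg m) 1 hF.one_pos
    obtain ⟨h, hh, ht⟩ := hg
    have hd : coneDist F 1 (g ^ m • (1 : Fin (n + 1) → ℝ)) < ε := by
      obtain ⟨t, htm⟩ := exists_smul_of_mem_center hgm
      rw [htm] at hp ⊢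
      have h1 := hF.isConeFunction.coneDist_smul hF.one_pos hF.one_pos one_pos
        (hF.isConeFunction.pos_of_smul hF.one_pos hp)
      rw [one_smul, hF.isConeFunction.coneDist_self hF.one_pos] at h1
      rwa [h1]
    refine hcenter h g ht ?_
    filter_upwards [hdist (fun i => h i ^ m) _ (ht.pow m) 1 hp hd] with i hi
    refine (hH i).torsion _ (hh i) m hm
      ((hH i).thick _ ((H i).pow_mem (hh i) m) 1 (hf i).one_pos ?_ hi)
    rwa [(hf i).isConeFunction.coneDist_self (hf i).one_pos]

/-- Automorphisms that move points of a compact set a bounded amount have a limit, up to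
homotheties. -/
theorem exists_limit (hH : ∀ i, IsThickGroup ε (f i) (H i))
    (hfF : ∀ w, Tendsto (fun i => f i w) l (𝓝 (F w)))
    {u u' : ι → Fin (n + 1) → ℝ} {w w' : Fin (n + 1) → ℝ} (hu : Tendsto u l (𝓝 w))
    (hu' : Tendsto u' l (𝓝 w')) (hw : 0 < F w) (hw' : 0 < F w') {h : ι → GL (Fin (n + 1)) ℝ}
    (hh : ∀ i, h i ∈ H i) {D : ℝ}
    (hD : ∀ᶠ i in (l : Filter ι), coneDist (f i) (u i) (h i • u' i) ≤ D) :
    ∃ g ∈ limitGroup (l : Filter ι) H,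
      Tendsto (fun i => coneDist (f i) (u i) (h i • u' i)) l (𝓝 (coneDist F w (g • w'))) := by
  have hf := fun i => (hH i).normalized
  have hF : IsNormalizedConeFunction F := IsNormalizedConeFunction.of_tendsto hf hfF
  have hp : ∀ᶠ i in (l : Filter ι), F w / 2 < f i (u i) :=
    (IsNormalizedConeFunction.tendsto_apply hf hfF hu).eventually (lt_mem_nhds (by linarith))
  have hp' : ∀ᶠ i in (l : Filter ι), F w' / 2 < f i (u' i) :=
    (IsNormalizedConeFunction.tendsto_apply hf hfF hu').eventually (lt_mem_nhds (by linarith))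
  have hs : Tendsto (fun i => ∑ j, u i j) l (𝓝 (∑ j, w j)) :=
    tendsto_finsetSum _ fun j _ => tendsto_pi_nhds.1 hu j
  have hs' : Tendsto (fun i => ∑ j, u' i j) l (𝓝 (∑ j, w' j)) :=
    tendsto_finsetSum _ fun j _ => tendsto_pi_nhds.1 hu' j
  have hsb : ∀ᶠ i in (l : Filter ι), ∑ j, u i j < ∑ j, w j + 1 :=
    hs.eventually (gt_mem_nhds (by linarith))
  have hsb' : ∀ᶠ i in (l : Filter ι), ∑ j, u' i j < ∑ j, w' j + 1 :=
    hs'.eventually (gt_mem_nhds (by linarith))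
  -- rescale so that the coordinates of the images have the same sum
  have hresc : ∀ i, ∃ k ∈ H i, F w / 2 < f i (u i) → F w' / 2 < f i (u' i) →
      ∑ j, (k • u' i) j = ∑ j, u i j ∧
        coneDist (f i) (u i) (k • u' i) = coneDist (f i) (u i) (h i • u' i) := by
    intro i
    by_cases hi : F w / 2 < f i (u i) ∧ F w' / 2 < f i (u' i)
    · have hC := (hf i).isConeFunction
      have h1 : 0 < f i (u i) := by linarith
      have h2 : 0 < f i (h i • u' i) := (hH i).smul_pos _ (hh i) _ (by linarith)
      have h3 := (hf i).sum_pos (hC.ne_zero h1) h1.le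
      have h4 := (hf i).sum_pos (hC.ne_zero h2) h2.le
      have ht : 0 < (∑ j, u i j) / ∑ j, (h i • u' i) j := div_pos h3 h4
      refine ⟨GeneralLinearGroup.scalar _ (Units.mk0 _ ht.ne') * h i,
        (H i).mul_mem ((hH i).scalar_mem _ ht) (hh i), fun _ _ => ⟨?_, ?_⟩⟩
      · rw [mul_smul, scalar_smul, Units.val_mk0]
        simp only [Pi.smul_apply, smul_eq_mul]
        rw [← Finset.mul_sum, div_mul_cancel₀ _ h4.ne']
      · rw [mul_smul, scalar_smul, Units.val_mk0]
        have := hC.coneDist_smul h1 h2 one_pos ht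
        rwa [one_smul] at this
    · exact ⟨h i, hh i, fun h1 h2 => absurd ⟨h1, h2⟩ hi⟩
  choose k hk hks using hresc
  have hone : ∀ m : Fin (n + 1), ∑ j, |(Pi.single m 1 : Fin (n + 1) → ℝ) j| = 1 := fun m => by
    simp [Pi.single_apply, apply_ite abs]
  have hle : ∀ i (a : Fin (n + 1) → ℝ), 0 < f i a → ∀ j, a j ≤ ∑ j, a j := fun i a ha j =>
    Finset.single_le_sum (fun m _ => ha.le.trans ((hf i).le_apply a m)) (Finset.mem_univ j)
  -- These constants bound the entries of k i and of its inverse by `mul_abs_smul_apply_le`, used at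
  -- u' i and at k i • u' i. The value of f i at the latter point is bounded below by
  -- `mul_exp_neg_le`, which is where the bound D and the equality of coordinate sums enter.
  set C₁ := (∑ j, w j + 1) / (F w' / 2) with hC₁
  set C₂ := (∑ j, w' j + 1) / (F w / 2 * Real.exp (-D)) with hC₂
  obtain ⟨g, hg⟩ : ∃ g, Tendsto k l (𝓝 g) := by
    refine exists_tendsto_GL l (C := max C₁ C₂) ?_ ?_
    · filter_upwards [hp, hp', hsb] with i h1 h2 h3 j m
      obtain ⟨h4, -⟩ := hks i h1 h2
      have h5 : 0 < f i (u' i) := by linarith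
      have h6 := (hf i).mul_abs_smul_apply_le ((hH i).nonneg_smul (hk i)) h5 (Pi.single m 1) j
      rw [hone, one_mul] at h6
      have h7 := hle i _ ((hH i).smul_pos _ (hk i) _ h5) j
      refine le_max_of_le_left ?_
      rw [hC₁, le_div_iff₀ (by linarith)]
      nlinarith [abs_nonneg ((k i • (Pi.single m 1 : Fin (n + 1) → ℝ)) j)]
    · filter_upwards [hp, hp', hsb', hD] with i h1 h2 h3 h4 j m
      obtain ⟨h5, h6⟩ := hks i h1 h2
      have h7 : 0 < f i (u i) := by linarith
      have h8 : 0 < f i (u' i) := by linarith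
      have h9 := (hH i).smul_pos _ (hk i) _ h8
      have h10 := (hf i).mul_exp_neg_le h7 h9 h5.symm (h6.trans_le h4)
      have h11 := (hf i).mul_abs_smul_apply_le ((hH i).nonneg_smul ((H i).inv_mem (hk i))) h9
        (Pi.single m 1) j
      rw [hone, one_mul, inv_smul_smul] at h11
      have h12 := hle i _ h8 j
      have h13 : F w / 2 * Real.exp (-D) ≤ f i (k i • u' i) :=
        (mul_le_mul_of_nonneg_right h1.le (Real.exp_pos _).le).trans h10
      refine le_max_of_le_right ?_
      rw [hC₂, le_div_iff₀ (by positivity)]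
      nlinarith [abs_nonneg (((k i)⁻¹ • (Pi.single m 1 : Fin (n + 1) → ℝ)) j)]
  have hgm : g ∈ limitGroup (l : Filter ι) H := ⟨k, hk, hg⟩
  refine ⟨g, hgm, (IsNormalizedConeFunction.tendsto_coneDist hf hF hfF hu
    (tendsto_GL_smul hg hu') hw (smul_pos_of_mem_limitGroup hH hfF hgm hw')).congr' ?_⟩
  filter_upwards [hp, hp'] with i h1 h2
  exact (hks i h1 h2).2

end IsThickGroup

/-! ### The manifold of a thick group -/

/-- `X` is the quotient of the cone `0 < F` with its Hilbert metric by the group `G`, and `P` is the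
projection. -/
structure IsThickModel {n : ℕ} (ε : ℝ) (X : PointedMetricSpace) (F : (Fin (n + 1) → ℝ) → ℝ)
    (G : Subgroup (GL (Fin (n + 1)) ℝ)) (P : (Fin (n + 1) → ℝ) → X.carrier) : Prop
    extends IsThickGroup ε F G where
  surj : ∀ p, ∃ w, 0 < F w ∧ P w = p
  map_one : P 1 = X.pt
  eq_iff : ∀ w w', 0 < F w → 0 < F w' → (P w = P w' ↔ ∃ g ∈ G, g • w = w')
  dist_le : ∀ w w', 0 < F w → 0 < F w' → dist (P w) (P w') ≤ coneDist F w w'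
  exists_lt : ∀ w w', 0 < F w → 0 < F w' → ∀ η : ℝ, 0 < η →
    ∃ g ∈ G, coneDist F w (g • w') < dist (P w) (P w') + η

theorem mem_projSubspace_toRP {n : ℕ} {U : Submodule ℝ (Fin (n + 1) → ℝ)} {w : Fin (n + 1) → ℝ}
    (hw : w ≠ 0) : toRP w ∈ projSubspace U ↔ w ∈ U := by
  rw [toRP_of_ne hw, projSubspace, Set.mem_ofPred_eq, Projectivization.submodule_mk,
    Submodule.span_singleton_le_iff_mem]

/-- The trace of the open cone on a plane is convex, hence connected, and projects onto the trace of
the projective set. -/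
theorem IsConeFunction.isProjConvex {n : ℕ} {F : (Fin (n + 1) → ℝ) → ℝ} (hF : IsConeFunction F) :
    IsProjConvex (projCone F) := by
  intro U _
  have h : projSubspace U ∩ projCone F = toRP '' ((U : Set (Fin (n + 1) → ℝ)) ∩ {w | 0 < F w}) := by
    ext p
    constructor
    · rintro ⟨h, w, hw, rfl⟩
      exact ⟨w, ⟨(mem_projSubspace_toRP (hF.ne_zero hw)).1 h, hw⟩, rfl⟩
    · rintro ⟨w, ⟨h, hw⟩, rfl⟩
      exact ⟨(mem_projSubspace_toRP (hF.ne_zero hw)).2 h, w, hw, rfl⟩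
  rw [h]
  refine (U.convex.inter hF.convex_pos).isPreconnected.image _ fun w hw => ?_
  exact (continuousAt_toRP (hF.ne_zero hw.2)).continuousWithinAt

theorem IsNormalizedConeFunction.isProperlyConvex {n : ℕ} {F : (Fin (n + 1) → ℝ) → ℝ}
    (hF : IsNormalizedConeFunction F) : IsProperlyConvex (projCone F) := by
  refine ⟨hF.isConeFunction.isProjConvex, ∑ i, LinearMap.proj i, ?_, fun p hp => ?_⟩
  · intro h
    have h1 := LinearMap.congr_fun h (1 : Fin (n + 1) → ℝ)
    have h2 := hF.sum_pos (w := 1) one_ne_zero hF.one_pos.le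
    simp at h1 h2
    linarith
  · obtain ⟨w, hw, h, rfl⟩ := hF.isConeFunction.exists_of_mem_closure hp
    rw [toRP_mem_affinePatch hw]
    simpa using (hF.sum_pos hw h).ne'

namespace IsThickGroup

variable {n : ℕ} {ε : ℝ} {F : (Fin (n + 1) → ℝ) → ℝ} {G : Subgroup (GL (Fin (n + 1)) ℝ)}

theorem mk_smul_toRP_mem (T : IsThickGroup ε F G) {g : GL (Fin (n + 1)) ℝ} (hg : g ∈ G) {p : RP n}
    (hp : p ∈ projCone F) : (ProjGenLinGroup.mk g : PGroup n) • p ∈ projCone F := by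
  obtain ⟨w, hw, rfl⟩ := hp
  exact ⟨g • w, T.smul_pos g hg w hw,
    (mk_smul_toRP g (T.normalized.isConeFunction.ne_zero hw)).symm⟩

/-- If g sends the base point close enough to its image under g₀, then g₀⁻¹ g moves it by less than
ε, so it is scalar by thickness and g = g₀ in PGL. -/
theorem discreteTopology_map (T : IsThickGroup ε F G) (hε : 0 < ε) :
    DiscreteTopology (G.map (ProjGenLinGroup.mk : GL (Fin (n + 1)) ℝ →* PGroup n)) := by
  have hF := T.normalized
  have hC := hF.isConeFunction
  have hne : ∀ (g : GL (Fin (n + 1)) ℝ) {w : Fin (n + 1) → ℝ}, w ≠ 0 → g • w ≠ 0 := fun g w hw =>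
    (smul_ne_zero_iff_ne g).2 hw
  rw [discreteTopology_iff_isOpen_singleton]
  rintro ⟨_, g₀, hg₀, rfl⟩
  set B : Set (RP n) := toRP '' {w | 0 < F w ∧ coneDist F 1 w < ε} with hB
  have hBo : IsOpen B := isOpen_toRP_image (hF.isOpen_ball hF.one_pos ε) fun h => hC.ne_zero h.1 rfl
  set U : Set (PGroup n) :=
    {γ | (ProjGenLinGroup.mk g₀ : PGroup n)⁻¹ • γ • toRP (1 : Fin (n + 1) → ℝ) ∈ B} with hU
  have hUo : IsOpen U := by
    rw [isOpen_coinduced]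
    have hc : Continuous fun g : GL (Fin (n + 1)) ℝ => toRP (g₀⁻¹ • g • (1 : Fin (n + 1) → ℝ)) := by
      refine continuous_iff_continuousAt.2 fun g => ?_
      exact (continuousAt_toRP (hne _ (hne _ one_ne_zero))).tendsto.comp
        (tendsto_GL_smul tendsto_const_nhds (tendsto_GL_smul tendsto_id tendsto_const_nhds))
    convert hBo.preimage hc using 1
    ext g
    simp only [hU, Set.mem_preimage, Set.mem_ofPred_eq]
    rw [mk_smul_toRP g one_ne_zero, ← map_inv, mk_smul_toRP _ (hne _ one_ne_zero)]
  refine ⟨U, hUo, ?_⟩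
  ext ⟨γ, hγ⟩
  simp only [Set.mem_preimage, Set.mem_singleton_iff]
  constructor
  · intro h
    obtain ⟨g, hg, rfl⟩ := hγ
    obtain ⟨w, ⟨hw, hd⟩, e⟩ := h
    rw [mk_smul_toRP g one_ne_zero, ← map_inv, mk_smul_toRP _ (hne _ one_ne_zero), ← mul_smul] at e
    have hk : g₀⁻¹ * g ∈ G := G.mul_mem (G.inv_mem hg₀) hg
    have hp := T.smul_pos _ hk 1 hF.one_pos
    obtain ⟨t, ht, rfl⟩ := (hC.toRP_eq_iff_pos hw hp).1 e
    have h1 := hC.coneDist_smul hF.one_pos hp one_pos ht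
    rw [one_smul] at h1
    have h2 := T.thick _ hk 1 hF.one_pos (by rwa [hC.coneDist_self hF.one_pos]) (h1 ▸ hd)
    rw [← ProjGenLinGroup.mk_eq_one, map_mul, map_inv, inv_mul_eq_one] at h2
    exact Subtype.ext h2.symm
  · intro h
    obtain rfl := congrArg Subtype.val h
    refine ⟨1, ⟨hF.one_pos, by rwa [hC.coneDist_self hF.one_pos]⟩, ?_⟩
    rw [inv_smul_smul]

/-- The properly convex manifold of a thick group. -/
def manifold (T : IsThickGroup ε F G) (hε : 0 < ε) : ProperlyConvexManifold n where
  Ω := projCone F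
  isOpen := T.normalized.isConeFunction.isOpen_projCone
  properlyConvex := T.normalized.isProperlyConvex
  Γ := G.map ProjGenLinGroup.mk
  preserves := by
    rintro _ ⟨g, hg, rfl⟩
    refine Set.Subset.antisymm (Set.image_subset_iff.2 fun p hp => T.mk_smul_toRP_mem hg hp)
      fun p hp => ⟨_, T.mk_smul_toRP_mem (G.inv_mem hg) hp, ?_⟩
    change _ • _ • p = p
    rw [map_inv, smul_inv_smul]
  discrete := T.discreteTopology_map hε
  torsionFree := by
    rintro _ ⟨g, hg, rfl⟩ h
    obtain ⟨m, hm, h⟩ := isOfFinOrder_iff_pow_eq_one.1 h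
    rw [← map_pow] at h
    rw [ProjGenLinGroup.mk_eq_one] at h ⊢
    exact T.torsion g hg m hm.ne' h

theorem uniformizes (T : IsThickGroup ε F G) (hε : 0 < ε) : Uniformizes (T.manifold hε) F G :=
  ⟨T.normalized.isConeFunction, rfl, rfl, T.smul_pos, T.scalar_mem⟩

theorem le_inj (T : IsThickGroup ε F G) (hε : 0 < ε) (x : (T.manifold hε).Space) :
    ENNReal.ofReal ε ≤ (T.manifold hε).inj ((T.manifold hε).conePt x 1) := by
  have hF := T.normalized
  have hU := T.uniformizes hε
  refine le_iSup₂_of_le ε.toNNReal ?_ le_rfl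
  intro a ha b hb c hc hbc
  rw [hU.conePt_eq x hF.one_pos] at ha
  obtain ⟨w, hw, hwa⟩ := hU.exists_pos a
  obtain ⟨u, hu, hub⟩ := hU.exists_pos b
  obtain ⟨v, hv, hvc⟩ := hU.exists_pos c
  obtain rfl : (⟨toRP w, hU.toRP_mem hw⟩ : (T.manifold hε).Ω) = a := Subtype.ext hwa
  obtain rfl : (⟨toRP u, hU.toRP_mem hu⟩ : (T.manifold hε).Ω) = b := Subtype.ext hub
  obtain rfl : (⟨toRP v, hU.toRP_mem hv⟩ : (T.manifold hε).Ω) = c := Subtype.ext hvc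
  rw [Set.mem_ofPred_eq, hU.hilbertDist_eq hw hu, Real.coe_toNNReal _ hε.le] at hb
  rw [Set.mem_ofPred_eq, hU.hilbertDist_eq hw hv, Real.coe_toNNReal _ hε.le] at hc
  obtain ⟨g, hg, rfl⟩ := (hU.proj_eq_iff hF.one_pos hw).1 ha.symm
  obtain ⟨h, hh, rfl⟩ := (hU.proj_eq_iff hu hv).1 hbc
  have hgu := T.smul_pos _ (G.inv_mem hg) u hu
  have hghu := T.smul_pos _ (G.inv_mem hg) _ hv
  rw [← T.coneDist_smul_smul (G.inv_mem hg) hw hu, inv_smul_smul] at hb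
  rw [← T.coneDist_smul_smul (G.inv_mem hg) hw hv, inv_smul_smul] at hc
  -- The ball is centred at an arbitrary lift g • 1; conjugation by g brings it back to the ball
  -- about 1, where thickness applies.
  have key := T.thick (g⁻¹ * h * g) (G.mul_mem (G.mul_mem (G.inv_mem hg) hh) hg) (g⁻¹ • u) hgu hb
    (by rwa [mul_smul, smul_inv_smul, mul_smul])
  have hcen : h ∈ Subgroup.center (GL (Fin (n + 1)) ℝ) := by
    have := (Subgroup.center (GL (Fin (n + 1)) ℝ)).normal_of_characteristic.conj_mem _ key g
    simpa [mul_assoc] using this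
  obtain ⟨t, ht⟩ := exists_smul_of_mem_center hcen
  refine Subtype.ext ?_
  change toRP u = toRP (h • u)
  rw [ht, toRP_smul t.ne_zero]

/-- A thick group whose orbits realize the distance zero is the group of a pointed manifold. -/
theorem exists_isThickModel (T : IsThickGroup ε F G) (hε : 0 < ε)
    (hatt : ∀ w w', 0 < F w → 0 < F w' → (∀ η : ℝ, 0 < η → ∃ g ∈ G, coneDist F w (g • w') < η) →
      ∃ g ∈ G, coneDist F w (g • w') = 0) :
    ∃ (X : PointedMetricSpace) (P : (Fin (n + 1) → ℝ) → X.carrier),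
      X.isomClass ∈ thickPointed n ε ∧ IsThickModel ε X F G P := by
  have hF := T.normalized
  have hC := hF.isConeFunction
  have hU := T.uniformizes hε
  set M := T.manifold hε
  set x : M.Space := M.proj ⟨toRP 1, hU.toRP_mem hF.one_pos⟩
  set P := M.conePt x
  have hle : ∀ w w', 0 < F w → 0 < F w' → M.mDist (P w) (P w') ≤ coneDist F w w' :=
    fun w w' hw hw' => hU.mDist_le x hw hw'
  have hlt : ∀ w w', 0 < F w → 0 < F w' → ∀ η : ℝ, 0 < η →
      ∃ g ∈ G, coneDist F w (g • w') < M.mDist (P w) (P w') + η :=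
    fun w w' hw hw' η hη => hU.exists_coneDist_lt x hw hw' hη
  have heq : ∀ w w', 0 < F w → 0 < F w' → (P w = P w' ↔ ∃ g ∈ G, g • w = w') :=
    fun w w' hw hw' => hU.conePt_eq_iff x hw hw'
  have hsmul : ∀ g ∈ G, ∀ w, 0 < F w → P (g • w) = P w := fun g hg w hw =>
    ((heq _ _ hw (T.smul_pos g hg w hw)).2 ⟨g, hg, rfl⟩).symm
  have hnn : ∀ w w', 0 < F w → 0 < F w' → 0 ≤ M.mDist (P w) (P w') := fun w w' hw hw' => by
    refine le_of_forall_pos_le_add fun η hη => ?_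
    obtain ⟨g, hg, h⟩ := hlt w w' hw hw' η hη
    exact (hC.coneDist_nonneg hw (T.smul_pos g hg w' hw')).trans h.le
  have hsymm : ∀ w w', 0 < F w → 0 < F w' → M.mDist (P w) (P w') ≤ M.mDist (P w') (P w) :=
    fun w w' hw hw' => by
    refine le_of_forall_pos_le_add fun η hη => ?_
    obtain ⟨g, hg, h⟩ := hlt w' w hw' hw η hη
    rw [IsConeFunction.coneDist_comm] at h
    have := hle _ _ (T.smul_pos g hg w hw) hw'
    rw [hsmul g hg w hw] at this
    exact this.trans h.le
  let _ : MetricSpace M.Space :=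
    { dist := M.mDist
      dist_self := fun p => by
        obtain ⟨w, hw, rfl⟩ := hU.exists_conePt_eq x p
        exact le_antisymm ((hle w w hw hw).trans_eq (hC.coneDist_self hw)) (hnn w w hw hw)
      dist_comm := fun p q => by
        obtain ⟨w, hw, rfl⟩ := hU.exists_conePt_eq x p
        obtain ⟨w', hw', rfl⟩ := hU.exists_conePt_eq x q
        exact le_antisymm (hsymm w w' hw hw') (hsymm w' w hw' hw)
      dist_triangle := fun p q r => by
        obtain ⟨w, hw, rfl⟩ := hU.exists_conePt_eq x p
        obtain ⟨w', hw', rfl⟩ := hU.exists_conePt_eq x q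
        obtain ⟨w'', hw'', rfl⟩ := hU.exists_conePt_eq x r
        refine le_of_forall_pos_le_add fun η hη => ?_
        obtain ⟨g, hg, h⟩ := hlt w w' hw hw' (η / 2) (half_pos hη)
        obtain ⟨g', hg', h'⟩ := hlt w' w'' hw' hw'' (η / 2) (half_pos hη)
        have h1 := T.smul_pos g hg w' hw'
        have h2 := T.smul_pos g' hg' w'' hw''
        have h3 := T.smul_pos g hg _ h2
        have h4 := hC.coneDist_triangle hw h1 h3
        rw [T.coneDist_smul_smul hg hw' h2] at h4
        have h5 := hle w _ hw h3
        rw [hsmul g hg _ h2, hsmul g' hg' _ hw''] at h5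
        change M.mDist (P w) (P w'') ≤ M.mDist (P w) (P w') + M.mDist (P w') (P w'') + η
        linarith
      eq_of_dist_eq_zero := fun {p q} hpq => by
        obtain ⟨w, hw, rfl⟩ := hU.exists_conePt_eq x p
        obtain ⟨w', hw', rfl⟩ := hU.exists_conePt_eq x q
        have hpq : M.mDist (P w) (P w') = 0 := hpq
        -- Attainment is what separates points: without it the quotient would only be known to be a
        -- pseudometric space.
        obtain ⟨g, hg, h⟩ := hatt w w' hw hw' fun η hη => by
          simpa [hpq] using hlt w w' hw hw' η hη
        have hp := T.smul_pos g hg w' hw'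
        obtain ⟨t, ht, h⟩ := hC.exists_smul_of_coneDist_eq_zero hw hp h
        refine ((heq w' w hw' hw).2 ⟨GeneralLinearGroup.scalar _ (Units.mk0 t ht.ne') * g,
          G.mul_mem (T.scalar_mem _ ht) hg, ?_⟩).symm
        rw [mul_smul, scalar_smul]
        exact h }
  refine ⟨⟨M.Space, P 1⟩, P, ⟨_, M, P 1, rfl, T.le_inj hε x, Equiv.refl _, rfl, fun _ _ => rfl⟩, ?_⟩
  exact
    { toIsThickGroup := T
      surj := hU.exists_conePt_eq x
      map_one := rfl
      eq_iff := heq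
      dist_le := hle
      exists_lt := hlt }

end IsThickGroup

/-! ### Ultralimits of thick models -/

namespace IsThickModel

variable {n : ℕ} {ε : ℝ}

section Single

variable {X : PointedMetricSpace} {F : (Fin (n + 1) → ℝ) → ℝ}
  {G : Subgroup (GL (Fin (n + 1)) ℝ)} {P : (Fin (n + 1) → ℝ) → X.carrier}

theorem apply_smul (T : IsThickModel ε X F G P) {g : GL (Fin (n + 1)) ℝ} (hg : g ∈ G)
    {w : Fin (n + 1) → ℝ} (hw : 0 < F w) : P (g • w) = P w :=
  ((T.eq_iff _ _ hw (T.smul_pos g hg w hw)).2 ⟨g, hg, rfl⟩).symm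

theorem dist_le_smul (T : IsThickModel ε X F G P) {g : GL (Fin (n + 1)) ℝ} (hg : g ∈ G)
    {w w' : Fin (n + 1) → ℝ} (hw : 0 < F w) (hw' : 0 < F w') :
    dist (P w) (P w') ≤ coneDist F w (g • w') := by
  have := T.dist_le w _ hw (T.smul_pos g hg w' hw')
  rwa [T.apply_smul hg hw'] at this

/-- The infimum need not be known to be attained. If the distance is positive, the factor 2 leaves
room; if it is zero, the points coincide because X is a metric space, and some g takes w' exactly to
w. -/
theorem exists_coneDist_le_two_mul (T : IsThickModel ε X F G P) {w w' : Fin (n + 1) → ℝ}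
    (hw : 0 < F w) (hw' : 0 < F w') : ∃ g ∈ G, coneDist F w (g • w') ≤ 2 * dist (P w) (P w') := by
  rcases (dist_nonneg (x := P w) (y := P w')).eq_or_lt with h | h
  · obtain ⟨g, hg, e⟩ := (T.eq_iff w' w hw' hw).1 (dist_eq_zero.1 h.symm).symm
    refine ⟨g, hg, ?_⟩
    rw [e, ← h, mul_zero, T.normalized.isConeFunction.coneDist_self hw]
  · obtain ⟨g, hg, h⟩ := T.exists_lt w w' hw hw' _ h
    exact ⟨g, hg, by linarith⟩

/-- The points of a ball about the base point have lifts in a fixed compact subset of the cone. -/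
theorem exists_sum_eq (T : IsThickModel ε X F G P) {p : X.carrier} {r : ℝ}
    (hp : dist p X.pt < r) : ∃ w, ∑ j, w j = ∑ _j : Fin (n + 1), (1 : ℝ) ∧
      Real.exp (-r) ≤ F w ∧ P w = p := by
  have hF := T.normalized
  have hC := hF.isConeFunction
  obtain ⟨w, hw, rfl⟩ := T.surj p
  rw [← T.map_one, dist_comm] at hp
  obtain ⟨g, hg, h⟩ := T.exists_lt 1 w hF.one_pos hw _ (sub_pos.2 hp)
  rw [add_sub_cancel] at h
  have hgw := T.smul_pos g hg w hw
  have h1 := hF.sum_pos (hC.ne_zero hgw) hgw.le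
  have h2 := hF.sum_pos (hC.ne_zero hF.one_pos) hF.one_pos.le
  have ht : 0 < (∑ j : Fin (n + 1), (1 : Fin (n + 1) → ℝ) j) / ∑ j, (g • w) j := div_pos h2 h1
  set t := (∑ j : Fin (n + 1), (1 : Fin (n + 1) → ℝ) j) / ∑ j, (g • w) j
  have hsum : ∑ j, (t • g • w) j = ∑ j : Fin (n + 1), (1 : Fin (n + 1) → ℝ) j := by
    simp only [Pi.smul_apply, smul_eq_mul]
    rw [← Finset.mul_sum, div_mul_cancel₀ _ h1.ne']
  have htw := hC.smul_pos hgw ht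
  refine ⟨t • g • w, hsum, ?_, ?_⟩
  · have h3 := hC.coneDist_smul hF.one_pos hgw one_pos ht
    rw [one_smul] at h3
    have h4 := hF.mul_exp_neg_le hF.one_pos htw hsum.symm (h3.trans_le h.le)
    rwa [hF.apply_one, one_mul] at h4
  · have h3 := T.apply_smul (T.scalar_mem (Units.mk0 t ht.ne') ht) hgw
    rw [scalar_smul] at h3
    exact h3.trans (T.apply_smul hg hw)

end Single

section Limit

variable {ι : Type*} {l : Ultrafilter ι} {X : ι → PointedMetricSpace}
  {f : ι → (Fin (n + 1) → ℝ) → ℝ} {H : ι → Subgroup (GL (Fin (n + 1)) ℝ)}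
  {P : ∀ i, (Fin (n + 1) → ℝ) → (X i).carrier} {F : (Fin (n + 1) → ℝ) → ℝ}
  {w w' : Fin (n + 1) → ℝ} {u u' : ι → Fin (n + 1) → ℝ}

/-- Elements of the limit group bound the distances in the approximating spaces. -/
theorem eventually_dist_lt (T : ∀ i, IsThickModel ε (X i) (f i) (H i) (P i))
    (hfF : ∀ w, Tendsto (fun i => f i w) l (𝓝 (F w))) (hu : Tendsto u l (𝓝 w))
    (hu' : Tendsto u' l (𝓝 w')) (hw : 0 < F w) (hw' : 0 < F w') {g : GL (Fin (n + 1)) ℝ}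
    (hg : g ∈ limitGroup (l : Filter ι) H) {b : ℝ} (hb : coneDist F w (g • w') < b) :
    ∀ᶠ i in (l : Filter ι), dist (P i (u i)) (P i (u' i)) < b := by
  have hf := fun i => (T i).normalized
  have hF : IsNormalizedConeFunction F := IsNormalizedConeFunction.of_tendsto hf hfF
  have hgw := IsThickGroup.smul_pos_of_mem_limitGroup (fun i => (T i).toIsThickGroup) hfF hg hw'
  obtain ⟨h, hh, ht⟩ := hg
  filter_upwards [(IsNormalizedConeFunction.tendsto_coneDist hf hF hfF hu (tendsto_GL_smul ht hu')
      hw hgw).eventually (gt_mem_nhds hb),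
    (IsNormalizedConeFunction.tendsto_apply hf hfF hu).eventually (lt_mem_nhds hw),
    (IsNormalizedConeFunction.tendsto_apply hf hfF hu').eventually (lt_mem_nhds hw')]
    with i h1 h2 h3
  exact ((T i).dist_le_smul (hh i) h2 h3).trans_lt h1

/-- This is the attainment hypothesis of `exists_isThickModel`. The distances of the images of w and
w' in the approximating spaces tend to 0; elements displacing by at most twice these distances
converge, after rescaling, to an element that realizes 0. -/
theorem exists_coneDist_eq_zero (T : ∀ i, IsThickModel ε (X i) (f i) (H i) (P i))
    (hfF : ∀ w, Tendsto (fun i => f i w) l (𝓝 (F w))) (hw : 0 < F w) (hw' : 0 < F w')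
    (h : ∀ η : ℝ, 0 < η → ∃ g ∈ limitGroup (l : Filter ι) H, coneDist F w (g • w') < η) :
    ∃ g ∈ limitGroup (l : Filter ι) H, coneDist F w (g • w') = 0 := by
  have hf := fun i => (T i).normalized
  have hF : IsNormalizedConeFunction F := IsNormalizedConeFunction.of_tendsto hf hfF
  have hd : ∀ η : ℝ, 0 < η → ∀ᶠ i in (l : Filter ι), dist (P i w) (P i w') < η := fun η hη => by
    obtain ⟨g, hg, hlt⟩ := h η hη
    exact eventually_dist_lt T hfF tendsto_const_nhds tendsto_const_nhds hw hw' hg hlt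
  have hex : ∀ i, ∃ k ∈ H i, 0 < f i w → 0 < f i w' →
      coneDist (f i) w (k • w') ≤ 2 * dist (P i w) (P i w') := fun i => by
    by_cases hi : 0 < f i w ∧ 0 < f i w'
    · obtain ⟨k, hk, hle⟩ := (T i).exists_coneDist_le_two_mul hi.1 hi.2
      exact ⟨k, hk, fun _ _ => hle⟩
    · exact ⟨1, (H i).one_mem, fun h1 h2 => absurd ⟨h1, h2⟩ hi⟩
  choose k hk hkd using hex
  have hk2 : ∀ η : ℝ, 0 < η → ∀ᶠ i in (l : Filter ι), coneDist (f i) w (k i • w') ≤ η :=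
      fun η hη => by
    filter_upwards [hd (η / 2) (half_pos hη), (hfF w).eventually (lt_mem_nhds hw),
      (hfF w').eventually (lt_mem_nhds hw')] with i h1 h2 h3
    linarith [hkd i h2 h3]
  obtain ⟨g, hg, ht⟩ := IsThickGroup.exists_limit (fun i => (T i).toIsThickGroup) hfF
    tendsto_const_nhds tendsto_const_nhds hw hw' hk (hk2 1 one_pos)
  refine ⟨g, hg, le_antisymm (le_of_forall_pos_le_add fun η hη => ?_) ?_⟩
  · rw [zero_add]
    exact le_of_tendsto ht (hk2 η hη)
  · exact hF.isConeFunction.coneDist_nonneg hw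
      (IsThickGroup.smul_pos_of_mem_limitGroup (fun i => (T i).toIsThickGroup) hfF hg hw')

variable {Y : PointedMetricSpace} {Q : (Fin (n + 1) → ℝ) → Y.carrier}

/-- The upper bound approximates a nearly optimal element of the limit group. For the lower bound,
nearly optimal elements of the approximating groups have a limit by `exists_limit`, so smaller
distances would persist in the limit. -/
theorem tendsto_dist (T : ∀ i, IsThickModel ε (X i) (f i) (H i) (P i))
    (hfF : ∀ w, Tendsto (fun i => f i w) l (𝓝 (F w)))
    (S : IsThickModel ε Y F (limitGroup (l : Filter ι) H) Q) (hu : Tendsto u l (𝓝 w))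
    (hu' : Tendsto u' l (𝓝 w')) (hw : 0 < F w) (hw' : 0 < F w') :
    Tendsto (fun i => dist (P i (u i)) (P i (u' i))) l (𝓝 (dist (Q w) (Q w'))) := by
  have hf := fun i => (T i).normalized
  refine tendsto_order.2 ⟨fun a ha => ?_, fun b hb => ?_⟩
  · by_contra hcon
    have hle : ∀ᶠ i in (l : Filter ι), dist (P i (u i)) (P i (u' i)) ≤ a :=
      (Ultrafilter.eventually_not.2 hcon).mono fun i hi => not_lt.1 hi
    have hex : ∀ i, ∃ k ∈ H i, 0 < f i (u i) → 0 < f i (u' i) → coneDist (f i) (u i) (k • u' i) <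
        dist (P i (u i)) (P i (u' i)) + (dist (Q w) (Q w') - a) / 2 := fun i => by
      by_cases hi : 0 < f i (u i) ∧ 0 < f i (u' i)
      · obtain ⟨k, hk, hlt⟩ := (T i).exists_lt _ _ hi.1 hi.2 ((dist (Q w) (Q w') - a) / 2)
          (by linarith)
        exact ⟨k, hk, fun _ _ => hlt⟩
      · exact ⟨1, (H i).one_mem, fun h1 h2 => absurd ⟨h1, h2⟩ hi⟩
    choose k hk hkd using hex
    have hb : ∀ᶠ i in (l : Filter ι),
        coneDist (f i) (u i) (k i • u' i) ≤ a + (dist (Q w) (Q w') - a) / 2 := by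
      filter_upwards [hle,
        (IsNormalizedConeFunction.tendsto_apply hf hfF hu).eventually (lt_mem_nhds hw),
        (IsNormalizedConeFunction.tendsto_apply hf hfF hu').eventually (lt_mem_nhds hw')]
        with i h1 h2 h3
      linarith [hkd i h2 h3]
    obtain ⟨g, hg, ht⟩ := IsThickGroup.exists_limit (fun i => (T i).toIsThickGroup) hfF hu hu' hw
      hw' hk hb
    have h1 := le_of_tendsto ht hb
    have h2 := S.dist_le_smul hg hw hw'
    linarith
  · obtain ⟨g, hg, hlt⟩ := S.exists_lt w w' hw hw' _ (sub_pos.2 hb)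
    rw [add_sub_cancel] at hlt
    exact eventually_dist_lt T hfF hu hu' hw hw' hg hlt

theorem tendsto_proj {X : PointedMetricSpace} {G : Subgroup (GL (Fin (n + 1)) ℝ)}
    {P : (Fin (n + 1) → ℝ) → X.carrier} (T : IsThickModel ε X F G P) (hu : Tendsto u l (𝓝 w))
    (hw : 0 < F w) : Tendsto (fun i => P (u i)) l (𝓝 (P w)) := by
  have hF := T.normalized
  rw [tendsto_iff_dist_tendsto_zero]
  have h0 : Tendsto (fun i => coneDist F w (u i)) l (𝓝 0) := by
    rw [← hF.isConeFunction.coneDist_self hw]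
    exact (hF.continuousAt_coneDist hw hw).tendsto.comp hu
  refine squeeze_zero' (Eventually.of_forall fun _ => dist_nonneg) ?_ h0
  filter_upwards [((hF.cont.tendsto w).comp hu).eventually (lt_mem_nhds hw)] with i hi
  rw [dist_comm]
  exact T.dist_le _ _ hw hi

/-- The limit model is the pointed Gromov-Hausdorff limit. -/
theorem eventually_ghClose (T : ∀ i, IsThickModel ε (X i) (f i) (H i) (P i))
    (hfF : ∀ w, Tendsto (fun i => f i w) l (𝓝 (F w)))
    (S : IsThickModel ε Y F (limitGroup (l : Filter ι) H) Q) {δ : ℝ} (hδ : 0 < δ) :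
    ∀ᶠ i in (l : Filter ι), GHClose δ Y (X i) := by
  have hf := fun i => (T i).normalized
  have hF := S.normalized
  set N : ℝ := ∑ _j : Fin (n + 1), (1 : ℝ) with hN
  -- Points within 1 / δ of the base point of X i have lifts in K with f i ≥ exp(−1/δ). Half of this
  -- is spent on the uniform error |f i − F| < η on K, so that F ≥ η and the lifts lie in C.
  set η : ℝ := Real.exp (-(1 / δ)) / 2 with hη
  have hη0 : 0 < η := by positivity
  set K : Set (Fin (n + 1) → ℝ) := {w | ∑ j, w j = N} ∩ Set.Icc 0 (fun _ => N) with hK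
  have hKc : IsCompact K :=
    isCompact_Icc.inter_left (isClosed_eq (by fun_prop) continuous_const)
  have hmem : ∀ w : Fin (n + 1) → ℝ, ∑ j, w j = N → (∀ j, 0 ≤ w j) → w ∈ K := fun w h h0 =>
    ⟨h, h0, fun j => h ▸ Finset.single_le_sum (fun m _ => h0 m) (Finset.mem_univ j)⟩
  set C : Set (Fin (n + 1) → ℝ) := K ∩ {w | η ≤ F w} with hC
  have hCc : IsCompact C := hKc.inter_right (isClosed_le continuous_const hF.cont)
  have hCpos : ∀ w ∈ C, 0 < F w := fun w hw => hη0.trans_le hw.2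
  -- Uniform convergence on the compact set of pairs: bad pairs would converge along the
  -- ultrafilter, contradicting `tendsto_dist` and the continuity of Q at their limit.
  have hdist : ∀ᶠ i in (l : Filter ι), ∀ v ∈ C ×ˢ C,
      |dist (Q v.1) (Q v.2) - dist (P i v.1) (P i v.2)| < δ := by
    by_contra hcon
    have h := Ultrafilter.eventually_not.2 hcon
    have h1 : ∀ i, ∃ v : (Fin (n + 1) → ℝ) × (Fin (n + 1) → ℝ),
        (¬ ∀ v ∈ C ×ˢ C, |dist (Q v.1) (Q v.2) - dist (P i v.1) (P i v.2)| < δ) →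
        v ∈ C ×ˢ C ∧ δ ≤ |dist (Q v.1) (Q v.2) - dist (P i v.1) (P i v.2)| := fun i => by
      by_cases hi : ∀ v ∈ C ×ˢ C, |dist (Q v.1) (Q v.2) - dist (P i v.1) (P i v.2)| < δ
      · exact ⟨0, fun h => absurd hi h⟩
      · push Not at hi
        exact hi.imp fun v hv _ => hv
    choose v hv using h1
    obtain ⟨⟨w, w'⟩, ⟨hw, hw'⟩, hvw⟩ := (hCc.prod hCc).ultrafilter_le_nhds (l.map v) (by
      rw [le_principal_iff]
      exact mem_map.2 (h.mono fun i hi => (hv i hi).1))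
    have hvw : Tendsto v l (𝓝 (w, w')) := hvw
    have h1 : Tendsto (fun i => (v i).1) l (𝓝 w) := (continuous_fst.tendsto (w, w')).comp hvw
    have h2 : Tendsto (fun i => (v i).2) l (𝓝 w') := (continuous_snd.tendsto (w, w')).comp hvw
    have h3 := (((S.tendsto_proj h1 (hCpos w hw)).dist (S.tendsto_proj h2 (hCpos w' hw'))).sub
      (tendsto_dist T hfF S h1 h2 (hCpos w hw) (hCpos w' hw'))).abs
    rw [sub_self, abs_zero] at h3
    obtain ⟨i, hi, hi'⟩ := (h.and (h3.eventually (gt_mem_nhds hδ))).exists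
    exact absurd (hv i hi).2 hi'.not_ge
  filter_upwards [hdist, IsNormalizedConeFunction.eventually_abs_sub_lt l hf hF hfF hKc hη0]
    with i hd hi
  -- Two points are related when they have a common lift in C.
  refine ⟨fun p q => ∃ w ∈ C, Q w = p ∧ P i w = q, ?_, ?_, ?_, ?_⟩
  · refine ⟨1, ⟨hmem 1 rfl fun _ => zero_le_one, ?_⟩, S.map_one, (T i).map_one⟩
    have : Real.exp (-(1 / δ)) ≤ 1 := Real.exp_le_one_iff.2 (by
      rw [neg_nonpos]
      positivity)
    change η ≤ F 1
    rw [hF.apply_one]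
    linarith
  · intro p hp
    obtain ⟨w, hs, hFw, rfl⟩ := S.exists_sum_eq hp
    have hpos : η ≤ F w := by linarith
    exact ⟨_, w, ⟨hmem w hs fun j => (hη0.le.trans hpos).trans (hF.le_apply w j), hpos⟩, rfl, rfl⟩
  · intro q hq
    obtain ⟨w, hs, hFw, rfl⟩ := (T i).exists_sum_eq hq
    have hK : w ∈ K := hmem w hs fun j =>
      (Real.exp_pos _).le.trans (hFw.trans ((hf i).le_apply w j))
    have := (abs_lt.1 (hi w hK)).2
    exact ⟨_, w, ⟨hK, (by linarith : η ≤ F w)⟩, rfl, rfl⟩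
  · rintro _ _ _ _ ⟨w, hw, rfl, rfl⟩ ⟨w', hw', rfl, rfl⟩
    exact hd (w, w') ⟨hw, hw'⟩

end Limit

end IsThickModel

/-! ### Compactness, given thick models -/

theorem isCompact_thickPointed_of_exists_model {n : ℕ} {ε : ℝ} (hε : 0 < ε)
    (hA : ∀ c ∈ thickPointed n ε, ∃ X F G P, X.isomClass = c ∧ IsThickModel (n := n) ε X F G P) :
    IsCompact (thickPointed n ε) := by
  rw [isCompact_iff_ultrafilter_le_nhds]
  intro 𝒰 h𝒰
  have hlarge : Set.range (Subtype.val : thickPointed n ε → PointedIsometryClass) ∈ 𝒰 := by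
    rw [Subtype.range_coe]
    exact le_principal_iff.1 h𝒰
  choose X f H P hX T using fun c : thickPointed n ε => hA c c.2
  -- The ultrafilter is pulled back to the subtype, which serves as the index set; a model can then
  -- be chosen for every index.
  set l : Ultrafilter (thickPointed n ε) := 𝒰.comap Subtype.val_injective hlarge with hl
  obtain ⟨F, hfF⟩ := IsNormalizedConeFunction.exists_tendsto l fun i => (T i).normalized
  have hlim := IsThickGroup.limit hε (fun i => (T i).toIsThickGroup) hfF
  obtain ⟨Y, Q, hY, S⟩ := hlim.exists_isThickModel hε fun w w' hw hw' h =>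
    IsThickModel.exists_coneDist_eq_zero T hfF hw hw' h
  refine ⟨_, hY, ?_⟩
  rw [(nhds_hasBasis_ghClose Y).ge_iff]
  intro δ hδ
  have h1 := IsThickModel.eventually_ghClose T hfF S hδ
  rw [hl, Ultrafilter.coe_comap] at h1
  rw [← Filter.map_comap_of_mem hlarge, mem_map]
  filter_upwards [h1] with c hc
  exact ⟨X c, (hX c).symm, hc⟩

/-! ### The cone over a properly convex set -/

theorem continuousAt_of_comp_toRP {n : ℕ} {f : RP n → ℝ} {w : Fin (n + 1) → ℝ} (hw : w ≠ 0)
    (h : ContinuousAt (fun u => f (toRP u)) w) : ContinuousAt f (toRP w) := by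
  intro N hN
  rw [mem_map]
  have h1 : {u | f (toRP u) ∈ N} ∩ {u | u ≠ 0} ∈ 𝓝 w := inter_mem (h hN) (isOpen_ne.mem_nhds hw)
  obtain ⟨V, hV, hVo, hwV⟩ := mem_nhds_iff.1 h1
  refine mem_of_superset ((isOpen_toRP_image hVo fun h0 => (hV h0).2 rfl).mem_nhds ⟨w, hwV, rfl⟩) ?_
  rintro _ ⟨u, hu, rfl⟩
  exact (hV hu).1

/-- One of the two cones over a subset of the affine patch of `φ`. -/
def coneOver {n : ℕ} (Ω : Set (RP n)) (φ : Module.Dual ℝ (Fin (n + 1) → ℝ)) :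
    Set (Fin (n + 1) → ℝ) :=
  {w | 0 < φ w ∧ toRP w ∈ Ω}

section ConeOver

variable {n : ℕ} {Ω : Set (RP n)} {φ : Module.Dual ℝ (Fin (n + 1) → ℝ)} {u w : Fin (n + 1) → ℝ}

theorem ne_zero_of_mem_coneOver (hw : w ∈ coneOver Ω φ) : w ≠ 0 := by
  rintro rfl
  have := hw.1
  simp at this

theorem isOpen_coneOver (hΩ : IsOpen Ω) : IsOpen (coneOver Ω φ) := by
  have h : coneOver Ω φ = {w | 0 < φ w} ∩ {w | w ≠ 0 ∧ toRP w ∈ Ω} := by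
    ext w
    exact ⟨fun h => ⟨h.1, ne_zero_of_mem_coneOver h, h.2⟩, fun h => ⟨h.1, h.2.2⟩⟩
  rw [h]
  exact (isOpen_lt continuous_const φ.continuous_of_finiteDimensional).inter (isOpen_RP_iff.1 hΩ)

theorem toRP_image_coneOver (hφ : Ω ⊆ affinePatch φ) : toRP '' coneOver Ω φ = Ω := by
  refine Set.Subset.antisymm (Set.image_subset_iff.2 fun w hw => hw.2) fun p hp => ?_
  obtain ⟨w, hw, rfl⟩ := exists_toRP_eq p
  rcases ((toRP_mem_affinePatch hw).1 (hφ hp)).lt_or_gt with h | h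
  · have e : toRP (-w) = toRP w := by rw [← neg_one_smul ℝ w, toRP_smul (by norm_num)]
    exact ⟨-w, ⟨by simpa using h, by rwa [e]⟩, e⟩
  · exact ⟨w, ⟨h, hp⟩, rfl⟩

theorem smul_mem_coneOver (hw : w ∈ coneOver Ω φ) {t : ℝ} (ht : 0 < t) :
    t • w ∈ coneOver Ω φ := by
  refine ⟨?_, ?_⟩
  · rw [map_smul]
    exact mul_pos ht hw.1
  · rw [toRP_smul ht.ne']
    exact hw.2

/-- Convexity of Ω is given as connectedness of its traces on projective lines. On the line through
u and w, a ratio ψ/φ with ψ(u + w) = 0 has opposite signs at u and w, so it vanishes on the trace of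
Ω. Its only zero on that line is the point of u + w, which therefore lies in Ω. -/
theorem add_mem_coneOver (hΩ : IsProjConvex Ω) (hφ : Ω ⊆ affinePatch φ) (hu : u ∈ coneOver Ω φ)
    (hw : w ∈ coneOver Ω φ) : u + w ∈ coneOver Ω φ := by
  have hu0 := ne_zero_of_mem_coneOver hu
  have hw0 := ne_zero_of_mem_coneOver hw
  have hz : 0 < φ (u + w) := by
    rw [map_add]
    exact add_pos hu.1 hw.1
  have hz0 : u + w ≠ 0 := by
    intro h
    rw [h, map_zero] at hz
    exact hz.false
  refine ⟨hz, ?_⟩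
  by_cases hli : LinearIndependent ℝ ![u, w]
  swap
  · rw [LinearIndependent.pair_iff' hu0] at hli
    push Not at hli
    obtain ⟨t, rfl⟩ := hli
    have h1 := hw.1
    rw [map_smul, smul_eq_mul] at h1
    have ht : 0 < t := (pos_iff_pos_of_mul_pos h1).2 hu.1
    have : u + t • u = (1 + t) • u := by module
    rw [this, toRP_smul (by linarith)]
    exact hu.2
  · set U := Submodule.span ℝ (Set.range ![u, w]) with hU
    have hrank : Module.finrank ℝ U = 2 := by
      rw [hU, finrank_span_eq_card hli, Fintype.card_fin]
    have huU : u ∈ U := Submodule.subset_span ⟨0, rfl⟩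
    have hwU : w ∈ U := Submodule.subset_span ⟨1, rfl⟩
    have hnotin : u ∉ Submodule.span ℝ {u + w} := by
      intro h
      obtain ⟨t, ht⟩ := Submodule.mem_span_singleton.1 h
      have h2 := LinearIndependent.pair_iff.1 hli (t - 1) t (by rw [← sub_eq_zero.2 ht]; module)
      linarith [h2.1, h2.2]
    obtain ⟨ψ, hψu, hψ⟩ := Submodule.exists_dual_map_eq_bot_of_notMem hnotin inferInstance
    have hψz : ψ (u + w) = 0 := by
      have : ψ (u + w) ∈ (Submodule.span ℝ {u + w}).map ψ :=
        Submodule.mem_map_of_mem (Submodule.mem_span_singleton_self _)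
      rwa [hψ, Submodule.mem_bot] at this
    have hψw : ψ w = -ψ u := by
      rw [map_add] at hψz
      linarith
    set f : RP n → ℝ := fun p => ψ p.rep / φ p.rep with hf
    have hft : ∀ v, v ≠ 0 → f (toRP v) = ψ v / φ v := fun v hv => by
      obtain ⟨t, ht, h⟩ := exists_rep_toRP hv
      rw [hf]
      simp only [h, map_smul, smul_eq_mul]
      rw [mul_div_mul_left _ _ ht]
    have hcont : ContinuousOn f (projSubspace U ∩ Ω) := by
      rintro p ⟨-, hp⟩
      obtain ⟨v, hv, rfl⟩ := exists_toRP_eq p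
      refine (continuousAt_of_comp_toRP hv ?_).continuousWithinAt
      have h1 : ContinuousAt (fun x => ψ x / φ x) v :=
        ψ.continuous_of_finiteDimensional.continuousAt.div
          φ.continuous_of_finiteDimensional.continuousAt ((toRP_mem_affinePatch hv).1 (hφ hp))
      refine h1.congr ?_
      filter_upwards [isOpen_ne.mem_nhds hv] with x hx
      exact (hft x hx).symm
    have humem : toRP u ∈ projSubspace U ∩ Ω := ⟨(mem_projSubspace_toRP hu0).2 huU, hu.2⟩
    have hwmem : toRP w ∈ projSubspace U ∩ Ω := ⟨(mem_projSubspace_toRP hw0).2 hwU, hw.2⟩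
    have hpre := hΩ U hrank
    have h0 : (0 : ℝ) ∈ f '' (projSubspace U ∩ Ω) := by
      rcases hψu.lt_or_gt with h | h
      · refine hpre.intermediate_value humem hwmem hcont ⟨?_, ?_⟩
        · rw [hft u hu0]
          exact (div_neg_of_neg_of_pos h hu.1).le
        · rw [hft w hw0, hψw]
          exact (div_pos (by linarith) hw.1).le
      · refine hpre.intermediate_value hwmem humem hcont ⟨?_, ?_⟩
        · rw [hft w hw0, hψw]
          exact (div_neg_of_neg_of_pos (by linarith) hw.1).le
        · rw [hft u hu0]
          exact (div_pos h hu.1).le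
    obtain ⟨p, ⟨hpU, hpΩ⟩, hp⟩ := h0
    obtain ⟨v, hv, rfl⟩ := exists_toRP_eq p
    rw [hft v hv, div_eq_zero_iff, or_iff_left ((toRP_mem_affinePatch hv).1 (hφ hpΩ))] at hp
    have hvU := (mem_projSubspace_toRP hv).1 hpU
    rw [hU, Matrix.range_cons, Matrix.range_cons, Matrix.range_empty, Set.union_empty,
      Set.singleton_union, Submodule.mem_span_pair] at hvU
    obtain ⟨s, t, rfl⟩ := hvU
    rw [map_add, map_smul, map_smul, hψw, smul_eq_mul, smul_eq_mul, mul_neg, ← sub_eq_add_neg,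
      ← sub_mul, mul_eq_zero, or_iff_left hψu, sub_eq_zero] at hp
    subst hp
    rw [← smul_add] at hv hpΩ
    rwa [toRP_smul (smul_ne_zero_iff.1 hv).1] at hpΩ

/-- The closure of Ω lies in the patch, so φ is positive on the compact section ∑ |wᵢ| = 1 of the
closed cone; κ is its minimum there. -/
theorem exists_mul_sum_abs_le (hφ : closure Ω ⊆ affinePatch φ) :
    ∃ κ : ℝ, 0 < κ ∧ ∀ w ∈ coneOver Ω φ, κ * ∑ i, |w i| ≤ φ w := by
  have hcφ : Continuous φ := φ.continuous_of_finiteDimensional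
  set S : Set (Fin (n + 1) → ℝ) := {w | ∑ i, |w i| = 1} with hS
  have hSc : IsCompact S := by
    refine IsCompact.of_isClosed_subset (isCompact_Icc (a := fun _ => -1) (b := fun _ => 1))
      (isClosed_eq (by fun_prop) continuous_const) fun w (hw : ∑ i, |w i| = 1) => ?_
    have h : ∀ i, |w i| ≤ 1 := fun i =>
      hw ▸ Finset.single_le_sum (f := fun i => |w i|) (fun j _ => abs_nonneg _) (Finset.mem_univ i)
    exact ⟨fun i => (abs_le.1 (h i)).1, fun i => (abs_le.1 (h i)).2⟩
  have hpos : ∀ w ∈ closure (coneOver Ω φ) ∩ S, 0 < φ w := by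
    rintro w ⟨hw, hwS⟩
    have hw0 : w ≠ 0 := by
      rintro rfl
      simp [hS] at hwS
    have h1 : 0 ≤ φ w := closure_minimal (fun u hu => hu.1.le)
      (isClosed_le continuous_const hcφ) hw
    have h2 : toRP w ∈ closure Ω :=
      (continuousAt_toRP hw0).continuousWithinAt.mem_closure hw fun u hu => hu.2
    exact lt_of_le_of_ne h1 ((toRP_mem_affinePatch hw0).1 (hφ h2)).symm
  obtain ⟨κ, hκ, hκφ⟩ : ∃ κ : ℝ, 0 < κ ∧ ∀ w ∈ closure (coneOver Ω φ) ∩ S, κ ≤ φ w := by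
    rcases (closure (coneOver Ω φ) ∩ S).eq_empty_or_nonempty with h | h
    · exact ⟨1, one_pos, by simp [h]⟩
    · obtain ⟨w, hw, hmin⟩ := (hSc.inter_left isClosed_closure).exists_isMinOn h hcφ.continuousOn
      exact ⟨φ w, hpos w hw, fun u hu => hmin hu⟩
  refine ⟨κ, hκ, fun w hw => ?_⟩
  have hs : 0 < ∑ i, |w i| := by
    obtain ⟨i, hi⟩ := Function.ne_iff.1 (ne_zero_of_mem_coneOver hw)
    exact Finset.sum_pos' (fun j _ => abs_nonneg _) ⟨i, Finset.mem_univ i, abs_pos.2 hi⟩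
  have h1 := hκφ ((∑ i, |w i|)⁻¹ • w) ⟨subset_closure (smul_mem_coneOver hw (inv_pos.2 hs)), by
    simp only [hS, Set.mem_ofPred_eq, Pi.smul_apply, smul_eq_mul, abs_mul,
      abs_of_pos (inv_pos.2 hs)]
    rw [← Finset.mul_sum, inv_mul_cancel₀ hs.ne']⟩
  rwa [map_smul, smul_eq_mul, le_inv_mul_iff₀ hs, mul_comm] at h1

end ConeOver

/-! ### Normalization of convex cones -/

/-- The linear forms that are nonnegative on `C` and take the value `1` at `v`. -/
def dualSection {n : ℕ} (C : Set (Fin (n + 1) → ℝ)) (v : Fin (n + 1) → ℝ) :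
    Set (Fin (n + 1) → ℝ) :=
  {a | a ⬝ᵥ v = 1 ∧ ∀ w ∈ C, 0 ≤ a ⬝ᵥ w}

section DualSection

variable {n : ℕ} {C : Set (Fin (n + 1) → ℝ)} {v : Fin (n + 1) → ℝ}

theorem exists_add_smul_mem (hC : IsOpen C) (hv : v ∈ C) (z : Fin (n + 1) → ℝ) :
    ∃ s : ℝ, 0 < s ∧ v + s • z ∈ C ∧ v - s • z ∈ C := by
  have hc : Continuous fun s : ℝ => v + s • z := by fun_prop
  have hc' : Continuous fun s : ℝ => v - s • z := by fun_prop
  have h1 : ∀ᶠ s : ℝ in 𝓝 0, v + s • z ∈ C :=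
    (hc.tendsto' 0 v (by simp)).eventually (hC.mem_nhds hv)
  have h2 : ∀ᶠ s : ℝ in 𝓝 0, v - s • z ∈ C :=
    (hc'.tendsto' 0 v (by simp)).eventually (hC.mem_nhds hv)
  obtain ⟨s, ⟨h1, h2⟩, hs⟩ := (((h1.and h2).filter_mono nhdsWithin_le_nhds).and
    (self_mem_nhdsWithin : Set.Ioi (0 : ℝ) ∈ 𝓝[>] 0)).exists
  exact ⟨s, hs, h1, h2⟩

/-- Since v is interior, v ± s eᵢ lies in C for some s > 0; nonnegativity of a form there, together
with its value 1 at v, bounds its i-th coefficient by 1 / s. -/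
theorem isCompact_dualSection (hC : IsOpen C) (hv : v ∈ C) : IsCompact (dualSection C v) := by
  choose s hs h1 h2 using fun i : Fin (n + 1) => exists_add_smul_mem hC hv (Pi.single i 1)
  have hcl : IsClosed (dualSection C v) := by
    have h : dualSection C v = {a | a ⬝ᵥ v = 1} ∩ ⋂ w ∈ C, {a | 0 ≤ a ⬝ᵥ w} := by
      ext a
      simp [dualSection]
    rw [h]
    refine (isClosed_eq (by fun_prop) continuous_const).inter
      (isClosed_biInter fun w _ => isClosed_le continuous_const (by fun_prop))
  refine IsCompact.of_isClosed_subset (isCompact_Icc (a := fun i => -(1 / s i))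
    (b := fun i => 1 / s i)) hcl fun a ha => ?_
  have h3 : ∀ i, -(1 / s i) ≤ a i ∧ a i ≤ 1 / s i := fun i => by
    have h4 := ha.2 _ (h1 i)
    have h5 := ha.2 _ (h2 i)
    rw [dotProduct_add, dotProduct_smul, ha.1, dotProduct_single, mul_one, smul_eq_mul] at h4
    rw [dotProduct_sub, dotProduct_smul, ha.1, dotProduct_single, mul_one, smul_eq_mul] at h5
    have h6 : |a i * s i| ≤ 1 := abs_le.2 ⟨by linarith, by linarith⟩
    rwa [abs_mul, abs_of_pos (hs i), ← le_div_iff₀ (hs i), abs_le] at h6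
  exact ⟨fun i => (h3 i).1, fun i => (h3 i).2⟩

/-- The rows are the perturbations a + sᵢ eᵢ, normalized at v. A kernel vector w satisfies wᵢ = −(a
· w) / sᵢ, whence (a · w)(1 + ∑ aᵢ / sᵢ) = 0 and then w = 0. -/
theorem exists_det_ne_zero {a : Fin (n + 1) → ℝ} {κ : ℝ} (hκ : 0 < κ)
    (ha : ∀ w ∈ C, κ * ∑ i, |w i| ≤ a ⬝ᵥ w) (hv : v ∈ C) (hv0 : v ≠ 0) :
    ∃ A : Matrix (Fin (n + 1)) (Fin (n + 1)) ℝ, (∀ i, A i ∈ dualSection C v) ∧ A.det ≠ 0 := by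
  -- The size κ / 2 keeps the perturbed forms positive on C; the sign is that of aᵢ, so that every
  -- aᵢ / sᵢ is nonnegative.
  set s : Fin (n + 1) → ℝ := fun i => if 0 ≤ a i then κ / 2 else -(κ / 2) with hs
  have hs0 : ∀ i, s i ≠ 0 := fun i => by
    simp only [hs]
    split_ifs <;> simp [hκ.ne']
  have hsa : ∀ i, 0 ≤ a i / s i := fun i => by
    simp only [hs]
    split_ifs with h
    · positivity
    · rw [div_neg, ← neg_div]
      exact div_nonneg (by linarith) (by linarith)
  have hsabs : ∀ i, |s i| = κ / 2 := fun i => by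
    simp only [hs]
    split_ifs
    · exact abs_of_pos (by linarith)
    · rw [abs_neg, abs_of_pos (by linarith)]
  have hle : ∀ w ∈ C, ∀ i, κ / 2 * ∑ j, |w j| ≤ a ⬝ᵥ w + s i * w i := fun w hw i => by
    have h1 := ha w hw
    have h2 : |w i| ≤ ∑ j, |w j| :=
      Finset.single_le_sum (f := fun j => |w j|) (fun j _ => abs_nonneg _) (Finset.mem_univ i)
    have h3 := neg_abs_le (s i * w i)
    rw [abs_mul, hsabs] at h3
    nlinarith
  have hvs : 0 < ∑ i, |v i| := by
    obtain ⟨i, hi⟩ := Function.ne_iff.1 hv0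
    exact Finset.sum_pos' (fun j _ => abs_nonneg _) ⟨i, Finset.mem_univ i, abs_pos.2 hi⟩
  have hden : ∀ i, 0 < a ⬝ᵥ v + s i * v i := fun i =>
    (by positivity : (0 : ℝ) < _).trans_le (hle v hv i)
  set A : Matrix (Fin (n + 1)) (Fin (n + 1)) ℝ :=
    fun i => (a ⬝ᵥ v + s i * v i)⁻¹ • (a + s i • Pi.single i 1) with hA
  have hdot : ∀ i w, A i ⬝ᵥ w = (a ⬝ᵥ v + s i * v i)⁻¹ * (a ⬝ᵥ w + s i * w i) := fun i w => by
    simp only [hA, smul_dotProduct, add_dotProduct, single_dotProduct, one_mul, smul_eq_mul]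
  refine ⟨A, fun i => ⟨?_, fun w hw => ?_⟩, fun hdet => ?_⟩
  · rw [hdot, inv_mul_cancel₀ (hden i).ne']
  · rw [hdot]
    exact mul_nonneg (inv_nonneg.2 (hden i).le)
      ((by positivity : (0 : ℝ) ≤ κ / 2 * ∑ j, |w j|).trans (hle w hw i))
  · obtain ⟨w, hw, h⟩ := Matrix.exists_mulVec_eq_zero_iff.2 hdet
    have h1 : ∀ i, w i = -(a ⬝ᵥ w) / s i := fun i => by
      have h2 : A i ⬝ᵥ w = 0 := congrFun h i
      rw [hdot, mul_eq_zero, or_iff_right (inv_ne_zero (hden i).ne')] at h2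
      rw [eq_div_iff (hs0 i)]
      linarith
    have h2 : a ⬝ᵥ w = -(a ⬝ᵥ w) * ∑ i, a i / s i := by
      conv_lhs => rw [dotProduct]
      rw [Finset.mul_sum]
      refine Finset.sum_congr rfl fun i _ => ?_
      rw [h1 i]
      ring
    have h3 : 0 ≤ ∑ i, a i / s i := Finset.sum_nonneg fun i _ => hsa i
    have h4 : a ⬝ᵥ w * (1 + ∑ i, a i / s i) = 0 := by linarith
    have h5 : a ⬝ᵥ w = 0 := (mul_eq_zero.1 h4).resolve_right (by positivity)
    refine hw (funext fun i => ?_)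
    rw [h1 i, h5, neg_zero, zero_div, Pi.zero_apply]

/-- Forms chosen so as to maximize the determinant bound all the others. -/
theorem exists_forall_neg_sum_le {a : Fin (n + 1) → ℝ} {κ : ℝ} (hκ : 0 < κ)
    (ha : ∀ w ∈ C, κ * ∑ i, |w i| ≤ a ⬝ᵥ w) (hC : IsOpen C) (hv : v ∈ C) (hv0 : v ≠ 0) :
    ∃ A : GL (Fin (n + 1)) ℝ,
      (∀ i, (A : Matrix (Fin (n + 1)) (Fin (n + 1)) ℝ) i ∈ dualSection C v) ∧
      ∀ b ∈ dualSection C v, ∀ w, -∑ i, |(A • w) i| ≤ b ⬝ᵥ w := by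
  obtain ⟨A₀, hA₀, hdet₀⟩ := exists_det_ne_zero hκ ha hv hv0
  have hK : IsCompact {A : Matrix (Fin (n + 1)) (Fin (n + 1)) ℝ | ∀ i, A i ∈ dualSection C v} := by
    have h : {A : Matrix (Fin (n + 1)) (Fin (n + 1)) ℝ | ∀ i, A i ∈ dualSection C v} =
        Set.univ.pi fun _ : Fin (n + 1) => dualSection C v :=
      Set.ext fun A => ⟨fun h i _ => h i, fun h i => h i trivial⟩
    rw [h]
    exact isCompact_univ_pi fun _ : Fin (n + 1) => isCompact_dualSection hC hv
  obtain ⟨A, hA, hmax⟩ := hK.exists_isMaxOn ⟨A₀, hA₀⟩ (f := fun A => |A.det|)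
    (continuous_id.matrix_det.abs).continuousOn
  have hpos : 0 < |A.det| := (abs_pos.2 hdet₀).trans_le (hmax hA₀)
  have hdet : A.det ≠ 0 := abs_pos.1 hpos
  refine ⟨GeneralLinearGroup.mkOfDetNeZero A hdet, hA, fun b hb w => ?_⟩
  -- Replacing a row of A by b keeps all rows in the dual section, so each Cramer determinant is at
  -- most |det A| in absolute value. Hence b is a combination of the rows with coefficients in [−1,
  -- 1].
  set c := cramer Aᵀ b with hc
  have hcle : ∀ i, |c i| ≤ |A.det| := fun i => by
    rw [hc, cramer_transpose_apply]
    refine hmax fun j => ?_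
    rcases eq_or_ne j i with rfl | hij
    · rwa [updateRow_self]
    · rw [updateRow_ne hij]
      exact hA j
  have h1 : A.det * (b ⬝ᵥ w) = c ⬝ᵥ (A *ᵥ w) := by
    have := mulVec_cramer Aᵀ b
    rw [det_transpose, ← hc, mulVec_transpose] at this
    rw [dotProduct_mulVec, this, smul_dotProduct, smul_eq_mul]
  have h2 : |A.det| * |b ⬝ᵥ w| ≤ |A.det| * ∑ i, |(A *ᵥ w) i| := by
    rw [← abs_mul, h1, Finset.mul_sum]
    refine (Finset.abs_sum_le_sum_abs _ _).trans (Finset.sum_le_sum fun i _ => ?_)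
    rw [abs_mul]
    exact mul_le_mul_of_nonneg_right (hcle i) (abs_nonneg _)
  have h3 := le_of_mul_le_mul_left h2 hpos
  exact (neg_le_neg h3).trans (neg_abs_le _)

/-- Separate w from C by f with f < f(w) on C. Homogeneity gives f ≤ 0 on C and f(w) ≥ 0, openness
gives f(v) < 0, and f / f(v) is the required form. -/
theorem exists_dualSection_nonpos (hC : IsOpen C) (hadd : ∀ u ∈ C, ∀ w ∈ C, u + w ∈ C)
    (hsmul : ∀ w ∈ C, ∀ t : ℝ, 0 < t → t • w ∈ C) (hv : v ∈ C) {w : Fin (n + 1) → ℝ} (hw : w ∉ C) :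
    ∃ b ∈ dualSection C v, b ⬝ᵥ w ≤ 0 := by
  have hconv : Convex ℝ C := by
    intro x hx y hy s t hs ht hst
    rcases hs.eq_or_lt with rfl | hs
    · simpa [show t = 1 by linarith] using hy
    · rcases ht.eq_or_lt with rfl | ht
      · simpa [show s = 1 by linarith] using hx
      · exact hadd _ (hsmul x hx s hs) _ (hsmul y hy t ht)
  obtain ⟨f, hf⟩ := geometric_hahn_banach_open_point hconv hC hw
  have hnp : ∀ u ∈ C, f u ≤ 0 := fun u hu => by
    by_contra! h
    have h1 := hf _ (hsmul u hu ((|f w| + 1) / f u) (by positivity))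
    rw [map_smul, smul_eq_mul, div_mul_cancel₀ _ h.ne'] at h1
    have := le_abs_self (f w)
    linarith
  have hfw : 0 ≤ f w := by
    by_contra! h
    have h1 := hf _ (hsmul v hv (-f w / (1 + |f v|)) (div_pos (by linarith) (by positivity)))
    rw [map_smul, smul_eq_mul, div_mul_eq_mul_div, div_lt_iff₀ (by positivity)] at h1
    have := neg_abs_le (f v)
    nlinarith
  have hfv : f v < 0 := by
    refine lt_of_le_of_ne (hnp v hv) fun h => ?_
    obtain ⟨s, hs, h1, -⟩ := exists_add_smul_mem hC hv w
    have h2 := hnp _ h1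
    rw [map_add, h, zero_add, map_smul, smul_eq_mul] at h2
    have h3 : f w = 0 := by nlinarith
    have h4 := hf v hv
    linarith
  have hdot : ∀ u, (fun i => f (Pi.single i 1) / f v) ⬝ᵥ u = f u / f v := fun u => by
    have h1 : u = ∑ i, u i • (Pi.single i (1 : ℝ) : Fin (n + 1) → ℝ) := by
      ext j
      simp [Finset.sum_apply, Pi.single_apply]
    conv_rhs => rw [h1, map_sum]
    rw [dotProduct, Finset.sum_div]
    refine Finset.sum_congr rfl fun i _ => ?_
    rw [map_smul, smul_eq_mul]
    ring
  refine ⟨_, ⟨(hdot v).trans (div_self hfv.ne), fun u hu => ?_⟩, ?_⟩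
  · rw [hdot]
    exact div_nonneg_of_nonpos (hnp u hu) hfv.le
  · rw [hdot]
    exact div_nonpos_of_nonneg_of_nonpos hfw hfv.le

/-- **Benzécri's theorem**: a sharp open convex cone with a marked vector can be normalized by a
linear map. -/
theorem exists_isNormalizedConeFunction {a : Fin (n + 1) → ℝ} {κ : ℝ} (hκ : 0 < κ)
    (ha : ∀ w ∈ C, κ * ∑ i, |w i| ≤ a ⬝ᵥ w) (hC : IsOpen C)
    (hadd : ∀ u ∈ C, ∀ w ∈ C, u + w ∈ C) (hsmul : ∀ w ∈ C, ∀ t : ℝ, 0 < t → t • w ∈ C)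
    (hv : v ∈ C) (hv0 : v ≠ 0) :
    ∃ (A : GL (Fin (n + 1)) ℝ) (F : (Fin (n + 1) → ℝ) → ℝ), IsNormalizedConeFunction F ∧
      A • v = 1 ∧ ∀ w, 0 < F (A • w) ↔ w ∈ C := by
  obtain ⟨A, hA, hle⟩ := exists_forall_neg_sum_le hκ ha hC hv hv0
  have hAv : A • v = 1 := funext fun i => (hA i).1
  -- The infimum of all the forms of the dual section, in the new coordinates. The rows of A are
  -- among them, which gives F w ≤ wᵢ; maximality of the determinant gives the lower bound, and the
  -- normalization at v gives F 1 ≥ 1.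
  set F : (Fin (n + 1) → ℝ) → ℝ :=
    fun u => ⨅ b : dualSection C v, (b : Fin (n + 1) → ℝ) ⬝ᵥ (A⁻¹ • u) with hF
  have : Nonempty (dualSection C v) := ⟨⟨_, hA 0⟩⟩
  have hlow : ∀ u (b : dualSection C v),
      -∑ i, |u i| ≤ (b : Fin (n + 1) → ℝ) ⬝ᵥ (A⁻¹ • u) := fun u b => by
    simpa using hle b b.2 (A⁻¹ • u)
  have hbdd : ∀ u, BddBelow
      (Set.range fun b : dualSection C v => (b : Fin (n + 1) → ℝ) ⬝ᵥ (A⁻¹ • u)) :=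
    fun u => ⟨_, Set.forall_mem_range.2 (hlow u)⟩
  have hFle : ∀ u, ∀ b ∈ dualSection C v, F u ≤ b ⬝ᵥ (A⁻¹ • u) := fun u b hb =>
    ciInf_le (hbdd u) ⟨b, hb⟩
  refine ⟨A, F, ⟨fun u w => le_ciInf fun b => ?_, fun t ht w => ?_, fun w i => ?_,
    fun w => le_ciInf (hlow w), le_ciInf fun b => ?_⟩, hAv, fun w => ⟨fun h => ?_, fun h => ?_⟩⟩
  · rw [smul_add, dotProduct_add]
    exact add_le_add (hFle u b b.2) (hFle w b b.2)
  · rw [hF]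
    simp only [smul_comm A⁻¹ t, dotProduct_smul, smul_eq_mul]
    rw [Real.mul_iInf_of_nonneg ht.le]
  · refine (hFle w _ (hA i)).trans_eq ?_
    change (A • A⁻¹ • w) i = w i
    rw [smul_inv_smul]
  · rw [← hAv, inv_smul_smul, b.2.1]
  · by_contra hw
    obtain ⟨b, hb, hbw⟩ := exists_dualSection_nonpos hC hadd hsmul hv hw
    have := hFle (A • w) b hb
    rw [inv_smul_smul] at this
    linarith
  · obtain ⟨s, hs, -, h1⟩ := exists_add_smul_mem hC h v
    refine hs.trans_le (le_ciInf fun b => ?_)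
    have h2 := b.2.2 _ h1
    rw [dotProduct_sub, dotProduct_smul, b.2.1, smul_eq_mul, mul_one] at h2
    rw [inv_smul_smul]
    linarith

end DualSection

/-! ### Thick models of pointed manifolds -/

theorem IsConeFunction.comp_smul {n : ℕ} {F : (Fin (n + 1) → ℝ) → ℝ} (hF : IsConeFunction F)
    (A : GL (Fin (n + 1)) ℝ) : IsConeFunction fun w => F (A • w) where
  add_le u w := by
    simp only [smul_add]
    exact hF.add_le _ _
  apply_smul t ht w := by
    simp only [smul_comm A t]
    exact hF.apply_smul t ht _
  cont := hF.cont.comp (continuous_GL_smul A)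
  sharp w hw h := by
    simp only [smul_neg]
    exact hF.sharp _ ((smul_ne_zero_iff_ne A).2 hw) h

theorem coneDist_comp_smul {n : ℕ} (F : (Fin (n + 1) → ℝ) → ℝ) (A : GL (Fin (n + 1)) ℝ)
    (a b : Fin (n + 1) → ℝ) :
    coneDist (fun w => F (A • w)) a b = coneDist F (A • a) (A • b) := by
  have h : ∀ (t : ℝ) (a b : Fin (n + 1) → ℝ), A • (t • b - a) = t • A • b - A • a := fun t a b => by
    rw [smul_sub, smul_comm A t]
  simp only [coneDist, relMax, h]

/-- The group of the linear lifts of elements of `Γ` that preserve the cone `0 < F`. -/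
def ProperlyConvexManifold.liftGroup {n : ℕ} (M : ProperlyConvexManifold n)
    (F : (Fin (n + 1) → ℝ) → ℝ) : Subgroup (GL (Fin (n + 1)) ℝ) where
  carrier := {g | (∀ w, 0 < F w → 0 < F (g • w)) ∧ (∀ w, 0 < F w → 0 < F (g⁻¹ • w)) ∧
    (ProjGenLinGroup.mk g : PGroup n) ∈ M.Γ}
  mul_mem' := by
    rintro g h ⟨h1, h2, h3⟩ ⟨k1, k2, k3⟩
    refine ⟨fun w hw => ?_, fun w hw => ?_, ?_⟩
    · rw [mul_smul]
      exact h1 _ (k1 _ hw)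
    · rw [_root_.mul_inv_rev, mul_smul]
      exact k2 _ (h2 _ hw)
    · rw [map_mul]
      exact M.Γ.mul_mem h3 k3
  one_mem' := ⟨fun w hw => by rwa [one_smul], fun w hw => by rwa [inv_one, one_smul],
    by rw [map_one]; exact M.Γ.one_mem⟩
  inv_mem' := by
    rintro g ⟨h1, h2, h3⟩
    refine ⟨h2, by rwa [inv_inv], ?_⟩
    rw [map_inv]
    exact M.Γ.inv_mem h3

/-- A linear lift g of an element of Γ maps the cone into itself or its negative, pointwise. The
sign is constant: if g v and −g w were both in the cone, some positive combination of v and w would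
be sent into the kernel of φ, yet φ vanishes nowhere on the cone and its negative. So g or −g
preserves the cone. -/
theorem ProperlyConvexManifold.uniformizes_liftGroup {n : ℕ} (M : ProperlyConvexManifold n)
    {F : (Fin (n + 1) → ℝ) → ℝ} (hF : IsConeFunction F) (hΩ : M.Ω = projCone F)
    {v : Fin (n + 1) → ℝ} (hv : 0 < F v) : Uniformizes M F (M.liftGroup F) := by
  obtain ⟨φ, hφ⟩ : ∃ φ : Module.Dual ℝ (Fin (n + 1) → ℝ), ∀ w, w ≠ 0 → 0 ≤ F w → 0 < φ w := by
    obtain ⟨φ, -, h⟩ := M.properlyConvex.2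
    rw [hΩ] at h
    exact (hF.dual_pos_or_neg hv h).elim (fun h => ⟨φ, h⟩) fun h => ⟨-φ, h⟩
  have hcase : ∀ g : GL (Fin (n + 1)) ℝ, (ProjGenLinGroup.mk g : PGroup n) ∈ M.Γ →
      ∀ w, 0 < F w → 0 < F (g • w) ∨ 0 < F (-(g • w)) := by
    intro g hg w hw
    have h1 : (ProjGenLinGroup.mk g : PGroup n) • toRP w ∈ M.Ω := by
      rw [← M.preserves _ hg]
      exact ⟨_, hΩ ▸ ⟨w, hw, rfl⟩, rfl⟩
    rw [mk_smul_toRP g (hF.ne_zero hw), hΩ] at h1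
    exact (hF.toRP_mem ((smul_ne_zero_iff_ne g).2 (hF.ne_zero hw))).1 h1
  have hmem : ∀ g : GL (Fin (n + 1)) ℝ, (ProjGenLinGroup.mk g : PGroup n) ∈ M.Γ →
      0 < F (g • v) → g ∈ M.liftGroup F := by
    intro g hg hgv
    have hpos : ∀ w, 0 < F w → 0 < F (g • w) := by
      intro w hw
      refine (hcase g hg w hw).resolve_right fun hneg => ?_
      have h1 : 0 < φ (g • v) := hφ _ (hF.ne_zero hgv) hgv.le
      have h2 : 0 < φ (-(g • w)) := hφ _ (hF.ne_zero hneg) hneg.le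
      have hz := hF.pos_add_smul (hF.smul_pos hv h2).le hw h1
      have h0 : φ (g • (φ (-(g • w)) • v + φ (g • v) • w)) = 0 := by
        have h3 : g • (φ (-(g • w)) • v + φ (g • v) • w) =
            φ (-(g • w)) • g • v + φ (g • v) • g • w := by
          rw [smul_add, smul_comm g (φ (-(g • w))) v, smul_comm g (φ (g • v)) w]
        rw [h3, map_add, φ.map_smul, φ.map_smul, map_neg, smul_eq_mul, smul_eq_mul]
        ring
      rcases hcase g hg _ hz with h | h
      · exact (hφ _ (hF.ne_zero h) h.le).ne' h0
      · have := hφ _ (hF.ne_zero h) h.le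
        rw [map_neg, h0, neg_zero] at this
        exact this.false
    refine ⟨hpos, fun w hw => ?_, hg⟩
    refine (hcase g⁻¹ (by rw [map_inv]; exact M.Γ.inv_mem hg) w hw).resolve_right fun h => ?_
    have h1 := hpos _ h
    rw [smul_neg, smul_inv_smul] at h1
    exact h1.not_gt (hF.neg_neg_of_pos hw)
  refine ⟨hF, hΩ, le_antisymm (fun γ hγ => ?_) ?_, fun g hg => hg.1, fun t ht => hmem _ ?_ ?_⟩
  · obtain ⟨g, rfl⟩ := ProjGenLinGroup.mk_surjective γ
    rcases hcase g hγ v hv with h | h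
    · exact ⟨g, hmem g hγ h, rfl⟩
    · have e : (ProjGenLinGroup.mk (GeneralLinearGroup.scalar (Fin (n + 1)) (-1 : ℝˣ) * g) :
          PGroup n) = ProjGenLinGroup.mk g := by
        rw [map_mul, ProjGenLinGroup.mk_scalar, one_mul]
      refine ⟨_, hmem _ (e ▸ hγ) ?_, e⟩
      rw [mul_smul, scalar_smul]
      simpa using h
  · rintro _ ⟨g, hg, rfl⟩
    exact hg.2.2
  · rw [ProjGenLinGroup.mk_scalar]
    exact M.Γ.one_mem
  · rw [scalar_smul]
    exact hF.smul_pos hv ht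

/-- The marked cone over a pointed properly convex set can be normalized. -/
theorem ProperlyConvexManifold.exists_normalization {n : ℕ} (M : ProperlyConvexManifold n)
    (x : M.Space) : ∃ (A : GL (Fin (n + 1)) ℝ) (F : (Fin (n + 1) → ℝ) → ℝ),
      IsNormalizedConeFunction F ∧ M.Ω = projCone (fun w => F (A • w)) ∧
      M.conePt x (A⁻¹ • 1) = x := by
  obtain ⟨p, hp⟩ : ∃ p, M.proj p = x := Quotient.exists_rep x
  obtain ⟨φ, -, hφ⟩ := M.properlyConvex.2
  have hφΩ : M.Ω ⊆ affinePatch φ := subset_closure.trans hφ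
  obtain ⟨κ, hκ, hle⟩ := exists_mul_sum_abs_le hφ
  have hpm : (p : RP n) ∈ toRP '' coneOver M.Ω φ := by
    rw [toRP_image_coneOver hφΩ]
    exact p.2
  obtain ⟨v, hv, hvp⟩ := hpm
  have hdot : ∀ w : Fin (n + 1) → ℝ, (fun i => φ (Pi.single i 1)) ⬝ᵥ w = φ w := fun w => by
    have h1 : w = ∑ i, w i • (Pi.single i (1 : ℝ) : Fin (n + 1) → ℝ) := by
      ext j
      simp [Finset.sum_apply, Pi.single_apply]
    conv_rhs => rw [h1, map_sum]
    refine Finset.sum_congr rfl fun i _ => ?_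
    rw [map_smul, smul_eq_mul, mul_comm]
  obtain ⟨A, F, hF, hAv, hFC⟩ := exists_isNormalizedConeFunction (C := coneOver M.Ω φ) hκ
    (fun w hw => (hle w hw).trans_eq (hdot w).symm) (isOpen_coneOver M.isOpen)
    (fun u hu w hw => add_mem_coneOver M.properlyConvex.1 hφΩ hu hw)
    (fun w hw t ht => smul_mem_coneOver hw ht) hv (ne_zero_of_mem_coneOver hv)
  refine ⟨A, F, hF, ?_, ?_⟩
  · rw [projCone, show {w | 0 < F (A • w)} = coneOver M.Ω φ from Set.ext hFC,
      toRP_image_coneOver hφΩ]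
  · rw [← hAv, inv_smul_smul, ← hp, ProperlyConvexManifold.conePt, dif_pos (hvp ▸ p.2)]
    exact congrArg M.proj (Subtype.ext hvp)

/-- Conjugating the lifted group by Benzécri's normalizing map A gives the group of the model; A
takes a lift of the base point to (1, …, 1). -/
theorem exists_isThickModel_of_mem {n : ℕ} {ε : ℝ} (hε : 0 < ε) {c : PointedIsometryClass}
    (hc : c ∈ thickPointed n ε) :
    ∃ X F G P, X.isomClass = c ∧ IsThickModel (n := n) ε X F G P := by
  obtain ⟨X, M, x, rfl, hinj, e, hex, he⟩ := hc
  obtain ⟨A, F, hF, hΩ, hx⟩ := M.exists_normalization x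
  have hC := hF.isConeFunction
  set F' : (Fin (n + 1) → ℝ) → ℝ := fun w => F (A • w) with hF'
  have hv : 0 < F' (A⁻¹ • 1) := by
    simp only [hF', smul_inv_smul]
    exact hF.one_pos
  have hU := M.uniformizes_liftGroup (hC.comp_smul A) hΩ hv
  have hpos : ∀ w, 0 < F w → 0 < F' (A⁻¹ • w) := fun w hw => by
    simpa only [hF', smul_inv_smul] using hw
  have hd : ∀ a b, coneDist F' (A⁻¹ • a) (A⁻¹ • b) = coneDist F a b := fun a b => by
    rw [hF', coneDist_comp_smul, smul_inv_smul, smul_inv_smul]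
  set G := (M.liftGroup F').map (MulAut.conj A).toMonoidHom with hG
  have hGmem : ∀ k, k ∈ G ↔ ∃ g ∈ M.liftGroup F', A * g * A⁻¹ = k := fun k => Iff.rfl
  have hconj : ∀ (g : GL (Fin (n + 1)) ℝ) (w : Fin (n + 1) → ℝ),
      A⁻¹ • (A * g * A⁻¹) • w = g • A⁻¹ • w := fun g w => by
    rw [mul_smul, mul_smul, inv_smul_smul]
  have hcen : ∀ g : GL (Fin (n + 1)) ℝ, A * g * A⁻¹ ∈ Subgroup.center _ ↔ g ∈ Subgroup.center _ :=
    fun g => ((Subgroup.center _).normal_of_characteristic.mem_comm_iff.trans (by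
      rw [← mul_assoc, inv_mul_cancel, one_mul]))
  refine ⟨X, F, G, fun w => e.symm (M.conePt x (A⁻¹ • w)), rfl,
    ⟨hF, ?_, ?_, ?_, ?_⟩, ?_, ?_, ?_, ?_, ?_⟩
  · rintro _ ⟨g, hg, rfl⟩ w hw
    have := hg.1 _ (hpos w hw)
    change 0 < F ((A * g * A⁻¹) • w)
    rwa [mul_smul, mul_smul]
  · intro t ht
    refine ⟨_, hU.scalar_mem t ht, ?_⟩
    have h1 : GeneralLinearGroup.scalar (Fin (n + 1)) t ∈ Subgroup.center (GL (Fin (n + 1)) ℝ) := by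
      rw [GeneralLinearGroup.center_eq_range_scalar]
      exact ⟨t, rfl⟩
    change A * _ * A⁻¹ = _
    rw [Subgroup.mem_center_iff.1 h1 A, mul_inv_cancel_right]
  · rintro _ ⟨g, hg, rfl⟩ w hw hd1 hd2
    change coneDist F 1 ((A * g * A⁻¹) • w) < ε at hd2
    change A * g * A⁻¹ ∈ _
    set k := A * g * A⁻¹ with hk
    have hkpos : ∀ u, 0 < F u → 0 < F (k • u) := fun u hu => by
      have := hg.1 _ (hpos u hu)
      rwa [hk, mul_smul, mul_smul]
    -- The injectivity radius is a supremum that need not be attained, so an embedded radius r is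
    -- chosen that exceeds both distances.
    have hlt : ENNReal.ofReal (max (coneDist F 1 w) (coneDist F 1 (k • w))) < M.inj x :=
      ((ENNReal.ofReal_lt_ofReal_iff hε).2 (max_lt hd1 hd2)).trans_le hinj
    obtain ⟨r, hlt⟩ := lt_iSup_iff.1 hlt
    obtain ⟨hr, hlt⟩ := lt_iSup_iff.1 hlt
    rw [ENNReal.ofReal_lt_coe_iff (le_max_of_le_left (hC.coneDist_nonneg hF.one_pos hw)),
      max_lt_iff] at hlt
    -- For all u near w, both u and k u stay in the embedded ball and have the same image in M, so
    -- they span the same line. Thus k has an open set of eigenvectors and is scalar; no separate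
    -- argument that Γ acts freely is needed.
    refine mem_center_of_isOpen (((hF.isOpen_ball hF.one_pos r).inter
      ((hF.isOpen_ball hF.one_pos r).preimage (continuous_GL_smul k))))
      ⟨w, ⟨hw, hlt.1⟩, hkpos w hw, hlt.2⟩ ?_
    rintro u ⟨⟨hu, hu1⟩, hku, hku1⟩
    have hu' := hpos u hu
    have hku' := hpos _ hku
    have h1 := hr ⟨toRP (A⁻¹ • 1), hU.toRP_mem hv⟩ (by rw [← hU.conePt_eq x hv, hx])
      (x₁ := ⟨toRP (A⁻¹ • u), hU.toRP_mem hu'⟩)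
      (by
        change hilbertDist M.Ω (toRP (A⁻¹ • 1)) (toRP (A⁻¹ • u)) < r
        rwa [hU.hilbertDist_eq hv hu', hd])
      (x₂ := ⟨toRP (A⁻¹ • k • u), hU.toRP_mem hku'⟩)
      (by
        change hilbertDist M.Ω (toRP (A⁻¹ • 1)) (toRP (A⁻¹ • k • u)) < r
        rwa [hU.hilbertDist_eq hv hku', hd])
      ((hU.proj_eq_iff hu' hku').2 ⟨g, hg, (hconj g u).symm⟩)
    obtain ⟨t, ht, h⟩ := (hU.cone.toRP_eq_iff_pos hku' hu').1 (congrArg Subtype.val h1).symm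
    refine ⟨t, ?_⟩
    have h2 := congrArg (A • ·) h
    simpa only [smul_comm A t, smul_inv_smul, eq_comm] using h2
  · rintro _ ⟨g, hg, rfl⟩ m hm hgm
    change (A * g * A⁻¹) ^ m ∈ _ at hgm
    change A * g * A⁻¹ ∈ _
    rw [conj_pow, hcen, ← ProjGenLinGroup.mk_eq_one, map_pow] at hgm
    rw [hcen, ← ProjGenLinGroup.mk_eq_one]
    exact M.torsionFree _ hg.2.2 (isOfFinOrder_iff_pow_eq_one.2 ⟨m, Nat.pos_of_ne_zero hm, hgm⟩)
  · intro p
    obtain ⟨w, hw, h⟩ := hU.exists_conePt_eq x (e p)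
    refine ⟨A • w, hw, ?_⟩
    rw [inv_smul_smul, h, e.symm_apply_apply]
  · rw [hx, ← hex, e.symm_apply_apply]
  · intro w w' hw hw'
    rw [e.symm.injective.eq_iff, hU.conePt_eq_iff x (hpos w hw) (hpos w' hw')]
    constructor
    · rintro ⟨g, hg, h⟩
      refine ⟨_, ⟨g, hg, rfl⟩, ?_⟩
      change (A * g * A⁻¹) • w = w'
      rw [mul_smul, mul_smul, h, smul_inv_smul]
    · rintro ⟨_, ⟨g, hg, rfl⟩, h⟩
      exact ⟨g, hg, by rw [← hconj]; exact congrArg (A⁻¹ • ·) h⟩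
  · intro w w' hw hw'
    rw [he, e.apply_symm_apply, e.apply_symm_apply, ← hd]
    exact hU.mDist_le x (hpos w hw) (hpos w' hw')
  · intro w w' hw hw' η hη
    obtain ⟨g, hg, h⟩ := hU.exists_coneDist_lt x (hpos w hw) (hpos w' hw') hη
    refine ⟨_, ⟨g, hg, rfl⟩, ?_⟩
    rw [he, e.apply_symm_apply, e.apply_symm_apply]
    change coneDist F w ((A * g * A⁻¹) • w') < _
    rwa [← hd, hconj]

end ConvexProjective

end

theorem mainTheorem11 (n : ℕ) (ε : ℝ) (hε : 0 < ε) :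
    IsCompact (ConvexProjective.thickPointed n ε) :=
  ConvexProjective.isCompact_thickPointed_of_exists_model hε fun _ hc =>
    ConvexProjective.exists_isThickModel_of_mem hε hc
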